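/- Let $G$ be a (finite-dimensional, Hausdorff) Lie group acting smoothly and properly, with finite isotropy groups, on a smooth (Hausdorff, second countable) manifold $M$ such that $X=M/G$ is compact; for instance, $G$ is a compact Lie group acting smoothly and with finite isotropy groups on a compact manifold $M$. A slice chart of the action is a triple $(V,H,\varphi)$, where $V$ is a connected (non-empty) open subset of $\mathbb R^{\dim M-\dim G}$, $H\subset G$ is a finite subgroup acting smoothly on $V$, and $\varphi:V\to M$ is $H$-equivariant and such that $(g,v)\mapsto g\varphi(v)$ induces a diffeomorphism of $G\times_H V$ onto an open subset of $M$. An injection $(V,H,\varphi)\to(V',H',\varphi')$ consists of an open smooth embedding $i:V\to V'$, a smooth map $a:V\to G$ with $a(v)\varphi(v)=\varphi'(i(v))$, and an injective homomorphism $\lambda:H\to H'$ with $a(hv)h=\lambda(h)a(v)$. The slice charts $V\to V/H\subset X$ and their injections make $X$ an orbifold (the quotient orbifold; the action need not be effective). A complex orbifold vector bundle $E$ on $X$ consists of a (finite rank, continuous) complex vector bundle $E_V\to V$ for every chart and, for every injection $i:V\to V'$, a bundle map $E_V\to E_{V'}$ over $i$ that is isomorphic on the fibres, such that the map of a composite of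 injections is the composite of the maps; an isomorphism is a family of isomorphisms $E_V\cong E'_V$ that commutes with these maps. Let $K_{orb}(X)$ be the Grothendieck group of the monoid (under $\oplus$) of isomorphism classes of complex orbifold vector bundles on $X$, and let $K_G(M)$ be the Grothendieck group of the monoid of isomorphism classes of $G$-equivariant complex vector bundles on $M$. (Ranks are finite and locally constant.) Then pull-back along the projection $p:M\to X$ is defined on orbifold vector bundles: each $E$ on $X$ has a pull-back $p^*E$, a $G$-equivariant vector bundle on $M$ with a $G$-invariant bundle map $p^*E\to E$ covering $p$ (that is, isomorphisms $(p^*E)_{g\varphi(v)}\cong (E_V)_v$ for all slice charts, $g\in G$, $v\in V$, which depend continuously on $(g,v)$ and are compatible with the injections), and $p^*E\cong p^*E'$ if $E\cong E'$; so $p^*E$ is unique up to isomorphism. It induces an isomorphism of groups $$p^*:K_{orb}(X)\to K_G(M),\qquad [E]\mapsto[p^*E],$$ whose inverse sends $[F]$ to $[F/G]$, where $F/G$ is the orbifold vector bundle on $X$ given by $\varphi^*F$ over a slice chart $(V,H,\varphi)$, an injection with $a:V\to G$ acting by $F_{\varphi(v)}\to F_{a(v)\varphi(v)}=F_{\varphi'(i(v))}$,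 $\xi\mapsto a(v)\xi$. -/

import Mathlib

open scoped Manifold ContDiff
open TopologicalSpace

/-! ## Complex vector bundles -/

/-- The disjoint union of a family of fibres over `B`, as a bare type: no topology is attached. -/
structure TotalOf {B : Type*} (fiber : B → Type) where
  proj : B
  snd : fiber proj

theorem TotalOf.mk_prod_eq {B : Type*} {P Q : B → Type} {x y : B} {p : P x} {q : Q x} {p' : P y}
    {q' : Q y} (h : (⟨x, p⟩ : TotalOf P) = ⟨y, p'⟩) (h' : (⟨x, q⟩ : TotalOf Q) = ⟨y, q'⟩) :
    (⟨x, (p, q)⟩ : TotalOf fun b => P b × Q b) = ⟨y, (p', q')⟩ := by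
  cases h
  cases h'
  rfl

theorem TotalOf.mk_eq_of_const {B : Type*} {P : Type} {x y : B} {p : P} (h : x = y) :
    (⟨x, p⟩ : TotalOf fun _ : B => P) = ⟨y, p⟩ := by
  cases h
  rfl

/-- A complex vector bundle of finite, locally constant rank over a topological space `B`.
It is given by its fibres (complex vector spaces; a universe-zero model loses nothing, the fibres
being finite-dimensional) and a topology on its total space; every point of `B` has an open
neighbourhood `U` over which the bundle is isomorphic to `U × ℂᵏ`. -/
structure ComplexVectorBundle (B : Type*) [TopologicalSpace B] where
  fiber : B → Type
  [addCommGroup : ∀ x, AddCommGroup (fiber x)]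
  [module : ∀ x, Module ℂ (fiber x)]
  [topology : TopologicalSpace (TotalOf fiber)]
  continuous_proj : Continuous (TotalOf.proj : TotalOf fiber → B)
  locally_trivial : ∀ x : B, ∃ (U : Opens B) (k : ℕ) (φ : ∀ y : U, fiber y ≃ₗ[ℂ] (Fin k → ℂ)),
    x ∈ U ∧
    Continuous (fun e : {e : TotalOf fiber // e.proj ∈ U} =>
      φ ⟨e.1.proj, e.2⟩ e.1.snd) ∧
    Continuous (fun p : U × (Fin k → ℂ) =>
      (⟨p.1, (φ p.1).symm p.2⟩ : TotalOf fiber))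

namespace ComplexVectorBundle

attribute [instance] ComplexVectorBundle.addCommGroup ComplexVectorBundle.module
  ComplexVectorBundle.topology

/-- The total space of a complex vector bundle. -/
abbrev Total {B : Type*} [TopologicalSpace B] (E : ComplexVectorBundle B) : Type _ :=
  TotalOf E.fiber

/-- An isomorphism of complex vector bundles over the identity of the base. -/
structure Iso {B : Type*} [TopologicalSpace B] (E E' : ComplexVectorBundle B) where
  equiv : ∀ x, E.fiber x ≃ₗ[ℂ] E'.fiber x
  continuous_equiv : Continuous (fun e : E.Total => (⟨e.proj, equiv e.proj e.snd⟩ : E'.Total))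
  continuous_symm :
    Continuous (fun e : E'.Total => (⟨e.proj, (equiv e.proj).symm e.snd⟩ : E.Total))

namespace Iso

variable {B : Type*} [TopologicalSpace B] {E₁ E₂ E₃ : ComplexVectorBundle B}

/-- The identity isomorphism. -/
def refl (E : ComplexVectorBundle B) : Iso E E where
  equiv _ := LinearEquiv.refl ℂ _
  continuous_equiv := continuous_id
  continuous_symm := continuous_id

/-- The inverse isomorphism. -/
def symm (f : Iso E₁ E₂) : Iso E₂ E₁ where
  equiv x := (f.equiv x).symm
  continuous_equiv := f.continuous_symm
  continuous_symm := f.continuous_equiv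

/-- The composite of two isomorphisms. -/
def trans (f : Iso E₁ E₂) (g : Iso E₂ E₃) : Iso E₁ E₃ where
  equiv x := (f.equiv x).trans (g.equiv x)
  continuous_equiv := g.continuous_equiv.comp f.continuous_equiv
  continuous_symm := f.continuous_symm.comp g.continuous_symm

end Iso

variable {B : Type*} [TopologicalSpace B]

/-- The bundle of rank zero. -/
def zero (B : Type*) [TopologicalSpace B] : ComplexVectorBundle B where
  fiber _ := PUnit
  topology := TopologicalSpace.induced TotalOf.proj inferInstance
  continuous_proj := continuous_induced_dom
  locally_trivial x := by
    let _ : TopologicalSpace (TotalOf fun _ : B => PUnit) :=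
      TopologicalSpace.induced TotalOf.proj inferInstance
    refine ⟨⊤, 0, fun _ => 0, trivial, continuous_const, ?_⟩
    exact continuous_induced_rng.2 (continuous_subtype_val.comp continuous_fst)

/-- The two projections of the total space of a direct sum. -/
def sumProj (E E' : ComplexVectorBundle B)
    (e : TotalOf (fun x => E.fiber x × E'.fiber x)) : E.Total × E'.Total :=
  (⟨e.proj, e.snd.1⟩, ⟨e.proj, e.snd.2⟩)

/-- The direct sum of two complex vector bundles; its total space is the fibre product of the
two total spaces. -/
def sum (E E' : ComplexVectorBundle B) : ComplexVectorBundle B where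
  fiber x := E.fiber x × E'.fiber x
  topology := TopologicalSpace.induced (sumProj E E') inferInstance
  continuous_proj := by
    let _ : TopologicalSpace (TotalOf fun x => E.fiber x × E'.fiber x) :=
      TopologicalSpace.induced (sumProj E E') inferInstance
    have h : Continuous (sumProj E E') := continuous_induced_dom
    exact E.continuous_proj.comp (continuous_fst.comp h)
  locally_trivial x := by
    let _ : TopologicalSpace (TotalOf fun x => E.fiber x × E'.fiber x) :=
      TopologicalSpace.induced (sumProj E E') inferInstance
    have h : Continuous (sumProj E E') := continuous_induced_dom
    obtain ⟨U, k, φ, hx, h1, h2⟩ := E.locally_trivial x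
    obtain ⟨U', k', φ', hx', h1', h2'⟩ := E'.locally_trivial x
    let ψ : ((Fin k → ℂ) × (Fin k' → ℂ)) ≃ₗ[ℂ] (Fin (k + k') → ℂ) :=
      (LinearEquiv.sumArrowLequivProdArrow (Fin k) (Fin k') ℂ ℂ).symm.trans
        (LinearEquiv.funCongrLeft ℂ ℂ finSumFinEquiv.symm)
    have hψ : Continuous ψ := ψ.toLinearMap.continuous_of_finiteDimensional
    have hψ' : Continuous ψ.symm := ψ.symm.toLinearMap.continuous_of_finiteDimensional
    refine ⟨U ⊓ U', k + k', fun y =>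
      ((φ ⟨y.1, y.2.1⟩).prodCongr (φ' ⟨y.1, y.2.2⟩)).trans ψ, ⟨hx, hx'⟩, ?_, ?_⟩
    · refine hψ.comp (Continuous.prodMk ?_ ?_)
      · exact h1.comp (Continuous.subtype_mk
          (continuous_fst.comp (h.comp continuous_subtype_val)) (fun e => e.2.1))
      · exact h1'.comp (Continuous.subtype_mk
          (continuous_snd.comp (h.comp continuous_subtype_val)) (fun e => e.2.2))
    · refine continuous_induced_rng.2 (Continuous.prodMk ?_ ?_)
      · exact h2.comp (Continuous.prodMk
          (Continuous.subtype_mk (continuous_subtype_val.comp continuous_fst) (fun p => p.1.2.1))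
          (continuous_fst.comp (hψ'.comp continuous_snd)))
      · exact h2'.comp (Continuous.prodMk
          (Continuous.subtype_mk (continuous_subtype_val.comp continuous_fst) (fun p => p.1.2.2))
          (continuous_snd.comp (hψ'.comp continuous_snd)))

theorem continuous_sumProj (E E' : ComplexVectorBundle B) :
    Continuous (fun e : (E.sum E').Total => sumProj E E' e) := continuous_induced_dom

theorem continuous_to_sum {E E' : ComplexVectorBundle B} {Z : Type*} [TopologicalSpace Z]
    {f : Z → (E.sum E').Total} (h : Continuous (fun z => sumProj E E' (f z))) : Continuous f :=
  continuous_induced_rng.2 h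

theorem continuous_to_zero {Z : Type*} [TopologicalSpace Z]
    {f : Z → (zero B).Total} (h : Continuous (fun z => (f z).proj)) : Continuous f :=
  continuous_induced_rng.2 h

namespace Iso

variable {E₁ E₂ E₃ E₁' E₂' : ComplexVectorBundle B}

/-- The direct sum of two isomorphisms. -/
def sum (f : Iso E₁ E₁') (g : Iso E₂ E₂') : Iso (E₁.sum E₂) (E₁'.sum E₂') where
  equiv x := (f.equiv x).prodCongr (g.equiv x)
  continuous_equiv := continuous_to_sum <|
    (f.continuous_equiv.comp (continuous_fst.comp (continuous_sumProj _ _))).prodMk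
      (g.continuous_equiv.comp (continuous_snd.comp (continuous_sumProj _ _)))
  continuous_symm := continuous_to_sum <|
    (f.continuous_symm.comp (continuous_fst.comp (continuous_sumProj _ _))).prodMk
      (g.continuous_symm.comp (continuous_snd.comp (continuous_sumProj _ _)))

/-- Commutativity of the direct sum. -/
def sumComm (E₁ E₂ : ComplexVectorBundle B) : Iso (E₁.sum E₂) (E₂.sum E₁) where
  equiv _ := LinearEquiv.prodComm ℂ _ _
  continuous_equiv := continuous_to_sum (continuous_swap.comp (continuous_sumProj _ _))
  continuous_symm := continuous_to_sum (continuous_swap.comp (continuous_sumProj _ _))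

/-- Associativity of the direct sum. -/
def sumAssoc (E₁ E₂ E₃ : ComplexVectorBundle B) :
    Iso ((E₁.sum E₂).sum E₃) (E₁.sum (E₂.sum E₃)) where
  equiv _ := LinearEquiv.prodAssoc ℂ _ _ _
  continuous_equiv := by
    have h := continuous_sumProj (E₁.sum E₂) E₃
    have h' := (continuous_sumProj E₁ E₂).comp (continuous_fst.comp h)
    exact continuous_to_sum ((continuous_fst.comp h').prodMk
      (continuous_to_sum ((continuous_snd.comp h').prodMk (continuous_snd.comp h))))
  continuous_symm := by
    have h := continuous_sumProj E₁ (E₂.sum E₃)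
    have h' := (continuous_sumProj E₂ E₃).comp (continuous_snd.comp h)
    have h₁₂ : Continuous (fun e : (E₁.sum (E₂.sum E₃)).Total =>
        (⟨e.proj, (e.snd.1, e.snd.2.1)⟩ : (E₁.sum E₂).Total)) :=
      continuous_to_sum ((continuous_fst.comp h).prodMk (continuous_fst.comp h'))
    exact continuous_to_sum (h₁₂.prodMk (continuous_snd.comp h'))

/-- The zero bundle is neutral for the direct sum. -/
def zeroSum (E : ComplexVectorBundle B) : Iso ((zero B).sum E) E where
  equiv _ :=
    { toFun := fun e => e.2
      invFun := fun e => (PUnit.unit, e)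
      map_add' := fun _ _ => rfl
      map_smul' := fun _ _ => rfl
      left_inv := fun _ => rfl
      right_inv := fun _ => rfl }
  continuous_equiv := continuous_snd.comp (continuous_sumProj _ _)
  continuous_symm := continuous_to_sum
    ((continuous_to_zero E.continuous_proj).prodMk continuous_id)

end Iso

/-- The map of total spaces `f^*E → B' × E`, where `f : B' → B`. -/
def pullbackProj {B' : Type*} (E : ComplexVectorBundle B) (f : B' → B)
    (e : TotalOf (fun x => E.fiber (f x))) : B' × E.Total :=
  (e.proj, ⟨f e.proj, e.snd⟩)

/-- The pull-back `f^*E` of a complex vector bundle along a continuous map `f : B' → B`; its total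
space is the fibre product of `B'` and the total space of `E`. -/
def pullback {B' : Type*} [TopologicalSpace B'] (E : ComplexVectorBundle B) (f : B' → B)
    (hf : Continuous f) : ComplexVectorBundle B' where
  fiber x := E.fiber (f x)
  topology := TopologicalSpace.induced (pullbackProj E f) inferInstance
  continuous_proj := by
    let _ : TopologicalSpace (TotalOf fun x => E.fiber (f x)) :=
      TopologicalSpace.induced (pullbackProj E f) inferInstance
    have h : Continuous (pullbackProj E f) := continuous_induced_dom
    exact continuous_fst.comp h
  locally_trivial x := by
    let _ : TopologicalSpace (TotalOf fun x => E.fiber (f x)) :=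
      TopologicalSpace.induced (pullbackProj E f) inferInstance
    have h : Continuous (pullbackProj E f) := continuous_induced_dom
    obtain ⟨U, k, φ, hx, h1, h2⟩ := E.locally_trivial (f x)
    refine ⟨U.comap ⟨f, hf⟩, k, fun y => φ ⟨f y.1, y.2⟩, hx, ?_, ?_⟩
    · exact h1.comp (Continuous.subtype_mk
        (continuous_snd.comp (h.comp continuous_subtype_val)) (fun e => e.2))
    · refine continuous_induced_rng.2 (Continuous.prodMk
        (continuous_subtype_val.comp continuous_fst) ?_)
      exact h2.comp (Continuous.prodMk (Continuous.subtype_mk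
        (hf.comp (continuous_subtype_val.comp continuous_fst)) (fun p => p.1.2)) continuous_snd)

theorem continuous_pullbackProj {B' : Type*} [TopologicalSpace B'] (E : ComplexVectorBundle B)
    (f : B' → B) (hf : Continuous f) :
    Continuous (fun e : (E.pullback f hf).Total => pullbackProj E f e) := continuous_induced_dom

theorem continuous_to_pullback {B' : Type*} [TopologicalSpace B'] {E : ComplexVectorBundle B}
    {f : B' → B} {hf : Continuous f} {Z : Type*} [TopologicalSpace Z]
    {q : Z → (E.pullback f hf).Total} (h : Continuous (fun z => pullbackProj E f (q z))) :
    Continuous q :=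
  continuous_induced_rng.2 h

/-- Transport of fibres along an equality of base points. -/
def castFiber (E : ComplexVectorBundle B) {x y : B} (h : x = y) : E.fiber x ≃ₗ[ℂ] E.fiber y := by
  subst h
  exact LinearEquiv.refl ℂ _

theorem mk_castFiber (E : ComplexVectorBundle B) {x y : B} (h : x = y) (ξ : E.fiber x) :
    (⟨y, E.castFiber h ξ⟩ : E.Total) = ⟨x, ξ⟩ := by
  subst h
  rfl

end ComplexVectorBundle

/-! ## Equivariant vector bundles and equivariant K-theory -/

/-- A `G`-equivariant complex vector bundle over a `G`-space `M`: a complex vector bundle with a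
continuous action of `G` on the total space that covers the action on `M` and is linear on
fibres. -/
structure EquivariantVectorBundle (G M : Type*) [Group G] [TopologicalSpace G]
    [TopologicalSpace M] [MulAction G M] extends ComplexVectorBundle M where
  act : ∀ (g : G) (x : M), fiber x ≃ₗ[ℂ] fiber (g • x)
  continuous_act : Continuous (fun p : G × toComplexVectorBundle.Total =>
    (⟨p.1 • p.2.proj, act p.1 p.2.proj p.2.snd⟩ : toComplexVectorBundle.Total))
  act_one : ∀ (x : M) (ξ : fiber x), (⟨(1 : G) • x, act 1 x ξ⟩ : toComplexVectorBundle.Total) =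
    ⟨x, ξ⟩
  act_mul : ∀ (g h : G) (x : M) (ξ : fiber x),
    (⟨(g * h) • x, act (g * h) x ξ⟩ : toComplexVectorBundle.Total) =
      ⟨g • h • x, act g (h • x) (act h x ξ)⟩

namespace EquivariantVectorBundle

variable {G M : Type*} [Group G] [TopologicalSpace G] [TopologicalSpace M] [MulAction G M]

/-- Two equivariant vector bundles are isomorphic if there is an isomorphism of vector bundles over
the identity of `M` that commutes with the action of `G`. -/
def Isomorphic (F F' : EquivariantVectorBundle G M) : Prop :=
  ∃ f : F.toComplexVectorBundle.Iso F'.toComplexVectorBundle,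
    ∀ (g : G) (x : M) (ξ : F.fiber x), f.equiv (g • x) (F.act g x ξ) = F'.act g x (f.equiv x ξ)

theorem isomorphic_equivalence :
    Equivalence (Isomorphic : EquivariantVectorBundle G M → EquivariantVectorBundle G M → Prop) where
  refl F := ⟨ComplexVectorBundle.Iso.refl _, fun _ _ _ => rfl⟩
  symm := by
    rintro F F' ⟨f, hf⟩
    refine ⟨f.symm, fun g x ξ => (f.equiv (g • x)).injective ?_⟩
    change f.equiv (g • x) ((f.equiv (g • x)).symm _) = f.equiv (g • x) (F.act g x ((f.equiv x).symm ξ))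
    rw [hf, LinearEquiv.apply_symm_apply, LinearEquiv.apply_symm_apply]
  trans := by
    rintro F F' F'' ⟨f, hf⟩ ⟨f', hf'⟩
    refine ⟨f.trans f', fun g x ξ => ?_⟩
    change f'.equiv _ (f.equiv _ _) = F''.act g x (f'.equiv _ (f.equiv _ _))
    rw [hf, hf']

/-- The direct sum of two equivariant vector bundles, with the diagonal action. -/
def sum (F F' : EquivariantVectorBundle G M) : EquivariantVectorBundle G M where
  toComplexVectorBundle := F.toComplexVectorBundle.sum F'.toComplexVectorBundle
  act g x := (F.act g x).prodCongr (F'.act g x)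
  continuous_act := by
    have h := (ComplexVectorBundle.continuous_sumProj F.toComplexVectorBundle
      F'.toComplexVectorBundle).comp (continuous_snd (X := G))
    exact ComplexVectorBundle.continuous_to_sum
      ((F.continuous_act.comp (continuous_fst.prodMk (continuous_fst.comp h))).prodMk
        (F'.continuous_act.comp (continuous_fst.prodMk (continuous_snd.comp h))))
  act_one x ξ := by
    have h := F.act_one x ξ.1
    have h' := F'.act_one x ξ.2
    exact TotalOf.mk_prod_eq h h'
  act_mul g h x ξ := TotalOf.mk_prod_eq (F.act_mul g h x ξ.1) (F'.act_mul g h x ξ.2)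

/-- The zero equivariant vector bundle. -/
def zero [ContinuousSMul G M] : EquivariantVectorBundle G M where
  toComplexVectorBundle := ComplexVectorBundle.zero M
  act _ _ := LinearEquiv.refl ℂ PUnit
  continuous_act := ComplexVectorBundle.continuous_to_zero
    (continuous_fst.smul ((ComplexVectorBundle.zero M).continuous_proj.comp continuous_snd))
  act_one x _ := TotalOf.mk_eq_of_const (one_smul G x)
  act_mul g h x _ := TotalOf.mk_eq_of_const (mul_smul g h x)

/-- The setoid of isomorphism of equivariant vector bundles. -/
def setoid (G M : Type*) [Group G] [TopologicalSpace G] [TopologicalSpace M] [MulAction G M] :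
    Setoid (EquivariantVectorBundle G M) :=
  ⟨Isomorphic, isomorphic_equivalence⟩

/-- Isomorphism classes of equivariant vector bundles. -/
def IsoClass (G M : Type*) [Group G] [TopologicalSpace G] [TopologicalSpace M] [MulAction G M] :
    Type _ :=
  Quotient (setoid G M)

instance : Add (IsoClass G M) :=
  ⟨Quotient.map₂ sum (by
    rintro F₁ F₁' ⟨f, hf⟩ F₂ F₂' ⟨f', hf'⟩
    exact ⟨f.sum f', fun g x ξ => Prod.ext (hf g x ξ.1) (hf' g x ξ.2)⟩)⟩

instance [ContinuousSMul G M] : Zero (IsoClass G M) := ⟨Quotient.mk _ zero⟩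

/-- Isomorphism classes of equivariant vector bundles form a commutative monoid under direct sum. -/
instance [ContinuousSMul G M] : AddCommMonoid (IsoClass G M) where
  nsmul := nsmulRec
  add_assoc := by
    rintro ⟨F₁⟩ ⟨F₂⟩ ⟨F₃⟩
    exact Quotient.sound ⟨ComplexVectorBundle.Iso.sumAssoc _ _ _, fun _ _ _ => rfl⟩
  zero_add := by
    rintro ⟨F⟩
    exact Quotient.sound ⟨ComplexVectorBundle.Iso.zeroSum _, fun _ _ _ => rfl⟩
  add_zero := by
    rintro ⟨F⟩
    exact Quotient.sound ⟨(ComplexVectorBundle.Iso.sumComm _ _).trans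
      (ComplexVectorBundle.Iso.zeroSum _), fun _ _ _ => rfl⟩
  add_comm := by
    rintro ⟨F₁⟩ ⟨F₂⟩
    exact Quotient.sound ⟨ComplexVectorBundle.Iso.sumComm _ _, fun _ _ _ => rfl⟩

end EquivariantVectorBundle

/-- The equivariant K-group `K_G(M)`: the Grothendieck group of the monoid of isomorphism classes
of `G`-equivariant complex vector bundles over `M`. -/
abbrev EquivariantK (G M : Type*) [Group G] [TopologicalSpace G] [TopologicalSpace M]
    [MulAction G M] [ContinuousSMul G M] : Type _ :=
  Algebra.GrothendieckAddGroup (EquivariantVectorBundle.IsoClass G M)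

/-- The class `[F]` in `K_G(M)` of an equivariant vector bundle `F`. -/
def EquivariantVectorBundle.toK {G M : Type*} [Group G] [TopologicalSpace G] [TopologicalSpace M]
    [MulAction G M] [ContinuousSMul G M] (F : EquivariantVectorBundle G M) : EquivariantK G M :=
  Algebra.GrothendieckAddGroup.of
    (Quotient.mk _ F : EquivariantVectorBundle.IsoClass G M)

/-! ## Orbifolds -/

/-- The data of an `n`-dimensional orbifold structure on a space `X`, the group actions being
allowed to be non-effective. It consists of a family of charts `(V, H, π)`, with `V` a connected
open subset of `ℝⁿ`, `H` a finite group acting smoothly on `V`, and `π` inducing a homeomorphism of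
`V / H` with an open subset of `X`, and of injections between charts. An injection has an underlying
smooth open embedding and an underlying injective group homomorphism, which restricts to an
isomorphism of the subgroups acting trivially and for which the embedding is equivariant. As the
actions need not be effective, an injection is not determined by its embedding: injections are the
morphisms of a category, in which the elements of the local group `H` are automorphisms of the
chart `(V, H, π)`, and any two injections between the same two charts differ by a unique element of
the local group of the target. That the charts cover `X` compatibly is the separate
predicate `OrbifoldAtlas.IsOrbifold`. -/
structure OrbifoldAtlas (n : ℕ) (X : Type*) [TopologicalSpace X] where
  Chart : Type*
  V : Chart → Opens (EuclideanSpace ℝ (Fin n))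
  isConnected_V : ∀ c, IsConnected (V c : Set (EuclideanSpace ℝ (Fin n)))
  H : Chart → Type*
  [group : ∀ c, Group (H c)]
  [finite : ∀ c, Finite (H c)]
  [action : ∀ c, MulAction (H c) (V c)]
  contMDiff_smul : ∀ c (h : H c), ContMDiff (𝓡 n) (𝓡 n) ∞ (fun v : V c => h • v)
  π : ∀ c, V c → X
  continuous_π : ∀ c, Continuous (π c)
  isOpenMap_π : ∀ c, IsOpenMap (π c)
  π_eq_iff : ∀ c (v w : V c), π c v = π c w ↔ ∃ h : H c, h • v = w
  /-- the injections from a chart to another -/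
  Inj : Chart → Chart → Type*
  /-- the embedding underlying an injection -/
  emb : ∀ {c c'}, Inj c c' → V c → V c'
  emb_injective : ∀ {c c'} (i : Inj c c'), Function.Injective (emb i)
  emb_isLocalDiffeomorph : ∀ {c c'} (i : Inj c c'), IsLocalDiffeomorph (𝓡 n) (𝓡 n) ∞ (emb i)
  π_emb : ∀ {c c'} (i : Inj c c') (v : V c), π c' (emb i v) = π c v
  /-- the group homomorphism underlying an injection -/
  hom : ∀ {c c'}, Inj c c' → H c →* H c'
  hom_injective : ∀ {c c'} (i : Inj c c'), Function.Injective (hom i)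
  map_ker : ∀ {c c'} (i : Inj c c'),
    (MulAction.toPermHom (H c) (V c)).ker.map (hom i) = (MulAction.toPermHom (H c') (V c')).ker
  emb_smul : ∀ {c c'} (i : Inj c c') (h : H c) (v : V c), emb i (h • v) = hom i h • emb i v
  /-- composition of injections, `comp j i = j ∘ i` -/
  comp : ∀ {c c' c''}, Inj c' c'' → Inj c c' → Inj c c''
  emb_comp : ∀ {c c' c''} (j : Inj c' c'') (i : Inj c c') (v : V c),
    emb (comp j i) v = emb j (emb i v)
  hom_comp : ∀ {c c' c''} (j : Inj c' c'') (i : Inj c c'), hom (comp j i) = (hom j).comp (hom i)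
  comp_assoc : ∀ {c c' c'' c'''} (k : Inj c'' c''') (j : Inj c' c'') (i : Inj c c'),
    comp (comp k j) i = comp k (comp j i)
  /-- the automorphism of a chart given by an element of its local group -/
  ofH : ∀ {c}, H c → Inj c c
  emb_ofH : ∀ {c} (h : H c) (v : V c), emb (ofH h) v = h • v
  hom_ofH : ∀ {c} (h k : H c), hom (ofH h) k = h * k * h⁻¹
  ofH_mul : ∀ {c} (h k : H c), ofH (h * k) = comp (ofH h) (ofH k)
  ofH_one_comp : ∀ {c c'} (i : Inj c c'), comp (ofH 1) i = i
  comp_ofH : ∀ {c c'} (i : Inj c c') (h : H c), comp i (ofH h) = comp (ofH (hom i h)) i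
  existsUnique_comp : ∀ {c c'} (i j : Inj c c'), ∃! h : H c', j = comp (ofH h) i

namespace OrbifoldAtlas

attribute [instance] OrbifoldAtlas.group OrbifoldAtlas.finite OrbifoldAtlas.action

/-- `X` is an orbifold with the given charts: `X` is Hausdorff and second countable, the images of
the charts cover `X`, and each point in the images of two charts is in the image of a third one
which admits injections into both. -/
structure IsOrbifold {n : ℕ} {X : Type*} [TopologicalSpace X] (𝒪 : OrbifoldAtlas n X) : Prop where
  t2Space : T2Space X
  secondCountable : SecondCountableTopology X
  cover : ∀ p : X, ∃ c, p ∈ Set.range (𝒪.π c)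
  compatible : ∀ (c₁ c₂ : 𝒪.Chart) (p : X), p ∈ Set.range (𝒪.π c₁) → p ∈ Set.range (𝒪.π c₂) →
    ∃ c₃, p ∈ Set.range (𝒪.π c₃) ∧ Nonempty (𝒪.Inj c₃ c₁) ∧ Nonempty (𝒪.Inj c₃ c₂)

end OrbifoldAtlas

/-! ## Orbifold vector bundles and orbifold K-theory -/

/-- A complex orbifold vector bundle: a complex vector bundle `E_c → V_c` over (the domain of) each
chart, and for each injection `i : c → c'` a bundle map `E_c → E_{c'}` over the embedding
`V_c → V_{c'}`, isomorphic on fibres, such that the map of a composite is the composite of the maps.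
In particular, the local group of a chart acts on the bundle over the chart. -/
structure OrbifoldVectorBundle {n : ℕ} {X : Type*} [TopologicalSpace X] (𝒪 : OrbifoldAtlas n X) where
  bundle : ∀ c : 𝒪.Chart, ComplexVectorBundle (𝒪.V c)
  map : ∀ {c c' : 𝒪.Chart} (i : 𝒪.Inj c c') (v : 𝒪.V c),
    (bundle c).fiber v ≃ₗ[ℂ] (bundle c').fiber (𝒪.emb i v)
  continuous_map : ∀ {c c' : 𝒪.Chart} (i : 𝒪.Inj c c'), Continuous (fun e : (bundle c).Total =>
    (⟨𝒪.emb i e.proj, map i e.proj e.snd⟩ : (bundle c').Total))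
  map_comp : ∀ {c c' c'' : 𝒪.Chart} (j : 𝒪.Inj c' c'') (i : 𝒪.Inj c c') (v : 𝒪.V c)
    (ξ : (bundle c).fiber v),
    (⟨𝒪.emb (𝒪.comp j i) v, map (𝒪.comp j i) v ξ⟩ : (bundle c'').Total) =
      ⟨𝒪.emb j (𝒪.emb i v), map j (𝒪.emb i v) (map i v ξ)⟩

namespace OrbifoldVectorBundle

variable {n : ℕ} {X : Type*} [TopologicalSpace X] {𝒪 : OrbifoldAtlas n X}

/-- Two orbifold vector bundles are isomorphic if there are isomorphisms of their bundles over all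
charts that commute with the maps given by the injections. -/
def Isomorphic (E E' : OrbifoldVectorBundle 𝒪) : Prop :=
  ∃ δ : ∀ c : 𝒪.Chart, (E.bundle c).Iso (E'.bundle c),
    ∀ (c c' : 𝒪.Chart) (i : 𝒪.Inj c c') (v : 𝒪.V c) (ξ : (E.bundle c).fiber v),
      (δ c').equiv (𝒪.emb i v) (E.map i v ξ) = E'.map i v ((δ c).equiv v ξ)

theorem isomorphic_equivalence :
    Equivalence (Isomorphic : OrbifoldVectorBundle 𝒪 → OrbifoldVectorBundle 𝒪 → Prop) where
  refl E := ⟨fun _ => ComplexVectorBundle.Iso.refl _, fun _ _ _ _ _ => rfl⟩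
  symm := by
    rintro E E' ⟨δ, hδ⟩
    refine ⟨fun c => (δ c).symm, fun c c' i v ξ => ((δ c').equiv (𝒪.emb i v)).injective ?_⟩
    change (δ c').equiv _ (((δ c').equiv _).symm _) =
      (δ c').equiv _ (E.map i v (((δ c).equiv v).symm ξ))
    rw [hδ, LinearEquiv.apply_symm_apply, LinearEquiv.apply_symm_apply]
  trans := by
    rintro E E' E'' ⟨δ, hδ⟩ ⟨δ', hδ'⟩
    refine ⟨fun c => (δ c).trans (δ' c), fun c c' i v ξ => ?_⟩
    change (δ' c').equiv _ ((δ c').equiv _ _) = E''.map i v ((δ' c).equiv _ ((δ c).equiv _ _))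
    rw [hδ, hδ']

/-- The direct sum of two orbifold vector bundles. -/
def sum (E E' : OrbifoldVectorBundle 𝒪) : OrbifoldVectorBundle 𝒪 where
  bundle c := (E.bundle c).sum (E'.bundle c)
  map i v := (E.map i v).prodCongr (E'.map i v)
  continuous_map {c c'} i := by
    have h := ComplexVectorBundle.continuous_sumProj (E.bundle c) (E'.bundle c)
    exact ComplexVectorBundle.continuous_to_sum
      (((E.continuous_map i).comp (continuous_fst.comp h)).prodMk
        ((E'.continuous_map i).comp (continuous_snd.comp h)))
  map_comp j i v ξ := TotalOf.mk_prod_eq (E.map_comp j i v ξ.1) (E'.map_comp j i v ξ.2)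

/-- The zero orbifold vector bundle. -/
def zero (𝒪 : OrbifoldAtlas n X) : OrbifoldVectorBundle 𝒪 where
  bundle c := ComplexVectorBundle.zero (𝒪.V c)
  map _ _ := LinearEquiv.refl ℂ PUnit
  continuous_map i := ComplexVectorBundle.continuous_to_zero
    ((𝒪.emb_isLocalDiffeomorph i).contMDiff.continuous.comp
      (ComplexVectorBundle.zero _).continuous_proj)
  map_comp j i v _ := TotalOf.mk_eq_of_const (𝒪.emb_comp j i v)

/-- The setoid of isomorphism of orbifold vector bundles. -/
def setoid (𝒪 : OrbifoldAtlas n X) : Setoid (OrbifoldVectorBundle 𝒪) :=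
  ⟨Isomorphic, isomorphic_equivalence⟩

/-- Isomorphism classes of orbifold vector bundles. -/
def IsoClass (𝒪 : OrbifoldAtlas n X) : Type _ := Quotient (setoid 𝒪)

instance : Add (IsoClass 𝒪) :=
  ⟨Quotient.map₂ sum (by
    rintro E₁ E₁' ⟨δ, hδ⟩ E₂ E₂' ⟨δ', hδ'⟩
    exact ⟨fun c => (δ c).sum (δ' c),
      fun c c' i v ξ => Prod.ext (hδ c c' i v ξ.1) (hδ' c c' i v ξ.2)⟩)⟩

instance : Zero (IsoClass 𝒪) := ⟨Quotient.mk _ (zero 𝒪)⟩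

/-- Isomorphism classes of orbifold vector bundles form a commutative monoid under direct sum. -/
instance : AddCommMonoid (IsoClass 𝒪) where
  nsmul := nsmulRec
  add_assoc := by
    rintro ⟨E₁⟩ ⟨E₂⟩ ⟨E₃⟩
    exact Quotient.sound ⟨fun _ => ComplexVectorBundle.Iso.sumAssoc _ _ _, fun _ _ _ _ _ => rfl⟩
  zero_add := by
    rintro ⟨E⟩
    exact Quotient.sound ⟨fun _ => ComplexVectorBundle.Iso.zeroSum _, fun _ _ _ _ _ => rfl⟩
  add_zero := by
    rintro ⟨E⟩
    exact Quotient.sound ⟨fun _ => (ComplexVectorBundle.Iso.sumComm _ _).trans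
      (ComplexVectorBundle.Iso.zeroSum _), fun _ _ _ _ _ => rfl⟩
  add_comm := by
    rintro ⟨E₁⟩ ⟨E₂⟩
    exact Quotient.sound ⟨fun _ => ComplexVectorBundle.Iso.sumComm _ _, fun _ _ _ _ _ => rfl⟩

end OrbifoldVectorBundle

/-- The orbifold K-group `K_orb(X)`: the Grothendieck group of the monoid of isomorphism classes of
complex orbifold vector bundles over `X`. -/
abbrev OrbifoldK {n : ℕ} {X : Type*} [TopologicalSpace X] (𝒪 : OrbifoldAtlas n X) : Type _ :=
  Algebra.GrothendieckAddGroup (OrbifoldVectorBundle.IsoClass 𝒪)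

/-- The class `[E]` in `K_orb(X)` of an orbifold vector bundle `E`. -/
def OrbifoldVectorBundle.toK {n : ℕ} {X : Type*} [TopologicalSpace X] {𝒪 : OrbifoldAtlas n X}
    (E : OrbifoldVectorBundle 𝒪) : OrbifoldK 𝒪 :=
  Algebra.GrothendieckAddGroup.of (Quotient.mk _ E : OrbifoldVectorBundle.IsoClass 𝒪)

/-! ## The orbifold `M/G` -/

/-- A smooth action of a finite group on a connected open subset of `ℝⁿ`: an element fixing the points
of a non-empty open set acts trivially. -/
theorem smul_eq_self_of_fixes_open {n : ℕ} {V : Opens (EuclideanSpace ℝ (Fin n))}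
    (hV : IsConnected (V : Set (EuclideanSpace ℝ (Fin n)))) {H : Type*} [Group H] [Finite H]
    [MulAction H V] (hs : ∀ h : H, ContMDiff (𝓡 n) (𝓡 n) ∞ (fun v : V => h • v)) (h : H)
    {O : Set V} (hO : IsOpen O) (hne : O.Nonempty) (hfix : ∀ v ∈ O, h • v = v) (v : V) :
    h • v = v := by
  classical
  let E := EuclideanSpace ℝ (Fin n)
  have : ConnectedSpace V := isConnected_iff_connectedSpace.1 hV
  let f : H → E → E := fun k x => if hx : x ∈ V then ((k • (⟨x, hx⟩ : V) : V) : E) else x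
  have hf : ∀ k (w : V), f k w = (k • w : V) := fun k w => by simp [f]
  have hfs : ∀ k, ContDiffOn ℝ ∞ (f k) V := by
    intro k x hx
    have h1 : ContMDiffAt (𝓡 n) (𝓡 n) ∞ (fun w : V => ((k • w : V) : E)) ⟨x, hx⟩ :=
      (contMDiff_subtype_val.comp (hs k)).contMDiffAt
    have h2 : (fun w : V => ((k • w : V) : E)) = fun w : V => f k w := by
      funext w; exact (hf k w).symm
    rw [h2] at h1
    have h3 := contMDiffAt_subtype_iff.1 h1
    exact (contMDiffAt_iff_contDiffAt.1 h3).contDiffWithinAt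
  let A : Set V := interior {w | h • w = w}
  have hAne : A.Nonempty := hne.mono (interior_maximal hfix hO)
  have hAc : IsClosed A := by
    refine isClosed_of_closure_subset fun w hw => ?_
    have hcont : Continuous fun w : V => h • w := (hs h).continuous
    have hT : IsClosed {w : V | h • w = w} := isClosed_eq hcont continuous_id
    have hw0 : h • w = w := closure_minimal interior_subset hT hw
    -- derivative of each power at w is the identity
    have hpow : ∀ k ∈ Subgroup.zpowers h, ∀ u : V, h • u = u → k • u = u := by
      intro k hk u hu
      have : Subgroup.zpowers h ≤ MulAction.stabilizer H u :=
        (Subgroup.zpowers_le).2 hu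
      exact this hk
    have hder : ∀ k ∈ Subgroup.zpowers h,
        fderiv ℝ (f k) (w : E) = ContinuousLinearMap.id ℝ E := by
      intro k hk
      have hc : ContinuousOn (fderiv ℝ (f k)) V :=
        (hfs k).continuousOn_fderiv_of_isOpen V.isOpen (by simp)
      have hc' : Continuous fun u : V => fderiv ℝ (f k) (u : E) :=
        continuousOn_iff_continuous_domRestrict.1 hc
      have hcl : IsClosed {u : V | fderiv ℝ (f k) (u : E) = ContinuousLinearMap.id ℝ E} :=
        isClosed_eq hc' continuous_const
      refine closure_minimal (fun u hu => ?_) hcl hw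
      have hev : f k =ᶠ[nhds (u : E)] id := by
        have h1 : ∀ᶠ x in nhds u, h • x = x := mem_interior_iff_mem_nhds.1 hu
        have h2 := (V.isOpenEmbedding'.map_nhds_eq u)
        rw [← h2]
        refine Filter.eventually_map.2 (h1.mono fun x hx => ?_)
        rw [hf, hpow k hk x hx]; rfl
      change fderiv ℝ (f k) (u : E) = _
      rw [hev.fderiv_eq, fderiv_id]
    -- the sum over the cyclic group generated by h
    have := Fintype.ofFinite H
    let ψ : E → E := fun x => ∑ k : Subgroup.zpowers h, f k x
    have hψs : HasStrictFDerivAt ψ (∑ k : Subgroup.zpowers h, ContinuousLinearMap.id ℝ E)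
        (w : E) := by
      refine HasStrictFDerivAt.fun_sum fun k _ => ?_
      have h1 : ContDiffAt ℝ ∞ (f k) (w : E) := (hfs k).contDiffAt (V.isOpen.mem_nhds w.2)
      have h2 := h1.hasStrictFDerivAt (by simp)
      rwa [hder k k.2] at h2
    have hN : ((Fintype.card (Subgroup.zpowers h) : ℕ) : ℝ) ≠ 0 :=
      Nat.cast_ne_zero.2 Fintype.card_ne_zero
    let L : E ≃L[ℝ] E := ContinuousLinearEquiv.smulLeft (Units.mk0 _ hN)
    have hL : (∑ k : Subgroup.zpowers h, ContinuousLinearMap.id ℝ E) = (L : E →L[ℝ] E) := by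
      ext x : 1
      simp [L, Units.smul_def, Nat.cast_smul_eq_nsmul]
    rw [hL] at hψs
    have hinv : ∀ u : V, ψ (h • u : V) = ψ u := by
      intro u
      refine Fintype.sum_equiv (Equiv.mulRight (⟨h, Subgroup.mem_zpowers h⟩ : Subgroup.zpowers h))
        _ _ fun k => ?_
      simp [hf, mul_smul]
    have hinj : ∀ᶠ p : E × E in nhds ((w : E), (w : E)), ψ p.1 = ψ p.2 → p.1 = p.2 := by
      let e := hψs.toOpenPartialHomeomorph ψ
      have hs : e.source ∈ nhds (w : E) :=
        e.open_source.mem_nhds hψs.mem_toOpenPartialHomeomorph_source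
      filter_upwards [prod_mem_nhds hs hs] with p hp heq
      exact e.injOn hp.1 hp.2 heq
    have hlim : Filter.Tendsto (fun u : V => (((h • u : V) : E), (u : E))) (nhds w) (nhds ((w : E), (w : E))) := by
      have : Continuous fun u : V => (((h • u : V) : E), (u : E)) :=
        (continuous_subtype_val.comp hcont).prodMk continuous_subtype_val
      have := this.tendsto w
      rwa [hw0] at this
    refine mem_interior_iff_mem_nhds.2 ?_
    filter_upwards [hlim.eventually hinj] with u hu
    exact Subtype.ext (hu (hinv u))
  have hA : A = Set.univ := IsClopen.eq_univ ⟨hAc, isOpen_interior⟩ hAne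
  have : v ∈ A := hA ▸ Set.mem_univ v
  have hsub : A ⊆ {w | h • w = w} := interior_subset
  exact hsub this

/-- A slice chart of a smooth action of a Lie group `G` of dimension `d` on a manifold `M` of
dimension `m`: a connected open subset `V` of `ℝ^(m-d)`, a finite subgroup `H` of `G` acting
smoothly on `V`, and an `H`-equivariant map `φ : V → M` such that `(g, v) ↦ g • φ v` induces a
diffeomorphism of `G ×_H V` with an open subset of `M`. Thus `φ V` is a smooth slice for the action,
and `V / H` is homeomorphic to an open subset of `M / G`. -/
structure SliceChart (d m : ℕ) (G M : Type*) [Group G] [TopologicalSpace G]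
    [ChartedSpace (EuclideanSpace ℝ (Fin d)) G] [TopologicalSpace M]
    [ChartedSpace (EuclideanSpace ℝ (Fin m)) M] [MulAction G M] where
  V : Opens (EuclideanSpace ℝ (Fin (m - d)))
  isConnected_V : IsConnected (V : Set (EuclideanSpace ℝ (Fin (m - d))))
  H : Subgroup G
  [finite : Finite H]
  [action : MulAction H V]
  contMDiff_smul : ∀ h : H, ContMDiff (𝓡 (m - d)) (𝓡 (m - d)) ∞ (fun v : V => h • v)
  φ : V → M
  φ_smul : ∀ (h : H) (v : V), φ (h • v) = (h : G) • φ v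
  isLocalDiffeomorph : IsLocalDiffeomorph ((𝓡 d).prod (𝓡 (m - d))) (𝓡 m) ∞
    (fun p : G × V => p.1 • φ p.2)
  exists_of_smul_eq : ∀ (g : G) (v w : V), g • φ v = φ w → ∃ h : H, (h : G) = g ∧ h • v = w

attribute [instance] SliceChart.finite SliceChart.action

/-- An injection of slice charts: a smooth open embedding `emb : V → V'` with a smooth map
`a : V → G` such that `a v` carries the point `φ v` of the first slice to the point `φ' (emb v)` of
the second, and an injective homomorphism `hom : H → H'` such that `a (h • v) h = hom h (a v)`. (The
maps `emb` and `hom` are determined by `a`, which records the arrows in the translation groupoid of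
the action.) -/
@[ext]
structure SliceInjection {d m : ℕ} {G M : Type*} [Group G] [TopologicalSpace G]
    [ChartedSpace (EuclideanSpace ℝ (Fin d)) G] [TopologicalSpace M]
    [ChartedSpace (EuclideanSpace ℝ (Fin m)) M] [MulAction G M]
    (c c' : SliceChart d m G M) where
  a : c.V → G
  contMDiff_a : ContMDiff (𝓡 (m - d)) (𝓡 d) ∞ a
  emb : c.V → c'.V
  emb_isLocalDiffeomorph : IsLocalDiffeomorph (𝓡 (m - d)) (𝓡 (m - d)) ∞ emb
  a_smul : ∀ v, a v • c.φ v = c'.φ (emb v)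
  hom : c.H →* c'.H
  hom_injective : Function.Injective hom
  a_equivariant : ∀ (h : c.H) (v : c.V), a (h • v) * h = hom h * a v

section SliceLemmas

variable {d m : ℕ} {G M : Type*} [Group G] [TopologicalSpace G]
  [ChartedSpace (EuclideanSpace ℝ (Fin d)) G] [TopologicalSpace M]
  [ChartedSpace (EuclideanSpace ℝ (Fin m)) M] [MulAction G M]

namespace SliceChart

variable (c : SliceChart d m G M)

theorem φ_injective : Function.Injective c.φ := by
  intro v w h
  obtain ⟨k, hk, hkv⟩ := c.exists_of_smul_eq 1 v w (by rw [one_smul, h])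
  have : k = 1 := Subtype.ext hk
  rw [← hkv, this, one_smul]

theorem continuous_φ : Continuous c.φ := by
  have h := c.isLocalDiffeomorph.contMDiff.continuous.comp
    (continuous_const.prodMk continuous_id : Continuous fun v : c.V => ((1 : G), v))
  have h' : (fun p : G × c.V => p.1 • c.φ p.2) ∘ (fun v : c.V => ((1 : G), v)) = c.φ := by
    funext v
    exact one_smul G _
  rwa [← h']

/-- The projection of a slice chart to the orbit space. -/
def proj (v : c.V) : MulAction.orbitRel.Quotient G M := Quotient.mk _ (c.φ v)

theorem continuous_proj : Continuous c.proj := continuous_quot_mk.comp c.continuous_φ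

theorem proj_eq_iff (v w : c.V) : c.proj v = c.proj w ↔ ∃ h : c.H, h • v = w := by
  constructor
  · intro h
    obtain ⟨g, hg⟩ := (MulAction.orbitRel_apply.1 (Quotient.exact h.symm))
    obtain ⟨k, -, hk⟩ := c.exists_of_smul_eq g v w hg
    exact ⟨k, hk⟩
  · rintro ⟨h, rfl⟩
    refine (Quotient.sound ?_ : c.proj (h • v) = c.proj v).symm
    exact MulAction.orbitRel_apply.2 ⟨(h : G), (c.φ_smul h v).symm⟩

theorem isOpenMap_proj [ContinuousConstSMul G M] : IsOpenMap c.proj := by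
  intro O hO
  have h1 : IsOpen ((fun p : G × c.V => p.1 • c.φ p.2) '' (Set.univ ×ˢ O)) :=
    c.isLocalDiffeomorph.isOpenMap _ (isOpen_univ.prod hO)
  have h2 := (isOpenMap_quotient_mk'_mul (Γ := G) (T := M)) _ h1
  convert! h2 using 1
  ext p
  constructor
  · rintro ⟨v, hv, rfl⟩
    exact ⟨c.φ v, ⟨(1, v), ⟨trivial, hv⟩, one_smul G _⟩, rfl⟩
  · rintro ⟨-, ⟨⟨g, v⟩, ⟨-, hv⟩, rfl⟩, rfl⟩
    refine ⟨v, hv, Quotient.sound (MulAction.orbitRel_apply.2 ⟨g⁻¹, ?_⟩)⟩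
    exact inv_smul_smul g _

end SliceChart

namespace SliceInjection

variable {c c' c'' : SliceChart d m G M}

theorem emb_injective (i : SliceInjection c c') : Function.Injective i.emb := by
  intro v w h
  have h1 : i.a v • c.φ v = i.a w • c.φ w := by rw [i.a_smul, i.a_smul, h]
  obtain ⟨k, hk, hkv⟩ := c.exists_of_smul_eq ((i.a w)⁻¹ * i.a v) v w
    (by rw [mul_smul, h1, inv_smul_smul])
  have h2 : i.a w * k = i.a v := by rw [hk, mul_inv_cancel_left]
  have h3 := i.a_equivariant k v
  rw [hkv, h2] at h3
  have h4 : i.hom k = 1 := Subtype.ext (mul_eq_right.1 h3.symm)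
  have h5 : k = 1 := i.hom_injective (h4.trans (map_one _).symm)
  rw [← hkv, h5, one_smul]

theorem proj_emb (i : SliceInjection c c') (v : c.V) : c'.proj (i.emb v) = c.proj v :=
  Quotient.sound (MulAction.orbitRel_apply.2 ⟨i.a v, i.a_smul v⟩)

theorem emb_smul (i : SliceInjection c c') (h : c.H) (v : c.V) :
    i.emb (h • v) = i.hom h • i.emb v := by
  apply c'.φ_injective
  rw [c'.φ_smul, ← i.a_smul, ← i.a_smul, c.φ_smul, ← mul_smul, ← mul_smul, i.a_equivariant]

theorem ext_a {i j : SliceInjection c c'} (h : i.a = j.a) : i = j := by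
  have he : i.emb = j.emb := by
    funext v
    apply c'.φ_injective
    rw [← i.a_smul, ← j.a_smul, h]
  have hh : i.hom = j.hom := by
    obtain ⟨x, hx⟩ := c.isConnected_V.nonempty
    ext k
    have h1 := i.a_equivariant k ⟨x, hx⟩
    rw [h, j.a_equivariant] at h1
    exact (mul_right_cancel h1).symm
  exact SliceInjection.ext h he hh

/-- Two continuous lifts of points of a slice to the same slice differ by a constant element of the
local group. -/
theorem exists_const [ContinuousInv G] [ContinuousMul G] [T2Space G] (i : SliceInjection c c')
    (b : c.V → G) (hb : Continuous b)
    (hbv : ∀ v, ∃ w, b v • c.φ v = c'.φ w) : ∃ k : c'.H, ∀ v, b v = k * i.a v := by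
  have : ConnectedSpace c.V := isConnected_iff_connectedSpace.1 c.isConnected_V
  have h1 : ∀ v, ∃ k : c'.H, (k : G) = b v * (i.a v)⁻¹ := by
    intro v
    obtain ⟨w, hw⟩ := hbv v
    obtain ⟨k, hk, -⟩ := c'.exists_of_smul_eq (b v * (i.a v)⁻¹) (i.emb v) w
      (by rw [← i.a_smul, ← hw, mul_smul, inv_smul_smul])
    exact ⟨k, hk⟩
  choose k hk using h1
  have hkc : Continuous k := by
    refine continuous_induced_rng.2 ?_
    have : (Subtype.val ∘ k) = fun v => b v * (i.a v)⁻¹ := funext hk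
    rw [this]
    exact hb.mul i.contMDiff_a.continuous.inv
  obtain ⟨x⟩ := (inferInstance : Nonempty c.V)
  refine ⟨k x, fun v => ?_⟩
  have : k v = k x := PreconnectedSpace.constant inferInstance hkc
  rw [← this, hk, inv_mul_cancel_right]

theorem map_ker [ContinuousInv G] [ContinuousMul G] [T2Space G] (i : SliceInjection c c') :
    (MulAction.toPermHom c.H c.V).ker.map i.hom = (MulAction.toPermHom c'.H c'.V).ker := by
  have hc : ∀ k : c.H, k ∈ (MulAction.toPermHom c.H c.V).ker ↔ ∀ v : c.V, k • v = v := fun k => by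
    rw [MonoidHom.mem_ker, Equiv.ext_iff]; rfl
  have hc' : ∀ k : c'.H, k ∈ (MulAction.toPermHom c'.H c'.V).ker ↔ ∀ v : c'.V, k • v = v :=
    fun k => by rw [MonoidHom.mem_ker, Equiv.ext_iff]; rfl
  have : ConnectedSpace c.V := isConnected_iff_connectedSpace.1 c.isConnected_V
  ext k'
  rw [Subgroup.mem_map, hc']
  constructor
  · rintro ⟨k, hk, rfl⟩
    rw [hc] at hk
    refine smul_eq_self_of_fixes_open c'.isConnected_V c'.contMDiff_smul _
      i.emb_isLocalDiffeomorph.isOpen_range (Set.range_nonempty i.emb) ?_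
    rintro _ ⟨v, rfl⟩
    rw [← i.emb_smul, hk]
  · intro hk'
    obtain ⟨x⟩ := (inferInstance : Nonempty c.V)
    have h1 : ∀ v, ∃ k : c.H, (k : G) = (i.a v)⁻¹ * k' * i.a v ∧ k • v = v := by
      intro v
      refine c.exists_of_smul_eq _ v v ?_
      rw [mul_smul, mul_smul, i.a_smul, ← c'.φ_smul, hk', ← i.a_smul, inv_smul_smul]
    choose k hk hkv using h1
    have hkc : Continuous k := by
      refine continuous_induced_rng.2 ?_
      have : (Subtype.val ∘ k) = fun v => (i.a v)⁻¹ * k' * i.a v := funext hk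
      rw [this]
      exact (i.contMDiff_a.continuous.inv.mul continuous_const).mul i.contMDiff_a.continuous
    have hconst : ∀ v, k v = k x := fun v => PreconnectedSpace.constant inferInstance hkc
    refine ⟨k x, (hc _).2 fun v => by rw [← hconst v, hkv], ?_⟩
    have h2 := i.a_equivariant (k x) x
    rw [hkv, hk, mul_assoc, mul_inv_cancel_left] at h2
    exact (Subtype.ext (mul_right_cancel h2)).symm

end SliceInjection

end SliceLemmas

section QuotientOrbifold

variable {d m : ℕ} {G M : Type*} [Group G] [TopologicalSpace G]
  [ChartedSpace (EuclideanSpace ℝ (Fin d)) G] [TopologicalSpace M]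
  [ChartedSpace (EuclideanSpace ℝ (Fin m)) M] [MulAction G M]

namespace SliceInjection

/-- The automorphism of a slice chart given by an element of its local group. -/
def ofH {c : SliceChart d m G M} (h : c.H) : SliceInjection c c where
  a _ := h
  contMDiff_a := contMDiff_const
  emb v := h • v
  emb_isLocalDiffeomorph := Diffeomorph.isLocalDiffeomorph
    { toEquiv := MulAction.toPerm h
      contMDiff_toFun := c.contMDiff_smul h
      contMDiff_invFun := c.contMDiff_smul h⁻¹ }
  a_smul v := (c.φ_smul h v).symm
  hom := (MulAut.conj h).toMonoidHom
  hom_injective := (MulAut.conj h).injective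
  a_equivariant k v := by simp

/-- The composite `j ∘ i` of two injections of slice charts. -/
def comp [LieGroup (𝓡 d) ∞ G] {c c' c'' : SliceChart d m G M} (j : SliceInjection c' c'')
    (i : SliceInjection c c') : SliceInjection c c'' where
  a v := j.a (i.emb v) * i.a v
  contMDiff_a := (j.contMDiff_a.comp i.emb_isLocalDiffeomorph.contMDiff).mul i.contMDiff_a
  emb v := j.emb (i.emb v)
  emb_isLocalDiffeomorph v :=
    IsLocalDiffeomorphAt.comp (hf := i.emb_isLocalDiffeomorph v) (hg := j.emb_isLocalDiffeomorph (i.emb v))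
  a_smul v := by rw [mul_smul, i.a_smul, j.a_smul]
  hom := j.hom.comp i.hom
  hom_injective := j.hom_injective.comp i.hom_injective
  a_equivariant h v := by
    rw [mul_assoc, i.a_equivariant, ← mul_assoc, i.emb_smul, j.a_equivariant, mul_assoc]
    rfl

end SliceInjection

variable (d m G M)

/-- The orbifold structure of `X = M/G`: its charts are the slice charts of the action of `G` on
`M`. -/
def quotientOrbifold [LieGroup (𝓡 d) ∞ G] [T2Space G] [ContinuousSMul G M] :
    OrbifoldAtlas (m - d) (MulAction.orbitRel.Quotient G M) where
  Chart := SliceChart d m G M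
  V c := c.V
  isConnected_V c := c.isConnected_V
  H c := c.H
  contMDiff_smul c := c.contMDiff_smul
  π c := c.proj
  continuous_π c := c.continuous_proj
  isOpenMap_π c := c.isOpenMap_proj
  π_eq_iff c := c.proj_eq_iff
  Inj := SliceInjection
  emb i := i.emb
  emb_injective i := i.emb_injective
  emb_isLocalDiffeomorph i := i.emb_isLocalDiffeomorph
  π_emb i := i.proj_emb
  hom i := i.hom
  hom_injective i := i.hom_injective
  map_ker i := by
    have : IsTopologicalGroup G := topologicalGroup_of_lieGroup (𝓡 d) ∞
    exact i.map_ker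
  emb_smul i := i.emb_smul
  comp j i := j.comp i
  emb_comp _ _ _ := rfl
  hom_comp _ _ := rfl
  comp_assoc k j i := SliceInjection.ext_a (funext fun _ => mul_assoc _ _ _)
  ofH h := SliceInjection.ofH h
  emb_ofH _ _ := rfl
  hom_ofH _ _ := rfl
  ofH_mul _ _ := SliceInjection.ext_a rfl
  ofH_one_comp i := SliceInjection.ext_a (funext fun _ => one_mul _)
  comp_ofH i h := SliceInjection.ext_a (funext fun v => i.a_equivariant h v)
  existsUnique_comp {c c'} i j := by
    have : IsTopologicalGroup G := topologicalGroup_of_lieGroup (𝓡 d) ∞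
    obtain ⟨k, hk⟩ := i.exists_const j.a j.contMDiff_a.continuous fun v => ⟨_, j.a_smul v⟩
    refine ⟨k, SliceInjection.ext_a (funext hk), fun k' hk' => Subtype.ext ?_⟩
    obtain ⟨x, hx⟩ := c.isConnected_V.nonempty
    have h1 : j.a ⟨x, hx⟩ = k' * i.a ⟨x, hx⟩ := congrFun (congrArg SliceInjection.a hk') ⟨x, hx⟩
    exact mul_right_cancel (h1.symm.trans (hk _))

variable {d m G M}
variable [LieGroup (𝓡 d) ∞ G] [T2Space G] [ContinuousSMul G M]

/-- The orbifold vector bundle `F/G → M/G` of an equivariant vector bundle `F → M`: over a slice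
chart it is the restriction of `F` to the slice, and an injection acts on it through the
action of `G` on `F`. -/
def EquivariantVectorBundle.quotient (F : EquivariantVectorBundle G M) :
    OrbifoldVectorBundle (quotientOrbifold d m G M) where
  bundle c := F.toComplexVectorBundle.pullback (SliceChart.φ c) (SliceChart.continuous_φ c)
  map {c c'} i v := (F.act (SliceInjection.a i v) (SliceChart.φ c v)).trans
    (F.castFiber (SliceInjection.a_smul i v))
  continuous_map {c c'} i := by
    have h := ComplexVectorBundle.continuous_pullbackProj F.toComplexVectorBundle
      (SliceChart.φ c) (SliceChart.continuous_φ c)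
    have hp := continuous_fst.comp h
    refine ComplexVectorBundle.continuous_to_pullback (Continuous.prodMk
      ((SliceInjection.emb_isLocalDiffeomorph i).contMDiff.continuous.comp hp) ?_)
    refine (F.continuous_act.comp (Continuous.prodMk
      ((SliceInjection.contMDiff_a i).continuous.comp hp) (continuous_snd.comp h))).congr ?_
    intro e
    exact (F.mk_castFiber (SliceInjection.a_smul i e.proj) _).symm
  map_comp {c c' c''} j i v ξ := by
    have key : ∀ {x : M} {ζ ζ' : F.fiber x}, (⟨x, ζ⟩ : F.Total) = ⟨x, ζ'⟩ → ζ = ζ' := by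
      intro x ζ ζ' h
      cases h
      rfl
    refine congrArg (TotalOf.mk _) (key ?_)
    refine (F.mk_castFiber _ _).trans (Eq.trans ?_ (F.mk_castFiber _ _).symm)
    refine (F.act_mul _ _ _ _).trans ?_
    have hact : ∀ (g : G) {e e' : F.Total}, e = e' →
        (⟨g • e.proj, F.act g e.proj e.snd⟩ : F.Total) = ⟨g • e'.proj, F.act g e'.proj e'.snd⟩ := by
      rintro g e e' rfl
      rfl
    exact hact _ (F.mk_castFiber (SliceInjection.a_smul i v) _).symm

/-- `F = p^*E` for the projection `p : M → X = M/G`. Over the open subset `G • φ(V)` of `M` that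
belongs to a slice chart, the projection `p` lifts locally to `g • φ v ↦ v`, and the pull-back of `E`
along `p` is the equivariant vector bundle `F` on `M` with a bundle map to `E` covering `p`: for each
slice chart `c`, each `g` in `G` and each `v` in `V`, an isomorphism of the fibres `F_{g • φ v}` and
`E_{c,v}` (denoted by `β`, from the second to the first), depending continuously on `(g, v)`,
compatible with the injections of charts, and such that the action of `G` on `F` does not change the
image in `E`. -/
def IsPullback (E : OrbifoldVectorBundle (quotientOrbifold d m G M))
    (F : EquivariantVectorBundle G M) : Prop :=
  ∃ β : ∀ (c : SliceChart d m G M) (g : G) (v : (quotientOrbifold d m G M).V c),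
      (E.bundle c).fiber v ≃ₗ[ℂ] F.fiber (g • c.φ v),
    (∀ c : SliceChart d m G M, Continuous (fun p : G × (E.bundle c).Total =>
      (⟨p.1 • c.φ p.2.proj, β c p.1 p.2.proj p.2.snd⟩ : F.Total))) ∧
    (∀ (c c' : SliceChart d m G M) (i : SliceInjection c c') (g : G) (v : (quotientOrbifold d m G M).V c)
      (ξ : (E.bundle c).fiber v),
      (⟨(g * (i.a v)⁻¹) • c'.φ (i.emb v), β c' (g * (i.a v)⁻¹) (i.emb v) (E.map i v ξ)⟩ : F.Total) =
        ⟨g • c.φ v, β c g v ξ⟩) ∧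
    (∀ (c : SliceChart d m G M) (g h : G) (v : (quotientOrbifold d m G M).V c) (ξ : (E.bundle c).fiber v),
      (⟨(g * h) • c.φ v, β c (g * h) v ξ⟩ : F.Total) =
        ⟨g • h • c.φ v, F.act g (h • c.φ v) (β c h v ξ)⟩)

end QuotientOrbifold

/-- Every continuous action of a compact group on a Hausdorff space is proper. -/
theorem properSMul_of_compactSpace (G M : Type*) [Group G] [TopologicalSpace G] [CompactSpace G]
    [TopologicalSpace M] [T2Space M] [MulAction G M] [ContinuousSMul G M] : ProperSMul G M := by
  rw [properSMul_iff_continuousSMul_ultrafilter_tendsto_t2]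
  refine ⟨inferInstance, fun 𝒰 x₁ x₂ h => ?_⟩
  obtain ⟨g, -, hg⟩ := isCompact_univ.ultrafilter_le_nhds (𝒰.map Prod.fst) (by simp)
  exact ⟨g, hg⟩

/-!
An orbifold vector bundle on `M/G` is a functorial family of bundles over the slices, and the
theorem holds because the slices together with the injections carry the same information as the
translation groupoid of `G` acting on `M`.

**Slices.** The orbit map of a point `x` with finite isotropy group `Gₓ` is an immersion
(`mfderiv_orbitMap_injective`): a tangent vector in the kernel of its derivative extends to a
left-invariant vector field with an integral curve in `Gₓ`. The coordinates of a chart at all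
translates by `Gₓ` form an equivariant immersion of a neighbourhood of `x` into an orthogonal
representation, and the orthogonal complement of the orbit in its image gives the germ of a slice
(`exists_slice_germ`). Properness makes a small ball in it a slice chart (`SliceChart.exists_φ_eq`),
so the charts cover.

**Refinements.** If `g` carries the point `φ v` of a slice to the point `φ' v'` of another, then a
small neighbourhood of `v` in the first slice, with the stabilizer of `v` as local group, is a slice
chart with injections to both, whose group elements at the given point are `1` and `g`
(`SliceChart.exists_refinement`). As an injection is determined by its group element at one point
(`SliceInjection.eq_of_a_eq`), these facts are all that is needed of the slice charts, and they are
recorded in the structure `ActionPresentation`.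

**Transport.** Through a refinement, each arrow `g : φ v → φ' v'` of the translation groupoid
induces an isomorphism `E_v → E_{v'}` of the fibres of an orbifold vector bundle `E`, independently
of the refinement and functorially (`ActionPresentation.transport`). The fibre of the pull-back at
`x` is the fibre of `E` at the coordinate of `x` in a chosen chart, `G` acts by transport, and the
total space is topologized as a quotient of the spaces `G × E_c`. The quotient maps are open, since
two points with the same image come from a refinement (`ActionPresentation.exists_shearMap_eq`) and
a bundle map that is isomorphic on fibres over an open map is open
(`ComplexVectorBundle.isOpenMap_of_fiberwise`); hence the quotient is locally trivial and the action
is continuous (`ActionPresentation.pullback`). The same two facts show that pull-backs of isomorphic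
bundles are isomorphic (`ActionPresentation.IsPullback.isomorphic`).

**Descent.** An equivariant bundle `F` is a pull-back of its restriction to the slices, and any `E`
with pull-back `F` is isomorphic to that restriction. Thus pull-back is an additive bijection on
isomorphism classes (`ActionPresentation.isoClassEquiv`), and it induces an isomorphism of the
Grothendieck groups.
-/

/-! ### Local diffeomorphisms and the inverse function theorem -/

section LocalDiffeomorphisms

variable {E E' H H' M N : Type*}
  [NormedAddCommGroup E] [NormedSpace ℝ E] [TopologicalSpace H] {I : ModelWithCorners ℝ E H}
  [NormedAddCommGroup E'] [NormedSpace ℝ E'] [TopologicalSpace H'] {J : ModelWithCorners ℝ E' H'}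
  [TopologicalSpace M] [ChartedSpace H M] [TopologicalSpace N] [ChartedSpace H' N]

/-- A germ of a smooth map with a two-sided inverse germ is a local diffeomorphism. -/
theorem isLocalDiffeomorphAt_of_eventually {f : M → N} {g : N → M} {x : M}
    (hf : ∀ᶠ y in nhds x, ContMDiffAt I J ∞ f y)
    (hg : ∀ᶠ z in nhds (f x), ContMDiffAt J I ∞ g z)
    (hgf : ∀ᶠ y in nhds x, g (f y) = y) (hfg : ∀ᶠ z in nhds (f x), f (g z) = z) :
    IsLocalDiffeomorphAt I J ∞ f x := by
  obtain ⟨U, hU, hUo, hxU⟩ := eventually_nhds_iff.1 (hf.and hgf)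
  obtain ⟨W, hW, hWo, hxW⟩ := eventually_nhds_iff.1 (hg.and hfg)
  have hfc : ContinuousOn f U := fun y hy => (hU y hy).1.continuousAt.continuousWithinAt
  have hgc : ContinuousOn g W := fun y hy => (hW y hy).1.continuousAt.continuousWithinAt
  refine ⟨⟨⟨f, g, U ∩ f ⁻¹' W, W ∩ g ⁻¹' U, ?_, ?_, ?_, ?_⟩, hfc.isOpen_inter_preimage hUo hWo,
    hgc.isOpen_inter_preimage hWo hUo, ?_, ?_⟩, ⟨hxU, hxW⟩, fun y _ => rfl⟩
  · rintro y ⟨hy, hy'⟩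
    exact ⟨hy', by simpa [(hU y hy).2] using hy⟩
  · rintro y ⟨hy, hy'⟩
    exact ⟨hy', by simpa [(hW y hy).2] using hy⟩
  · exact fun y hy => (hU y hy.1).2
  · exact fun y hy => (hW y hy.1).2
  · exact fun y hy => (hU y hy.1).1.contMDiffWithinAt
  · exact fun y hy => (hW y hy.1).1.contMDiffWithinAt

/-- The inverse function theorem for maps of boundaryless manifolds of the same finite
dimension. -/
theorem isLocalDiffeomorphAt_of_mfderiv_injective [I.Boundaryless] [J.Boundaryless]
    [FiniteDimensional ℝ E] [FiniteDimensional ℝ E'] [IsManifold I ∞ M] [IsManifold J ∞ N]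
    (hdim : Module.finrank ℝ E = Module.finrank ℝ E') {f : M → N} {x : M}
    (hf : ∀ᶠ y in nhds x, ContMDiffAt I J ∞ f y)
    (hinj : ∀ ξ : TangentSpace I x, mfderiv I J f x ξ = 0 → ξ = 0) :
    IsLocalDiffeomorphAt I J ∞ f x := by
  have : CompleteSpace E := FiniteDimensional.complete ℝ E
  let ψ := extChartAt I x
  let χ := extChartAt J (f x)
  let F : E → E' := writtenInExtChartAt I J x f
  let a : E := ψ x
  have hfx := hf.self_of_nhds
  have hψs : ContinuousAt ψ.symm a := continuousAt_extChartAt_symm x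
  have hψa : ψ.symm a = x := extChartAt_to_inv x
  have hψs' : ∀ᶠ u in nhds a, ContMDiffAt 𝓘(ℝ, E) I ∞ ψ.symm u := by
    filter_upwards [extChartAt_target_mem_nhds (I := I) x] with u hu
    exact (contMDiffOn_extChartAt_symm x).contMDiffAt
      ((isOpen_extChartAt_target x).mem_nhds hu)
  have htend : Filter.Tendsto ψ.symm (nhds a) (nhds x) := by
    have := hψs.tendsto
    rwa [hψa] at this
  have hχ : ∀ᶠ z in nhds (f x), ContMDiffAt J 𝓘(ℝ, E') ∞ χ z := by
    filter_upwards [extChartAt_source_mem_nhds (I := J) (f x)] with z hz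
    exact contMDiffAt_extChartAt' (by simpa [χ] using hz)
  -- `F`, the map `f` in charts, has an inverse germ at `a` by the inverse function theorem
  have hF : ∀ᶠ u in nhds a, ContDiffAt ℝ ∞ F u := by
    filter_upwards [hψs', htend.eventually hf,
      (hfx.continuousAt.tendsto.comp htend).eventually hχ] with u h1 h2 h3
    exact contMDiffAt_iff_contDiffAt.1
      (ContMDiffAt.comp u h3 (ContMDiffAt.comp u h2 h1))
  have hFa := hF.self_of_nhds
  have hder : mfderiv I J f x = fderiv ℝ F a := by
    rw [(hfx.mdifferentiableAt (by simp)).mfderiv, I.range_eq_univ, fderivWithin_univ]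
  have hinj' : Function.Injective (fderiv ℝ F a).toLinearMap :=
    (injective_iff_map_eq_zero _).2 fun ξ hξ => hinj ξ (by rw [hder]; exact hξ)
  let A : E ≃L[ℝ] E' :=
    (LinearEquiv.ofInjectiveOfFinrankEq (fderiv ℝ F a).toLinearMap hinj' hdim).toContinuousLinearEquiv
  have hA : (A : E →L[ℝ] E') = fderiv ℝ F a := by ext v; rfl
  have hFd : HasFDerivAt F (A : E →L[ℝ] E') a := by
    rw [hA]
    exact (hFa.differentiableAt (by simp)).hasFDerivAt
  let e := hFa.toOpenPartialHomeomorph F hFd (by simp)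
  have hecoe : ∀ u, e u = F u := fun u => rfl
  have hae : a ∈ e.source := hFa.mem_toOpenPartialHomeomorph_source hFd (by simp)
  -- the derivative of `F` is invertible near `a`, so the inverse germ is smooth near `F a`
  have hsymm : ∀ᶠ w in nhds (F a), ContDiffAt ℝ ∞ e.symm w := by
    have h1 : ∀ᶠ u in nhds a, fderiv ℝ F u ∈ Set.range ((↑) : (E ≃L[ℝ] E') → E →L[ℝ] E') := by
      have hc : ContinuousAt (fderiv ℝ F) a := (hFa.fderiv_right (m := 0) (by simp)).continuousAt
      refine hc.tendsto.eventually ?_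
      rw [← hA]
      exact ContinuousLinearEquiv.nhds A
    have h2 := e.symm.continuousAt (x := F a) (e.map_source hae)
    have h3 : Filter.Tendsto e.symm (nhds (F a)) (nhds a) := by
      have := h2.tendsto
      rwa [show e.symm (F a) = a from e.left_inv hae] at this
    filter_upwards [h3.eventually h1, h3.eventually hF, e.open_target.mem_nhds (e.map_source hae)]
      with w h4 h5 h6
    obtain ⟨B, hB⟩ := h4
    refine e.contDiffAt_symm (f₀' := B) h6 ?_ h5
    rw [hB]
    exact (h5.differentiableAt (by simp)).hasFDerivAt
  have hFa' : χ (f x) = F a := by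
    change _ = χ (f (ψ.symm a))
    rw [hψa]
  have hχc : Filter.Tendsto χ (nhds (f x)) (nhds (F a)) := by
    rw [← hFa']
    exact (continuousAt_extChartAt (f x)).tendsto
  have hec : Filter.Tendsto e.symm (nhds (F a)) (nhds a) := by
    have := (e.symm.continuousAt (x := F a) (e.map_source hae)).tendsto
    rwa [show e.symm (F a) = a from e.left_inv hae] at this
  refine isLocalDiffeomorphAt_of_eventually (g := fun z => ψ.symm (e.symm (χ z))) hf ?_ ?_ ?_
  · filter_upwards [hχ, hχc.eventually hsymm, (hec.comp hχc).eventually hψs'] with z h1 h2 h3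
    exact ContMDiffAt.comp z h3 (ContMDiffAt.comp z h2.contMDiffAt h1)
  · have h1 : Filter.Tendsto ψ (nhds x) (nhds a) := (continuousAt_extChartAt x).tendsto
    filter_upwards [extChartAt_source_mem_nhds (I := I) x,
      h1.eventually (e.open_source.mem_nhds hae)] with y h2 h3
    have h4 : χ (f y) = e (ψ y) := by
      change χ (f y) = χ (f (ψ.symm (ψ y)))
      rw [ψ.left_inv h2]
    rw [h4, e.left_inv h3, ψ.left_inv h2]
  · have h0 : Filter.Tendsto (fun z => f (ψ.symm (e.symm (χ z)))) (nhds (f x)) (nhds (f x)) :=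
      hfx.continuousAt.tendsto.comp (htend.comp (hec.comp hχc))
    filter_upwards [extChartAt_source_mem_nhds (I := J) (f x),
      h0.eventually (extChartAt_source_mem_nhds (I := J) (f x)),
      hχc.eventually (e.open_target.mem_nhds (e.map_source hae))] with z h1 h2 h3
    refine χ.injOn h2 h1 ?_
    exact e.right_inv h3

end LocalDiffeomorphisms

/-! ### Orbit maps of points with finite isotropy group -/

section OrbitMap

theorem contMDiff_smul_const_left (d : ℕ) {m : ℕ} {G M : Type*}
    [TopologicalSpace G] [ChartedSpace (EuclideanSpace ℝ (Fin d)) G]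
    [TopologicalSpace M] [ChartedSpace (EuclideanSpace ℝ (Fin m)) M] [SMul G M]
    [ContMDiffSMul (𝓡 d) (𝓡 m) ∞ G M] (g : G) :
    ContMDiff (𝓡 m) (𝓡 m) ∞ (fun x : M => g • x) :=
  (ContMDiffSMul.contMDiff_smul (I := 𝓡 d) (I' := 𝓡 m) (n := ∞) (G := G) (M := M)).comp
    (contMDiff_const.prodMk contMDiff_id)

variable {d m : ℕ} {G M : Type*}
    [Group G] [TopologicalSpace G] [ChartedSpace (EuclideanSpace ℝ (Fin d)) G]
    [TopologicalSpace M] [ChartedSpace (EuclideanSpace ℝ (Fin m)) M]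
    [MulAction G M] [ContMDiffSMul (𝓡 d) (𝓡 m) ∞ G M]

theorem contMDiff_orbitMap (x : M) : ContMDiff (𝓡 d) (𝓡 m) ∞ (fun g : G => g • x) :=
  (ContMDiffSMul.contMDiff_smul (I := 𝓡 d) (I' := 𝓡 m) (n := ∞) (G := G) (M := M)).comp
    (contMDiff_id.prodMk contMDiff_const)

/-- The orbit map of a point with finite isotropy group is an immersion: a tangent vector in the
kernel generates a left-invariant vector field, whose integral curve through `1` stays in the
isotropy group and is therefore constant. -/
theorem mfderiv_orbitMap_injective [LieGroup (𝓡 d) ∞ G] [T2Space G] [IsManifold (𝓡 m) ∞ M] (x : M)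
    [Finite (MulAction.stabilizer G x)] (v : TangentSpace (𝓡 d) (1 : G))
    (hv : mfderiv (𝓡 d) (𝓡 m) (fun g : G => g • x) 1 v = 0) : v = 0 := by
  have : LieGroup (𝓡 d) (minSmoothness ℝ 3) G :=
    LieGroup.of_le (n := ∞) (by
      simp [show (3 : ℕ∞ω) ≤ ∞ from WithTop.coe_le_coe.2 (le_top : (3 : ℕ∞) ≤ ⊤)])
  have : IsManifold (𝓡 d) 1 G := IsManifold.of_le (n := ∞) (by exact_mod_cast le_top)
  have hX : ContMDiffAt (𝓡 d) (𝓡 d).tangent 1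
      (fun g : G ↦ (⟨g, mulInvariantVectorField v g⟩ : TangentBundle (𝓡 d) G)) 1 :=
    (contMDiffAt_mulInvariantVectorField (I := 𝓡 d) v).of_le (by simp)
  obtain ⟨γ, hγ0, hγ⟩ := exists_isMIntegralCurveAt_of_contMDiffAt_boundaryless (0 : ℝ) hX
  have ho := contMDiff_orbitMap (d := d) (m := m) (G := G) x
  -- `(g k) • x = g • (k • x)`, so the left-invariant field is in the kernel everywhere
  have hker : ∀ g : G, mfderiv (𝓡 d) (𝓡 m) (fun g : G => g • x) g
      (mulInvariantVectorField v g) = 0 := by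
    intro g
    have h1 : mfderiv (𝓡 d) (𝓡 m) ((fun g : G => g • x) ∘ fun k => g * k) 1 =
        (mfderiv (𝓡 d) (𝓡 m) (fun g : G => g • x) (g * 1)).comp
          (mfderiv (𝓡 d) (𝓡 d) (fun k => g * k) 1) :=
      mfderiv_comp 1 ((ho _).mdifferentiableAt (by simp))
        ((contMDiff_mul_left (n := ∞) _).mdifferentiableAt (by simp))
    have h2 : mfderiv (𝓡 d) (𝓡 m) ((fun y : M => g • y) ∘ fun k : G => k • x) 1 =
        (mfderiv (𝓡 m) (𝓡 m) (fun y : M => g • y) ((1 : G) • x)).comp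
          (mfderiv (𝓡 d) (𝓡 m) (fun k : G => k • x) 1) :=
      mfderiv_comp 1 ((contMDiff_smul_const_left d g _).mdifferentiableAt (by simp))
        ((ho _).mdifferentiableAt (by simp))
    have h3 : ((fun g : G => g • x) ∘ fun k => g * k) =
        ((fun y : M => g • y) ∘ fun k : G => k • x) :=
      funext fun k => mul_smul g k x
    rw [h3, h2] at h1
    have h4 := DFunLike.congr_fun h1.symm v
    have h5 : mfderiv (𝓡 d) (𝓡 m) (fun g : G => g • x) (g * 1)
        (mfderiv (𝓡 d) (𝓡 d) (fun k => g * k) 1 v) = 0 := by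
      refine h4.trans ?_
      change mfderiv (𝓡 m) (𝓡 m) (fun y : M => g • y) ((1 : G) • x)
        (mfderiv (𝓡 d) (𝓡 m) (fun k : G => k • x) 1 v) = 0
      rw [hv]
      exact map_zero _
    have h6 : ∀ k, k = g → mfderiv (𝓡 d) (𝓡 m) (fun g : G => g • x) k
        (mfderiv (𝓡 d) (𝓡 d) (fun k => g * k) 1 v) = 0 →
        mfderiv (𝓡 d) (𝓡 m) (fun g : G => g • x) g
          (mfderiv (𝓡 d) (𝓡 d) (fun k => g * k) 1 v) = 0 := by
      rintro k rfl h
      exact h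
    exact h6 _ (mul_one g) h5
  -- along the integral curve, the orbit map is constant
  let ψ := extChartAt (𝓡 m) x
  have hγc : Filter.Tendsto γ (nhds 0) (nhds 1) := by
    have := hγ.continuousAt.tendsto
    rwa [hγ0] at this
  have hoc : Filter.Tendsto (fun t => γ t • x) (nhds 0) (nhds x) := by
    have := (ho.continuous.tendsto (1 : G)).comp hγc
    rwa [one_smul] at this
  have hψ0 : ∀ᶠ t in nhds (0 : ℝ), HasDerivAt (fun t => ψ (γ t • x)) 0 t := by
    filter_upwards [hγ, hoc.eventually (extChartAt_source_mem_nhds (I := 𝓡 m) x)] with t h1 h2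
    have h3 : HasMFDerivAt (𝓡 d) (𝓡 m) (fun g : G => g • x) (γ t)
      (mfderiv (𝓡 d) (𝓡 m) (fun g : G => g • x) (γ t)) :=
      ((ho _).mdifferentiableAt (by simp)).hasMFDerivAt
    have h4 : HasMFDerivAt (𝓡 m) 𝓘(ℝ, EuclideanSpace ℝ (Fin m)) ψ (γ t • x)
        (mfderiv (𝓡 m) 𝓘(ℝ, EuclideanSpace ℝ (Fin m)) ψ (γ t • x)) :=
      ((contMDiffAt_extChartAt' (n := ∞) (by rwa [extChartAt_source] at h2)).mdifferentiableAt
        (by simp)).hasMFDerivAt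
    have h5 := HasMFDerivAt.comp t h4 (HasMFDerivAt.comp t h3 h1)
    have h6 : HasMFDerivAt 𝓘(ℝ, ℝ) 𝓘(ℝ, EuclideanSpace ℝ (Fin m)) (fun t => ψ (γ t • x)) t
        (0 : ℝ →L[ℝ] EuclideanSpace ℝ (Fin m)) := by
      refine h5.congr_mfderiv (ContinuousLinearMap.ext fun (s : ℝ) => ?_)
      change mfderiv (𝓡 m) 𝓘(ℝ, EuclideanSpace ℝ (Fin m)) ψ (γ t • x)
        (mfderiv (𝓡 d) (𝓡 m) (fun g : G => g • x) (γ t)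
          (s • mulInvariantVectorField v (γ t))) = 0
      rw [map_smul, hker, smul_zero, map_zero]
    have h7 : HasFDerivAt (fun t => ψ (γ t • x)) (0 : ℝ →L[ℝ] EuclideanSpace ℝ (Fin m)) t :=
      h6.hasFDerivAt
    simpa using h7.hasDerivAt
  have hconst : ∀ᶠ t in nhds (0 : ℝ), γ t • x = x := by
    obtain ⟨ε, hε, hb⟩ := Metric.eventually_nhds_iff_ball.1
      (hψ0.and (hoc.eventually (extChartAt_source_mem_nhds (I := 𝓡 m) x)))
    refine Metric.eventually_nhds_iff_ball.2 ⟨ε, hε, fun t ht => ?_⟩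
    have h0 : (0 : ℝ) ∈ Metric.ball (0 : ℝ) ε := Metric.mem_ball_self hε
    have h1 : ψ (γ t • x) = ψ (γ 0 • x) :=
      (convex_ball (0 : ℝ) ε).is_const_of_fderivWithin_eq_zero (𝕜 := ℝ)
        (fun s hs => (hb s hs).1.differentiableAt.differentiableWithinAt)
        (fun s hs => by
          rw [fderivWithin_of_isOpen Metric.isOpen_ball hs]
          refine ContinuousLinearMap.ext_ring ?_
          rw [fderiv_apply_one_eq_deriv, (hb s hs).1.deriv]
          rfl) ht h0
    have h2 := ψ.injOn (hb t ht).2 (hb 0 h0).2 h1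
    rw [h2, hγ0, one_smul]
  -- the curve stays in the isotropy group, whose elements other than `1` form a closed set
  have hγ1 : ∀ᶠ t in nhds (0 : ℝ), γ t = 1 := by
    have hfin : ((MulAction.stabilizer G x : Set G) \ {1}).Finite :=
      (Set.toFinite (MulAction.stabilizer G x : Set G)).subset Set.sdiff_subset
    have h1 : ∀ᶠ g in nhds (1 : G), g ∉ (MulAction.stabilizer G x : Set G) \ {1} :=
      hfin.isClosed.isOpen_compl.mem_nhds (by simp)
    filter_upwards [hconst, hγc.eventually h1] with t h2 h3
    by_contra h4
    exact h3 ⟨h2, h4⟩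
  have hγd := hγ.hasMFDerivAt
  have hc : HasMFDerivAt 𝓘(ℝ, ℝ) (𝓡 d) γ 0 (0 : ℝ →L[ℝ] EuclideanSpace ℝ (Fin d)) :=
    (hasMFDerivAt_const (1 : G) (0 : ℝ)).congr_of_eventuallyEq hγ1
  have h1 := hasMFDerivAt_unique hγd hc
  have h2 : mulInvariantVectorField (I := 𝓡 d) v (γ 0) = 0 := by
    have h : (1 : ℝ) • mulInvariantVectorField (I := 𝓡 d) v (γ 0) = 0 :=
      DFunLike.congr_fun h1 (1 : ℝ)
    rwa [one_smul] at h
  have h3 : ∀ k : G, k = 1 → mulInvariantVectorField (I := 𝓡 d) v k = 0 → v = 0 := by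
    rintro k rfl h
    rw [mulInvariantVectorField] at h
    have h4 : (fun k : G => 1 * k) = id := funext one_mul
    rw [h4, mfderiv_id] at h
    exact h
  exact h3 _ hγ0 h2

end OrbitMap

/-! ### Germs of local diffeomorphisms -/

section LocalDiffeomorphisms

variable {E E' H H' M N : Type*}
  [NormedAddCommGroup E] [NormedSpace ℝ E] [TopologicalSpace H] {I : ModelWithCorners ℝ E H}
  [NormedAddCommGroup E'] [NormedSpace ℝ E'] [TopologicalSpace H'] {J : ModelWithCorners ℝ E' H'}
  [TopologicalSpace M] [ChartedSpace H M] [TopologicalSpace N] [ChartedSpace H' N]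

/-- A local diffeomorphism in terms of germs: the converse of
`isLocalDiffeomorphAt_of_eventually`. -/
theorem IsLocalDiffeomorphAt.exists_eventually {f : M → N} {x : M}
    (hf : IsLocalDiffeomorphAt I J ∞ f x) : ∃ g : N → M,
    (∀ᶠ y in nhds x, ContMDiffAt I J ∞ f y) ∧
    (∀ᶠ z in nhds (f x), ContMDiffAt J I ∞ g z) ∧
    (∀ᶠ y in nhds x, g (f y) = y) ∧ (∀ᶠ z in nhds (f x), f (g z) = z) := by
  obtain ⟨Φ, hx, hΦ⟩ := hf
  have hs : ∀ᶠ y in nhds x, y ∈ Φ.source := Φ.open_source.mem_nhds hx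
  have ht : ∀ᶠ z in nhds (f x), z ∈ Φ.target := by
    rw [hΦ hx]
    exact Φ.open_target.mem_nhds (Φ.map_source hx)
  refine ⟨Φ.invFun, ?_, ?_, ?_, ?_⟩
  · filter_upwards [hs] with y hy
    exact (Φ.contMDiffOn_toFun.congr hΦ).contMDiffAt (Φ.open_source.mem_nhds hy)
  · filter_upwards [ht] with z hz
    exact Φ.contMDiffOn_invFun.contMDiffAt (Φ.open_target.mem_nhds hz)
  · filter_upwards [hs] with y hy
    rw [hΦ hy]
    exact Φ.left_inv hy
  · filter_upwards [ht] with z hz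
    exact (hΦ (Φ.map_target hz)).trans (Φ.right_inv hz)

theorem IsLocalDiffeomorphAt.eventually {f : M → N} {x : M}
    (hf : IsLocalDiffeomorphAt I J ∞ f x) :
    ∀ᶠ y in nhds x, IsLocalDiffeomorphAt I J ∞ f y := by
  obtain ⟨Φ, hx, hΦ⟩ := hf
  filter_upwards [Φ.open_source.mem_nhds hx] with y hy
  exact ⟨Φ, hy, hΦ⟩

theorem IsLocalDiffeomorphAt.congr_of_eventuallyEq {f f' : M → N} {x : M}
    (hf : IsLocalDiffeomorphAt I J ∞ f x) (h : ∀ᶠ y in nhds x, f' y = f y) :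
    IsLocalDiffeomorphAt I J ∞ f' x := by
  obtain ⟨g, h1, h2, h3, h4⟩ := hf.exists_eventually
  have hx : f' x = f x := h.self_of_nhds
  have hg : Filter.Tendsto g (nhds (f x)) (nhds x) := by
    have := h2.self_of_nhds.continuousAt.tendsto
    rwa [h3.self_of_nhds] at this
  refine isLocalDiffeomorphAt_of_eventually (g := g) ?_ (hx ▸ h2) ?_ (hx ▸ ?_)
  · filter_upwards [h1, h.eventually_nhds] with y hy hy'
    exact hy.congr_of_eventuallyEq hy'
  · filter_upwards [h3, h] with y hy hy'
    rw [hy', hy]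
  · filter_upwards [h4, hg.eventually h] with z hz hz'
    rw [hz', hz]

theorem IsLocalDiffeomorphAt.eventually_injective {f : M → N} {x : M}
    (hf : IsLocalDiffeomorphAt I J ∞ f x) :
    ∀ᶠ p in nhds (x, x), f p.1 = f p.2 → p.1 = p.2 := by
  obtain ⟨g, -, -, h3, -⟩ := hf.exists_eventually
  rw [nhds_prod_eq]
  filter_upwards [h3.prod_mk h3] with p hp h
  rw [← hp.1, h, hp.2]

theorem IsLocalDiffeomorphAt.prodMap {E₁ E₁' H₁ H₁' M₁ N₁ : Type*}
    [NormedAddCommGroup E₁] [NormedSpace ℝ E₁] [TopologicalSpace H₁] {I₁ : ModelWithCorners ℝ E₁ H₁}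
    [NormedAddCommGroup E₁'] [NormedSpace ℝ E₁'] [TopologicalSpace H₁']
    {J₁ : ModelWithCorners ℝ E₁' H₁'}
    [TopologicalSpace M₁] [ChartedSpace H₁ M₁] [TopologicalSpace N₁] [ChartedSpace H₁' N₁]
    {f : M → N} {x : M} {f₁ : M₁ → N₁} {x₁ : M₁}
    (hf : IsLocalDiffeomorphAt I J ∞ f x) (hf₁ : IsLocalDiffeomorphAt I₁ J₁ ∞ f₁ x₁) :
    IsLocalDiffeomorphAt (I.prod I₁) (J.prod J₁) ∞ (Prod.map f f₁) (x, x₁) := by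
  obtain ⟨g, h1, h2, h3, h4⟩ := hf.exists_eventually
  obtain ⟨g₁, k1, k2, k3, k4⟩ := hf₁.exists_eventually
  refine isLocalDiffeomorphAt_of_eventually (g := Prod.map g g₁) ?_ ?_ ?_ ?_
  · rw [nhds_prod_eq]
    filter_upwards [h1.prod_mk k1] with p hp
    exact hp.1.prodMap' hp.2
  · rw [Prod.map_apply, nhds_prod_eq]
    filter_upwards [h2.prod_mk k2] with p hp
    exact hp.1.prodMap' hp.2
  · rw [nhds_prod_eq]
    filter_upwards [h3.prod_mk k3] with p hp
    exact Prod.ext hp.1 hp.2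
  · rw [Prod.map_apply, nhds_prod_eq]
    filter_upwards [h4.prod_mk k4] with p hp
    exact Prod.ext hp.1 hp.2

theorem isLocalDiffeomorph_id : IsLocalDiffeomorph I I ∞ (id : M → M) :=
  (Diffeomorph.refl I M ∞).isLocalDiffeomorph

theorem isLocalDiffeomorph_subtype_val (U : Opens M) :
    IsLocalDiffeomorph I I ∞ (Subtype.val : U → M) := by
  classical
  intro u
  have hU : ∀ᶠ z in nhds (u : M), z ∈ U := U.isOpen.mem_nhds u.2
  refine isLocalDiffeomorphAt_of_eventually (g := fun z => if h : z ∈ U then ⟨z, h⟩ else u)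
    (.of_forall fun _ => contMDiff_subtype_val _) ?_ (.of_forall fun y => by simp) ?_
  · filter_upwards [hU.eventually_nhds] with z hz
    rw [← ContMDiffAt.subtypeVal_comp_iff]
    refine contMDiffAt_id.congr_of_eventuallyEq ?_
    filter_upwards [hz] with y hy
    simp [hy]
  · filter_upwards [hU] with z hz
    simp [hz]

end LocalDiffeomorphisms

/-! ### Orthogonal representations -/

section InvariantComplement

/-- For a finite-dimensional orthogonal representation `W` with subrepresentations `L ≤ D`, the
orthogonal complement of `L` in `D` is a subrepresentation. -/
theorem exists_invariant_complement {H W : Type*} [Group H] [NormedAddCommGroup W]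
    [InnerProductSpace ℝ W] [FiniteDimensional ℝ W] (σ : H → W ≃ₗᵢ[ℝ] W)
    (hσ : ∀ k w, σ k (σ k⁻¹ w) = w) (L D : Submodule ℝ W) (hLD : L ≤ D)
    (hL : ∀ k, ∀ w ∈ L, σ k w ∈ L) (hD : ∀ k, ∀ w ∈ D, σ k w ∈ D)
    {n : ℕ} (hn : Module.finrank ℝ L + n = Module.finrank ℝ D) :
    ∃ (u : EuclideanSpace ℝ (Fin n) →ₗᵢ[ℝ] W)
      (ρ : H → EuclideanSpace ℝ (Fin n) →ₗᵢ[ℝ] EuclideanSpace ℝ (Fin n)),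
      (∀ v, u v ∈ D ∧ u v ∈ Lᗮ) ∧ ∀ k v, u (ρ k v) = σ k (u v) := by
  let N : Submodule ℝ W := Lᗮ ⊓ D
  have hN : Module.finrank ℝ N = n := by
    have := Submodule.finrank_add_inf_finrank_orthogonal hLD
    change Module.finrank ℝ L + Module.finrank ℝ N = _ at this
    omega
  have hNσ : ∀ k, ∀ w ∈ N, σ k w ∈ N := by
    refine fun k w hw => ⟨(Submodule.mem_orthogonal _ _).2 fun l hl => ?_, hD k w hw.2⟩
    rw [← hσ k l, LinearIsometryEquiv.inner_map_map]
    exact (Submodule.mem_orthogonal _ _).1 hw.1 _ (hL _ l hl)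
  -- `u` identifies `ℝⁿ` with `N` through an orthonormal basis
  let e : N ≃ₗᵢ[ℝ] EuclideanSpace ℝ (Fin n) :=
    ((stdOrthonormalBasis ℝ N).reindex (finCongr hN)).repr
  let u : EuclideanSpace ℝ (Fin n) →ₗᵢ[ℝ] W := N.subtypeₗᵢ.comp e.symm.toLinearIsometry
  have hu : ∀ v, u v ∈ N := fun v => (e.symm v).2
  let c : H → EuclideanSpace ℝ (Fin n) →ₗ[ℝ] N := fun k =>
    LinearMap.codRestrict N ((σ k).toLinearEquiv.toLinearMap ∘ₗ u.toLinearMap)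
      fun v => hNσ k _ (hu v)
  have hc : ∀ k v, ((c k v : N) : W) = σ k (u v) := fun k v => rfl
  refine ⟨u, fun k => ⟨e.toLinearEquiv.toLinearMap ∘ₗ c k, fun v => ?_⟩,
    fun v => ⟨(hu v).2, (hu v).1⟩, fun k v => ?_⟩
  · change ‖e (c k v)‖ = ‖v‖
    rw [e.norm_map]
    change ‖((c k v : N) : W)‖ = _
    rw [hc, LinearIsometryEquiv.norm_map, u.norm_map]
  · change ((e.symm (e (c k v)) : N) : W) = _
    rw [e.symm_apply_apply, hc]

/-- The orthogonal projection onto a subrepresentation of an orthogonal representation is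
equivariant. -/
theorem starProjection_map_of_invariant {H W : Type*} [Group H] [NormedAddCommGroup W]
    [InnerProductSpace ℝ W] [FiniteDimensional ℝ W] (σ : H → W ≃ₗᵢ[ℝ] W)
    (hσ : ∀ k w, σ k (σ k⁻¹ w) = w) (D : Submodule ℝ W)
    (hD : ∀ k, ∀ w ∈ D, σ k w ∈ D) (k : H) (w : W) :
    D.starProjection (σ k w) = σ k (D.starProjection w) := by
  refine (Submodule.eq_starProjection_of_mem_orthogonal (hD k _ (D.starProjection_apply_mem w)) ?_)
  refine (Submodule.mem_orthogonal _ _).2 fun l hl => ?_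
  rw [← map_sub, ← hσ k l, LinearIsometryEquiv.inner_map_map]
  exact (Submodule.mem_orthogonal _ _).1 (Submodule.sub_starProjection_mem_orthogonal w) _ (hD _ l hl)

end InvariantComplement

/-! ### Equivariant coordinates around a point with finite isotropy group -/

section LinearSlice

variable {d m : ℕ} {G M : Type*}
  [Group G] [TopologicalSpace M] [ChartedSpace (EuclideanSpace ℝ (Fin m)) M] [MulAction G M]

variable (m) in
/-- The orthogonal representation of a finite group `H` on the `ℝᵐ`-valued functions on `H`, by
right translations. -/
noncomputable def rightTranslation {H : Type*} [Group H] [Fintype H] (k : H) :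
    PiLp 2 (fun _ : H => EuclideanSpace ℝ (Fin m)) ≃ₗᵢ[ℝ]
      PiLp 2 (fun _ : H => EuclideanSpace ℝ (Fin m)) :=
  LinearIsometryEquiv.piLpCongrLeft 2 ℝ (EuclideanSpace ℝ (Fin m)) (Equiv.mulRight k⁻¹)

theorem rightTranslation_apply {H : Type*} [Group H] [Fintype H] (k h : H)
    (w : PiLp 2 (fun _ : H => EuclideanSpace ℝ (Fin m))) :
    rightTranslation m k w h = w (h * k) := by
  rw [rightTranslation, LinearIsometryEquiv.piLpCongrLeft_apply]
  simp [Equiv.piCongrLeft']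

theorem rightTranslation_inv {H : Type*} [Group H] [Fintype H] (k : H)
    (w : PiLp 2 (fun _ : H => EuclideanSpace ℝ (Fin m))) :
    rightTranslation m k (rightTranslation m k⁻¹ w) = w := by
  ext h : 1
  rw [rightTranslation_apply, rightTranslation_apply, mul_inv_cancel_right]

/-- The coordinates of a chart at `x` along the orbit of the isotropy group of `x`: an equivariant
map to the space of functions on the isotropy group. -/
noncomputable def isotropyCoordinates (x : M) [Fintype (MulAction.stabilizer G x)] (y : M) :
    PiLp 2 (fun _ : MulAction.stabilizer G x => EuclideanSpace ℝ (Fin m)) :=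
  WithLp.toLp 2 fun h => extChartAt (𝓡 m) x (h • y) - extChartAt (𝓡 m) x x

variable (x : M) [Fintype (MulAction.stabilizer G x)]

theorem isotropyCoordinates_self : isotropyCoordinates (m := m) (G := G) x x = 0 := by
  ext h : 1
  change extChartAt (𝓡 m) x (h • x) - extChartAt (𝓡 m) x x = 0
  rw [show h • x = x from h.2, sub_self]

theorem isotropyCoordinates_smul (k : MulAction.stabilizer G x) (y : M) :
    isotropyCoordinates (m := m) (G := G) x (k • y) =
      rightTranslation m k (isotropyCoordinates x y) := by
  ext h : 1
  rw [rightTranslation_apply]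
  change extChartAt (𝓡 m) x (h • k • y) - extChartAt (𝓡 m) x x =
    extChartAt (𝓡 m) x ((h * k) • y) - extChartAt (𝓡 m) x x
  rw [mul_smul]

variable [TopologicalSpace G] [ChartedSpace (EuclideanSpace ℝ (Fin d)) G]

theorem contMDiffAt_isotropyCoordinates [ContMDiffSMul (𝓡 d) (𝓡 m) ∞ G M] [IsManifold (𝓡 m) ∞ M] :
    ∀ᶠ y in nhds x, ContMDiffAt (𝓡 m)
      𝓘(ℝ, PiLp 2 (fun _ : MulAction.stabilizer G x => EuclideanSpace ℝ (Fin m))) ∞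
      (isotropyCoordinates (m := m) (G := G) x) y := by
  have h1 : ∀ᶠ y in nhds x, ∀ h : MulAction.stabilizer G x,
      h • y ∈ (chartAt (EuclideanSpace ℝ (Fin m)) x).source := by
    refine Filter.eventually_all.2 fun h => ?_
    have hc : Continuous fun y : M => (h : G) • y :=
      (contMDiff_smul_const_left (m := m) d (h : G)).continuous
    have ht := hc.tendsto x
    rw [show (h : G) • x = x from h.2] at ht
    exact ht.eventually (chart_source_mem_nhds _ x)
  filter_upwards [h1] with y hy
  let e := (PiLp.continuousLinearEquiv 2 ℝ
    (fun _ : MulAction.stabilizer G x => EuclideanSpace ℝ (Fin m))).symm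
  refine ContMDiffAt.comp y (e.contDiff.contMDiff.contMDiffAt) (contMDiffAt_pi_space.2 fun h => ?_)
  have h2 : ContMDiffAt (𝓡 m) 𝓘(ℝ, EuclideanSpace ℝ (Fin m)) ∞
      (fun z : M => extChartAt (𝓡 m) x ((h : G) • z)) y :=
    ContMDiffAt.comp y (contMDiffAt_extChartAt' (hy h))
      (contMDiff_smul_const_left d (h : G)).contMDiffAt
  exact h2.sub contMDiffAt_const

/-- The isotropy coordinates are an immersion at `x`, since one of their components is a chart. -/
theorem mfderiv_isotropyCoordinates_injective [ContMDiffSMul (𝓡 d) (𝓡 m) ∞ G M]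
    [IsManifold (𝓡 m) ∞ M] (ξ : TangentSpace (𝓡 m) x)
    (hξ : mfderiv (𝓡 m) 𝓘(ℝ, PiLp 2 (fun _ : MulAction.stabilizer G x => EuclideanSpace ℝ (Fin m)))
      (isotropyCoordinates (m := m) (G := G) x) x ξ = 0) : ξ = 0 := by
  let W := PiLp 2 (fun _ : MulAction.stabilizer G x => EuclideanSpace ℝ (Fin m))
  let q : W →L[ℝ] EuclideanSpace ℝ (Fin m) := PiLp.proj 2 _ 1
  have h1 := (contMDiffAt_isotropyCoordinates (d := d) (m := m) (G := G) x).self_of_nhds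
    |>.mdifferentiableAt (by simp)
  have h2 : HasMFDerivAt (𝓡 m) 𝓘(ℝ, EuclideanSpace ℝ (Fin m))
      (q ∘ isotropyCoordinates (m := m) (G := G) x) x _ :=
    HasMFDerivAt.comp x q.hasMFDerivAt h1.hasMFDerivAt
  have h3 : q ∘ isotropyCoordinates (m := m) (G := G) x =
      fun y => extChartAt (𝓡 m) x y - extChartAt (𝓡 m) x x := by
    funext y
    change extChartAt (𝓡 m) x ((1 : MulAction.stabilizer G x) • y) - extChartAt (𝓡 m) x x = _
    rw [one_smul]
  have h4 := ((mdifferentiableAt_extChartAt (I := 𝓡 m) (mem_chart_source _ x)).hasMFDerivAt).sub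
    (hasMFDerivAt_const (I := 𝓡 m) (I' := 𝓘(ℝ, EuclideanSpace ℝ (Fin m))) (extChartAt (𝓡 m) x x) x)
  rw [h3] at h2
  have h5 := DFunLike.congr_fun (hasMFDerivAt_unique h2 h4) ξ
  have h6 : mfderiv (𝓡 m) 𝓘(ℝ, EuclideanSpace ℝ (Fin m)) (extChartAt (𝓡 m) x) x ξ = 0 := by
    refine (sub_zero (mfderiv (𝓡 m) 𝓘(ℝ, EuclideanSpace ℝ (Fin m)) (extChartAt (𝓡 m) x) x ξ)).symm.trans
      (h5.symm.trans ?_)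
    exact (congrArg q hξ).trans (map_zero q)
  exact (isInvertible_mfderiv_extChartAt (I := 𝓡 m) (mem_extChartAt_source x)).injective
    (h6.trans (map_zero _).symm)

end LinearSlice

/-! ### Germs of slices -/

section LinearSlice

/-- An immersion `Ψ` at `x` that is equivariant for an orthogonal representation of the isotropy
group of `x` yields the germ of a slice at `x`. With `D` the image of the derivative of `Ψ` and `L ≤
D` the tangent space of the orbit, the orthogonal projection of `Ψ` to `D` is an equivariant chart,
and the slice is the part of the chart that lies in the orthogonal complement of `L` in `D`. -/
theorem exists_slice_germ_of_equivariant_immersion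
    {d m : ℕ} {G M : Type*}
    [Group G] [TopologicalSpace G] [ChartedSpace (EuclideanSpace ℝ (Fin d)) G]
    [LieGroup (𝓡 d) ∞ G] [T2Space G]
    [TopologicalSpace M] [ChartedSpace (EuclideanSpace ℝ (Fin m)) M] [IsManifold (𝓡 m) ∞ M]
    [MulAction G M] [ContMDiffSMul (𝓡 d) (𝓡 m) ∞ G M] (x : M)
    [Finite (MulAction.stabilizer G x)]
    {W : Type*} [NormedAddCommGroup W] [InnerProductSpace ℝ W] [FiniteDimensional ℝ W]
    (σ : MulAction.stabilizer G x → W ≃ₗᵢ[ℝ] W) (Ψ : M → W)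
    (hσ : ∀ k w, σ k (σ k⁻¹ w) = w) (hσ1 : ∀ w, σ 1 w = w)
    (hσm : ∀ k l w, σ (k * l) w = σ k (σ l w)) (hΨ0 : Ψ x = 0)
    (hΨs : ∀ᶠ y in nhds x, ContMDiffAt (𝓡 m) 𝓘(ℝ, W) ∞ Ψ y)
    (hΨσ : ∀ (k : MulAction.stabilizer G x) y, Ψ ((k : G) • y) = σ k (Ψ y))
    (hΨi : ∀ ξ : TangentSpace (𝓡 m) x, mfderiv (𝓡 m) 𝓘(ℝ, W) Ψ x ξ = 0 → ξ = 0) :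
    ∃ (φ : EuclideanSpace ℝ (Fin (m - d)) → M)
      (ρ : MulAction.stabilizer G x →
        EuclideanSpace ℝ (Fin (m - d)) →ₗᵢ[ℝ] EuclideanSpace ℝ (Fin (m - d))),
      φ 0 = x ∧ (∀ v, ρ 1 v = v) ∧ (∀ k l v, ρ (k * l) v = ρ k (ρ l v)) ∧
      (∀ᶠ v in nhds 0, ContMDiffAt (𝓡 (m - d)) (𝓡 m) ∞ φ v) ∧
      (∀ k, ∀ᶠ v in nhds 0, φ (ρ k v) = k • φ v) ∧
      IsLocalDiffeomorphAt ((𝓡 d).prod (𝓡 (m - d))) (𝓡 m) ∞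
        (fun p : G × EuclideanSpace ℝ (Fin (m - d)) => p.1 • φ p.2) (1, 0) := by
  obtain ⟨A, hA, hAinj⟩ : ∃ A : EuclideanSpace ℝ (Fin m) →L[ℝ] W,
      (∀ y, y = x → HasMFDerivAt (𝓡 m) 𝓘(ℝ, W) Ψ y A) ∧ Function.Injective A := by
    refine ⟨mfderiv (𝓡 m) 𝓘(ℝ, W) Ψ x, ?_, (injective_iff_map_eq_zero _).2 hΨi⟩
    rintro y rfl
    exact (hΨs.self_of_nhds.mdifferentiableAt (by simp)).hasMFDerivAt
  obtain ⟨o, ho, hoinj⟩ : ∃ o : EuclideanSpace ℝ (Fin d) →L[ℝ] EuclideanSpace ℝ (Fin m),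
      HasMFDerivAt (𝓡 d) (𝓡 m) (fun g : G => g • x) 1 o ∧ Function.Injective o :=
    ⟨mfderiv (𝓡 d) (𝓡 m) (fun g : G => g • x) 1,
      ((contMDiff_orbitMap x _).mdifferentiableAt (by simp)).hasMFDerivAt,
      (injective_iff_map_eq_zero _).2 (mfderiv_orbitMap_injective (G := G) x)⟩
  let B : EuclideanSpace ℝ (Fin d) →L[ℝ] W := A.comp o
  have hB : ∀ g : G, g = 1 → HasMFDerivAt (𝓡 d) 𝓘(ℝ, W) (fun g : G => Ψ (g • x)) g B := by
    rintro g rfl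
    exact HasMFDerivAt.comp (g := Ψ) (f := fun g : G => g • x) (1 : G) (hA _ (one_smul G x)) ho
  have hBinj : Function.Injective B := hAinj.comp hoinj
  let D : Submodule ℝ W := A.toLinearMap.range
  let L : Submodule ℝ W := B.toLinearMap.range
  have hLD : L ≤ D := LinearMap.range_comp_le_range o.toLinearMap A.toLinearMap
  -- `D` and `L` are subrepresentations, because `Ψ (k • y) = σ k (Ψ y)` can be differentiated along
  -- `M` and along the orbit of `x`
  have hD : ∀ k, ∀ w ∈ D, σ k w ∈ D := by
    rintro k _ ⟨ξ, rfl⟩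
    have h1 : HasMFDerivAt (𝓡 m) (𝓡 m) (fun y : M => (k : G) • y) x
      (mfderiv (𝓡 m) (𝓡 m) (fun y : M => (k : G) • y) x) :=
      ((contMDiff_smul_const_left d (k : G) x).mdifferentiableAt (by simp)).hasMFDerivAt
    have h2 := HasMFDerivAt.comp x (hA _ (show (k : G) • x = x from k.2)) h1
    have h3 := HasMFDerivAt.comp x ((σ k).toContinuousLinearEquiv.hasMFDerivAt) (hA x rfl)
    have h4 : Ψ ∘ (fun y : M => (k : G) • y) = (σ k).toContinuousLinearEquiv ∘ Ψ :=
      funext fun y => hΨσ k y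
    rw [h4] at h2
    exact ⟨_, DFunLike.congr_fun (hasMFDerivAt_unique h2 h3) ξ⟩
  have hL : ∀ k, ∀ w ∈ L, σ k w ∈ L := by
    rintro k _ ⟨ξ, rfl⟩
    let c : G → G := fun g => k * g * (k : G)⁻¹
    have hc : ContMDiff (𝓡 d) (𝓡 d) ∞ c :=
      (contMDiff_mul_right (a := (k : G)⁻¹)).comp (contMDiff_mul_left (a := (k : G)))
    have h1 : HasMFDerivAt (𝓡 d) (𝓡 d) c 1 (mfderiv (𝓡 d) (𝓡 d) c 1) :=
      ((hc 1).mdifferentiableAt (by simp)).hasMFDerivAt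
    have h2 := HasMFDerivAt.comp 1 (hB (c 1) (by simp [c])) h1
    have h3 := HasMFDerivAt.comp (1 : G) ((σ k).toContinuousLinearEquiv.hasMFDerivAt) (hB 1 rfl)
    have h4 : (fun g : G => Ψ (g • x)) ∘ c =
        (σ k).toContinuousLinearEquiv ∘ (fun g : G => Ψ (g • x)) := by
      funext g
      have h5 : (k : G)⁻¹ • x = x := inv_smul_eq_iff.2 (show (k : G) • x = x from k.2).symm
      change Ψ ((k * g * (k : G)⁻¹) • x) = σ k (Ψ (g • x))
      rw [mul_smul, mul_smul, h5, hΨσ]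
    rw [h4] at h2
    exact ⟨_, DFunLike.congr_fun (hasMFDerivAt_unique h2 h3) ξ⟩
  have hDm : Module.finrank ℝ D = m := by
    rw [LinearMap.finrank_range_of_inj hAinj, finrank_euclideanSpace_fin]
  have hLd : Module.finrank ℝ L = d := by
    rw [LinearMap.finrank_range_of_inj hBinj, finrank_euclideanSpace_fin]
  have hdm : d ≤ m := by
    rw [← hDm, ← hLd]
    exact Submodule.finrank_mono hLD
  obtain ⟨u, ρ, hu, hρ⟩ := exists_invariant_complement σ hσ L D hLD hL hD (n := m - d) (by omega)
  -- the orthogonal projection of `Ψ` to `D` is an equivariant chart at `x`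
  let P : W →L[ℝ] D := D.orthogonalProjectionOnto
  have hPc : ∀ w, (P w : W) = D.starProjection w := fun w => rfl
  have hPD : ∀ w (hw : w ∈ D), P w = ⟨w, hw⟩ := fun w hw =>
    D.orthogonalProjectionOnto_mem_subspace_eq_self ⟨w, hw⟩
  have hPA : ∀ ξ, (P (A ξ) : W) = A ξ := fun ξ => congrArg Subtype.val (hPD _ ⟨ξ, rfl⟩)
  have hPA0 : ∀ ξ, P (A ξ) = 0 → ξ = 0 := by
    intro ξ h1
    have h2 := hPA ξ
    rw [h1] at h2
    exact hAinj (h2.symm.trans (map_zero A).symm)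
  let f : M → D := fun y => P (Ψ y)
  have hf0 : f x = 0 := by
    change P (Ψ x) = 0
    rw [hΨ0, map_zero]
  have hfs : ∀ᶠ y in nhds x, ContMDiffAt (𝓡 m) 𝓘(ℝ, D) ∞ f y := by
    filter_upwards [hΨs] with y hy
    exact ContMDiffAt.comp y P.contMDiff.contMDiffAt hy
  have hfd : HasMFDerivAt (𝓡 m) 𝓘(ℝ, D) f x (P.comp A) :=
    HasMFDerivAt.comp x P.hasMFDerivAt (hA x rfl)
  have hfl : IsLocalDiffeomorphAt (𝓡 m) 𝓘(ℝ, D) ∞ f x := by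
    refine isLocalDiffeomorphAt_of_mfderiv_injective (by rw [hDm, finrank_euclideanSpace_fin]) hfs
      fun ξ hξ => ?_
    rw [hfd.mfderiv] at hξ
    exact hPA0 ξ hξ
  obtain ⟨κ, -, hκs, hκf, hfκ⟩ := hfl.exists_eventually
  have hκ0 : κ 0 = x := by rw [← hf0, hκf.self_of_nhds]
  rw [hf0] at hκs hfκ
  -- the slice is the inverse image under the chart of the complement of `L` in `D`
  let uD : EuclideanSpace ℝ (Fin (m - d)) →L[ℝ] D :=
    u.toContinuousLinearMap.codRestrict D fun v => (hu v).1
  have huD : ∀ v, (uD v : W) = u v := fun v => rfl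
  have huc : Filter.Tendsto uD (nhds 0) (nhds 0) := by
    have := uD.continuous.tendsto 0
    rwa [map_zero] at this
  let φ : EuclideanSpace ℝ (Fin (m - d)) → M := fun v => κ (uD v)
  have hφ0 : φ 0 = x := by rw [← hκ0, ← map_zero uD]
  have hφs : ∀ᶠ v in nhds 0, ContMDiffAt (𝓡 (m - d)) (𝓡 m) ∞ φ v := by
    filter_upwards [huc.eventually hκs] with v hv
    exact ContMDiffAt.comp v hv uD.contMDiff.contMDiffAt
  have hφc : Filter.Tendsto φ (nhds 0) (nhds x) := by
    have := hφs.self_of_nhds.continuousAt.tendsto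
    rwa [hφ0] at this
  have hfφ : ∀ᶠ v in nhds 0, f (φ v) = uD v := huc.eventually hfκ
  refine ⟨φ, ρ, hφ0, fun v => u.injective ?_, fun k l v => u.injective ?_, hφs, fun k => ?_, ?_⟩
  · rw [hρ, hσ1]
  · rw [hρ, hρ, hρ, hσm]
  · have hk : Filter.Tendsto (fun v => (k : G) • φ v) (nhds 0) (nhds x) := by
      have h1 := ((contMDiff_smul_const_left (m := m) d (k : G)).continuous.tendsto x).comp hφc
      rwa [show (k : G) • x = x from k.2] at h1
    filter_upwards [hfφ, hk.eventually hκf] with v h1 h2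
    have h3 : f ((k : G) • φ v) = uD (ρ k v) := by
      refine Subtype.ext ?_
      rw [huD, hρ, ← huD, ← h1]
      change D.starProjection (Ψ ((k : G) • φ v)) = σ k (D.starProjection (Ψ (φ v)))
      rw [hΨσ, starProjection_map_of_invariant σ hσ D hD]
    exact (congrArg κ h3).symm.trans h2
  · have hΦs : ∀ᶠ p in nhds ((1 : G), (0 : EuclideanSpace ℝ (Fin (m - d)))),
        ContMDiffAt ((𝓡 d).prod (𝓡 (m - d))) (𝓡 m) ∞
          (fun p : G × EuclideanSpace ℝ (Fin (m - d)) => p.1 • φ p.2) p := by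
      rw [nhds_prod_eq]
      filter_upwards [hφs.prod_inr (nhds (1 : G))] with p hp
      exact ContMDiffAt.comp p
        (ContMDiffSMul.contMDiff_smul (I := 𝓡 d) (I' := 𝓡 m) (n := ∞) (G := G) (M := M)).contMDiffAt
        (contMDiffAt_fst.prodMk (ContMDiffAt.comp p hp contMDiffAt_snd))
    refine isLocalDiffeomorphAt_of_mfderiv_injective ?_ hΦs ?_
    · rw [Module.finrank_prod, finrank_euclideanSpace_fin, finrank_euclideanSpace_fin,
        finrank_euclideanSpace_fin]
      omega
    · obtain ⟨δ, hδ⟩ : ∃ δ : EuclideanSpace ℝ (Fin (m - d)) →L[ℝ] EuclideanSpace ℝ (Fin m),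
          HasMFDerivAt (𝓡 (m - d)) (𝓡 m) φ 0 δ :=
        ⟨mfderiv (𝓡 (m - d)) (𝓡 m) φ 0,
          (hφs.self_of_nhds.mdifferentiableAt (by simp)).hasMFDerivAt⟩
      suffices key : ∀ (a : EuclideanSpace ℝ (Fin d)) (b : EuclideanSpace ℝ (Fin (m - d))),
          o a + δ b = 0 → a = 0 ∧ b = 0 by
        rintro ⟨a, b⟩ hξ
        have h1 := mfderiv_prod_eq_add_apply (v := (a, b))
          (hΦs.self_of_nhds.mdifferentiableAt (by simp))
        rw [hξ] at h1
        have h2 : (fun z : EuclideanSpace ℝ (Fin (m - d)) => (1 : G) • φ z) = φ :=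
          funext fun z => one_smul G _
        have h3 : mfderiv (𝓡 d) (𝓡 m) (fun z : G => z • φ 0) 1 = o := by
          rw [hφ0]
          exact ho.mfderiv
        have h4 : mfderiv (𝓡 (m - d)) (𝓡 m)
            (fun z : EuclideanSpace ℝ (Fin (m - d)) => (1 : G) • φ z) 0 = δ := by
          rw [h2]
          exact hδ.mfderiv
        obtain ⟨ha, hb⟩ := key a b (by
          refine Eq.trans ?_ h1.symm
          exact congrArg₂ (· + ·) (DFunLike.congr_fun h3 a).symm (DFunLike.congr_fun h4 b).symm)
        rw [ha, hb]
        rfl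
      -- `A` maps `o a` to `L` and `δ b` to `u b`, which is orthogonal to `L`
      intro a b h4
      have h5 : P (A (δ b)) = uD b := by
        have h1 : HasMFDerivAt (𝓡 (m - d)) 𝓘(ℝ, D) (f ∘ φ) 0 ((P.comp A).comp δ) :=
          HasMFDerivAt.comp 0 (by rw [hφ0]; exact hfd) hδ
        have h2 : HasMFDerivAt (𝓡 (m - d)) 𝓘(ℝ, D) (f ∘ φ) 0 uD :=
          uD.hasMFDerivAt.congr_of_eventuallyEq hfφ
        exact DFunLike.congr_fun (hasMFDerivAt_unique h1 h2) b
      have h6 : A (δ b) = u b := by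
        rw [← hPA, h5, huD]
      have h7 : B a + u b = 0 := by
        rw [← h6]
        change A (o a) + A (δ b) = 0
        rw [← map_add, h4, map_zero]
      have h8 : u b = 0 := by
        have h9 : u b ∈ L := by
          rw [eq_neg_of_add_eq_zero_right h7]
          exact L.neg_mem ⟨a, rfl⟩
        exact inner_self_eq_zero.1 ((Submodule.mem_orthogonal _ _).1 (hu b).2 _ h9)
      have h9 : b = 0 := u.injective (h8.trans (map_zero u).symm)
      have h10 : a = 0 := by
        refine hBinj (Eq.trans ?_ (map_zero B).symm)
        rw [h8, add_zero] at h7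
        exact h7
      exact ⟨h10, h9⟩

/-- The germ of a slice at a point `x` with finite isotropy group: an equivariant map `φ` from an
orthogonal representation `ρ` of the isotropy group to `M`, defined near `0`, with `φ 0 = x`, such
that `(g, v) ↦ g • φ v` is a local diffeomorphism. -/
theorem exists_slice_germ
    {d m : ℕ} {G M : Type*}
    [Group G] [TopologicalSpace G] [ChartedSpace (EuclideanSpace ℝ (Fin d)) G]
    [LieGroup (𝓡 d) ∞ G] [T2Space G]
    [TopologicalSpace M] [ChartedSpace (EuclideanSpace ℝ (Fin m)) M] [IsManifold (𝓡 m) ∞ M]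
    [MulAction G M] [ContMDiffSMul (𝓡 d) (𝓡 m) ∞ G M] (x : M)
    [Finite (MulAction.stabilizer G x)] :
    ∃ (φ : EuclideanSpace ℝ (Fin (m - d)) → M)
      (ρ : MulAction.stabilizer G x →
        EuclideanSpace ℝ (Fin (m - d)) →ₗᵢ[ℝ] EuclideanSpace ℝ (Fin (m - d))),
      φ 0 = x ∧ (∀ v, ρ 1 v = v) ∧ (∀ k l v, ρ (k * l) v = ρ k (ρ l v)) ∧
      (∀ᶠ v in nhds 0, ContMDiffAt (𝓡 (m - d)) (𝓡 m) ∞ φ v) ∧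
      (∀ k, ∀ᶠ v in nhds 0, φ (ρ k v) = k • φ v) ∧
      IsLocalDiffeomorphAt ((𝓡 d).prod (𝓡 (m - d))) (𝓡 m) ∞
        (fun p : G × EuclideanSpace ℝ (Fin (m - d)) => p.1 • φ p.2) (1, 0) := by
  have := Fintype.ofFinite (MulAction.stabilizer G x)
  refine exists_slice_germ_of_equivariant_immersion x (rightTranslation m)
    (isotropyCoordinates (m := m) (G := G) x) rightTranslation_inv
    (fun w => ?_) (fun k l w => ?_) (isotropyCoordinates_self x)
    (contMDiffAt_isotropyCoordinates (d := d) x) (isotropyCoordinates_smul x)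
    (mfderiv_isotropyCoordinates_injective (d := d) (G := G) x)
  · ext h : 1
    rw [rightTranslation_apply, mul_one]
  · ext h : 1
    rw [rightTranslation_apply, rightTranslation_apply, rightTranslation_apply, mul_assoc]

end LinearSlice

/-! ### The slice theorem -/

section SliceTheorem

/-- For a proper action, group elements that match nearby points of a slice germ at `x` belong to
the isotropy group of `x`. By properness, such elements accumulate at an element `g₀` of the
isotropy group; then the local injectivity of `(g, v) ↦ g • φ v` shows that they are eventually
equal to `g₀`. -/
theorem eventually_mem_stabilizer_of_smul_eq {G M : Type*} [Group G] [TopologicalSpace G]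
    [IsTopologicalGroup G] [TopologicalSpace M] [MulAction G M] [ProperSMul G M] {n : ℕ} (x : M)
    {φ : EuclideanSpace ℝ (Fin n) → M}
    {ρ : MulAction.stabilizer G x → EuclideanSpace ℝ (Fin n) →ₗᵢ[ℝ] EuclideanSpace ℝ (Fin n)}
    (hφ0 : φ 0 = x) (hφc : ContinuousAt φ 0)
    (hφρ : ∀ k, ∀ᶠ v in nhds 0, φ (ρ k v) = k • φ v)
    (hinj : ∀ᶠ p in nhds (((1 : G), (0 : EuclideanSpace ℝ (Fin n))),
      ((1 : G), (0 : EuclideanSpace ℝ (Fin n)))),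
      p.1.1 • φ p.1.2 = p.2.1 • φ p.2.2 → p.1 = p.2) :
    ∀ᶠ p in nhds ((0 : EuclideanSpace ℝ (Fin n)), (0 : EuclideanSpace ℝ (Fin n))),
      ∀ g : G, g • φ p.1 = φ p.2 → g ∈ MulAction.stabilizer G x := by
  by_contra hcon
  have hcon' := Filter.not_eventually.1 hcon
  classical
  let g : EuclideanSpace ℝ (Fin n) × EuclideanSpace ℝ (Fin n) → G := fun p =>
    if h : ∃ g : G, g • φ p.1 = φ p.2 ∧ g ∉ MulAction.stabilizer G x then h.choose else 1
  have hg : ∀ p, (¬ ∀ g : G, g • φ p.1 = φ p.2 → g ∈ MulAction.stabilizer G x) →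
      g p • φ p.1 = φ p.2 ∧ g p ∉ MulAction.stabilizer G x := by
    intro p hp
    push Not at hp
    simp only [g, dif_pos hp]
    exact hp.choose_spec
  -- along an ultrafilter, the elements `g p` outside the isotropy group converge by properness
  obtain ⟨𝒰, h𝒰, hS⟩ := Filter.exists_ultrafilter_iff.2 (Filter.frequently_iff_neBot.1 hcon') |>.imp
    fun 𝒰 h => le_inf_iff.1 h
  have hS' : ∀ᶠ p in (𝒰 : Filter _), g p • φ p.1 = φ p.2 ∧ g p ∉ MulAction.stabilizer G x := by
    filter_upwards [Filter.le_principal_iff.1 hS] with p hp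
    exact hg p hp
  have h1 : Filter.Tendsto (fun p : EuclideanSpace ℝ (Fin n) × EuclideanSpace ℝ (Fin n) => p.1) 𝒰
      (nhds 0) := (continuous_fst.tendsto _).mono_left h𝒰
  have h2 : Filter.Tendsto (fun p : EuclideanSpace ℝ (Fin n) × EuclideanSpace ℝ (Fin n) => p.2) 𝒰
      (nhds 0) := (continuous_snd.tendsto _).mono_left h𝒰
  have hφt : Filter.Tendsto φ (nhds 0) (nhds x) := by
    have := hφc.tendsto
    rwa [hφ0] at this
  obtain ⟨-, hprop⟩ := properSMul_iff_continuousSMul_ultrafilter_tendsto.1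
    (inferInstance : ProperSMul G M)
  obtain ⟨g₀, hg₀, hlim⟩ := hprop (𝒰.map fun p => (g p, φ p.1)) x x (by
    refine Filter.tendsto_map'_iff.2 (Filter.Tendsto.prodMk_nhds ?_ (hφt.comp h1))
    refine (hφt.comp h2).congr' ?_
    filter_upwards [hS'] with p hp
    exact hp.1.symm)
  have hlim' : Filter.Tendsto g 𝒰 (nhds g₀) := Filter.tendsto_map'_iff.1 hlim
  let k₀ : MulAction.stabilizer G x := ⟨g₀, hg₀⟩
  have h3 : Filter.Tendsto (fun p => g₀⁻¹ * g p) 𝒰 (nhds 1) := by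
    have := (continuous_const_mul g₀⁻¹).tendsto g₀ |>.comp hlim'
    rwa [inv_mul_cancel] at this
  have h4 : Filter.Tendsto (fun p : EuclideanSpace ℝ (Fin n) × EuclideanSpace ℝ (Fin n) =>
      ρ k₀⁻¹ p.2) 𝒰 (nhds 0) := by
    have := ((ρ k₀⁻¹).continuous.tendsto 0).comp h2
    rwa [map_zero] at this
  -- so `g₀⁻¹ * g p` carries `φ p.1` to a point of the slice and tends to `1`
  have h5 := ((h3.prodMk_nhds h1).prodMk_nhds
    ((tendsto_const_nhds (x := (1 : G))).prodMk_nhds h4)).eventually hinj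
  obtain ⟨p, hp, hp', hp''⟩ := (hS'.and (h5.and (h2.eventually (hφρ k₀⁻¹)))).exists
  have h6 : (g₀⁻¹ * g p) • φ p.1 = (1 : G) • φ (ρ k₀⁻¹ p.2) := by
    rw [mul_smul, hp.1, one_smul, hp'']
    rfl
  have h7 : g₀⁻¹ * g p = 1 := congrArg Prod.fst (hp' h6)
  exact hp.2 (by rw [← inv_mul_eq_one.1 h7]; exact hg₀)

variable {d m : ℕ} {G M : Type*}
    [Group G] [TopologicalSpace G] [ChartedSpace (EuclideanSpace ℝ (Fin d)) G]
    [LieGroup (𝓡 d) ∞ G] [T2Space G]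
    [TopologicalSpace M] [ChartedSpace (EuclideanSpace ℝ (Fin m)) M] [IsManifold (𝓡 m) ∞ M]
    [MulAction G M] [ContMDiffSMul (𝓡 d) (𝓡 m) ∞ G M]

/-- The slice theorem: every point with finite isotropy group lies on the slice of a slice chart. -/
theorem SliceChart.exists_φ_eq [ProperSMul G M] (x : M) [Finite (MulAction.stabilizer G x)] :
    ∃ (c : SliceChart d m G M) (v : c.V), c.φ v = x := by
  obtain ⟨φ, ρ, hφ0, hρ1, hρm, hφs, hφρ, hΦ⟩ := exists_slice_germ (d := d) (m := m) (G := G) x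
  have : IsTopologicalGroup G := topologicalGroup_of_lieGroup (𝓡 d) ∞
  have hinj := hΦ.eventually_injective
  have hmem := eventually_mem_stabilizer_of_smul_eq x hφ0
    hφs.self_of_nhds.continuousAt hφρ hinj
  have hl : ∀ᶠ v in nhds (0 : EuclideanSpace ℝ (Fin (m - d))),
      IsLocalDiffeomorphAt ((𝓡 d).prod (𝓡 (m - d))) (𝓡 m) ∞
        (fun p : G × EuclideanSpace ℝ (Fin (m - d)) => p.1 • φ p.2) (1, v) :=
    ((continuous_const.prodMk continuous_id).tendsto
      (0 : EuclideanSpace ℝ (Fin (m - d)))).eventually hΦ.eventually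
  have hi : ∀ᶠ p in nhds ((0 : EuclideanSpace ℝ (Fin (m - d))), (0 : EuclideanSpace ℝ (Fin (m - d)))),
      φ p.1 = φ p.2 → p.1 = p.2 := by
    have hc : Continuous fun p : EuclideanSpace ℝ (Fin (m - d)) × EuclideanSpace ℝ (Fin (m - d)) =>
        (((1 : G), p.1), ((1 : G), p.2)) := by fun_prop
    filter_upwards [(hc.tendsto (0, 0)).eventually hinj] with p hp h
    exact congrArg Prod.snd (hp (by rw [one_smul, one_smul, h]))
  -- a ball on which all these germs are defined; it is invariant under the isometries `ρ k`
  obtain ⟨r, hr, hb⟩ := Metric.eventually_nhds_iff_ball.1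
    (hφs.and ((Filter.eventually_all.2 hφρ).and hl))
  obtain ⟨r', hr', hb'⟩ := Metric.eventually_nhds_iff_ball.1 (hmem.and hi)
  let ε := min r r'
  have hε : 0 < ε := lt_min hr hr'
  let V : Opens (EuclideanSpace ℝ (Fin (m - d))) := ⟨Metric.ball 0 ε, Metric.isOpen_ball⟩
  have hV : ∀ v : V, (v : EuclideanSpace ℝ (Fin (m - d))) ∈ Metric.ball 0 r := fun v =>
    Metric.ball_subset_ball (min_le_left _ _) v.2
  have hV' : ∀ v w : V, ((v : EuclideanSpace ℝ (Fin (m - d))), (w : EuclideanSpace ℝ (Fin (m - d)))) ∈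
      Metric.ball (0, 0) r' := fun v w => by
    rw [← ball_prod_same]
    exact ⟨Metric.ball_subset_ball (min_le_right _ _) v.2,
      Metric.ball_subset_ball (min_le_right _ _) w.2⟩
  have hρV : ∀ k (v : V), ρ k v ∈ V := by
    intro k v
    have := v.2
    change ρ k v ∈ Metric.ball 0 ε
    rw [mem_ball_zero_iff, LinearIsometry.norm_map]
    exact mem_ball_zero_iff.1 this
  let act : MulAction (MulAction.stabilizer G x) V :=
    { smul := fun k v => ⟨ρ k v, hρV k v⟩
      one_smul := fun v => Subtype.ext (hρ1 v)
      mul_smul := fun k l v => Subtype.ext (hρm k l v) }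
  have hact : ∀ (k : MulAction.stabilizer G x) (v : V), φ (k • v : V) = (k : G) • φ v :=
    fun k v => (hb v (hV v)).2.1 k
  refine ⟨{ V := V
            isConnected_V := (convex_ball 0 ε).isConnected ⟨0, Metric.mem_ball_self hε⟩
            H := MulAction.stabilizer G x
            contMDiff_smul := fun k => ?_
            φ := fun v => φ v
            φ_smul := hact
            isLocalDiffeomorph := ?_
            exists_of_smul_eq := ?_ }, ⟨0, Metric.mem_ball_self hε⟩, hφ0⟩
  · rw [← ContMDiff.subtypeVal_comp_iff]
    exact (ρ k).toContinuousLinearMap.contMDiff.comp contMDiff_subtype_val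
  -- left translation by `g` reduces the local diffeomorphism property at `(g, v)` to `(1, v)`
  · rintro ⟨g, v⟩
    have h1 : IsLocalDiffeomorphAt ((𝓡 d).prod (𝓡 (m - d))) ((𝓡 d).prod (𝓡 (m - d))) ∞
        (Prod.map (fun k : G => g⁻¹ * k) (Subtype.val : V → EuclideanSpace ℝ (Fin (m - d)))) (g, v) :=
      IsLocalDiffeomorphAt.prodMap
        (isLocalDiffeomorphAt_of_eventually (g := fun k => g * k)
          (.of_forall fun _ => contMDiff_mul_left _) (.of_forall fun _ => contMDiff_mul_left _)
          (.of_forall fun y => mul_inv_cancel_left g y) (.of_forall fun y => inv_mul_cancel_left g y))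
        (isLocalDiffeomorph_subtype_val V v)
    have h2 : IsLocalDiffeomorphAt ((𝓡 d).prod (𝓡 (m - d))) (𝓡 m) ∞
        (fun p : G × EuclideanSpace ℝ (Fin (m - d)) => p.1 • φ p.2)
        (Prod.map (fun k : G => g⁻¹ * k) (Subtype.val : V → EuclideanSpace ℝ (Fin (m - d))) (g, v)) := by
      rw [Prod.map_apply, inv_mul_cancel]
      exact (hb v (hV v)).2.2
    have h3 : IsLocalDiffeomorph (𝓡 m) (𝓡 m) ∞ (fun y : M => g • y) := fun y =>
      isLocalDiffeomorphAt_of_eventually (g := fun z => g⁻¹ • z)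
        (.of_forall fun _ => contMDiff_smul_const_left d _ _)
        (.of_forall fun _ => contMDiff_smul_const_left d _ _)
        (.of_forall fun y => inv_smul_smul g y) (.of_forall fun y => smul_inv_smul g y)
    have h4 := IsLocalDiffeomorphAt.comp (hf := IsLocalDiffeomorphAt.comp (hf := h1) (hg := h2))
      (hg := h3 _)
    refine h4.congr_of_eventuallyEq (.of_forall fun p => ?_)
    change p.1 • φ p.2 = g • (g⁻¹ * p.1) • φ p.2
    rw [← mul_smul, mul_inv_cancel_left]
  · intro g v w h
    have h1 := hb' _ (hV' v w)
    let k : MulAction.stabilizer G x := ⟨g, h1.1 g h⟩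
    exact ⟨k, rfl, Subtype.ext ((hb' _ (hV' (k • v) w)).2 ((hact k v).trans h))⟩

end SliceTheorem

/-! ### Common refinements of slice charts -/

section Refinement

theorem isLocalDiffeomorph_inclusion {E H M : Type*}
    [NormedAddCommGroup E] [NormedSpace ℝ E] [TopologicalSpace H] {I : ModelWithCorners ℝ E H}
    [TopologicalSpace M] [ChartedSpace H M] {U V : Opens M} (h : U ≤ V) :
    IsLocalDiffeomorph I I ∞ (Opens.inclusion h : U → V) := by
  classical
  intro u
  have hU : ∀ᶠ z : V in nhds (Opens.inclusion h u), (z : M) ∈ U :=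
    (U.isOpen.preimage continuous_subtype_val).mem_nhds u.2
  refine isLocalDiffeomorphAt_of_eventually (g := fun z : V => if h : (z : M) ∈ U then ⟨z, h⟩ else u)
    (.of_forall fun _ => contMDiff_inclusion h _) ?_
    (.of_forall fun y => by simp) ?_
  · filter_upwards [hU.eventually_nhds] with z hz
    rw [← ContMDiffAt.subtypeVal_comp_iff]
    refine (contMDiff_subtype_val z).congr_of_eventuallyEq ?_
    filter_upwards [hz] with y hy
    simp [hy]
  · filter_upwards [hU] with z hz
    simp [hz, Opens.inclusion]

/-- A point of a locally connected Hausdorff space with an action of a finite group has arbitrarily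
small connected open neighbourhoods that are invariant under the stabilizer of the point and
disjoint from their translates by all other elements. -/
theorem exists_isConnected_invariant_nhds {H X : Type*} [Group H] [Finite H] [TopologicalSpace X]
    [T2Space X] [LocallyConnectedSpace X] [MulAction H X] (hc : ∀ h : H, Continuous fun y : X => h • y)
    (x : X) {O : Set X} (hO : O ∈ nhds x) :
    ∃ U ⊆ O, IsOpen U ∧ IsConnected U ∧ x ∈ U ∧
      (∀ h ∈ MulAction.stabilizer H x, ∀ y ∈ U, h • y ∈ U) ∧
      ∀ h : H, ∀ y ∈ U, h • y ∈ U → h ∈ MulAction.stabilizer H x := by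
  have h1 : ∀ᶠ p in nhds (x, x), ∀ h : H, h • p.1 = p.2 → h ∈ MulAction.stabilizer H x := by
    refine Filter.eventually_all.2 fun h => ?_
    by_cases hh : h ∈ MulAction.stabilizer H x
    · exact .of_forall fun _ _ => hh
    · have h2 : IsClosed {p : X × X | h • p.1 = p.2} :=
        isClosed_eq ((hc h).comp continuous_fst) continuous_snd
      filter_upwards [h2.isOpen_compl.mem_nhds (show (x, x) ∉ _ from hh)] with p hp hp'
      exact absurd hp' hp
  rw [nhds_prod_eq] at h1
  obtain ⟨S, hS, T, hT, hST⟩ := Filter.mem_prod_iff.1 h1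
  obtain ⟨O₁, hO₁, hO₁o, hxO₁⟩ := mem_nhds_iff.1 (Filter.inter_mem hO (Filter.inter_mem hS hT))
  let O₂ : Set X := ⋂ h ∈ MulAction.stabilizer H x, (fun y => h • y) ⁻¹' O₁
  have hO₂o : IsOpen O₂ := Set.Finite.isOpen_biInter (Set.toFinite _) fun h _ => hO₁o.preimage (hc h)
  have hxO₂ : x ∈ O₂ := by
    refine Set.mem_iInter₂.2 fun h hh => ?_
    change h • x ∈ O₁
    rwa [show h • x = x from hh]
  have hO₂₁ : O₂ ⊆ O₁ := by
    intro y hy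
    have : (1 : H) • y ∈ O₁ := Set.mem_iInter₂.1 hy 1 (one_mem _)
    rwa [one_smul] at this
  have hinv : ∀ h ∈ MulAction.stabilizer H x, ∀ y ∈ O₂, h • y ∈ O₂ := by
    intro h hh y hy
    refine Set.mem_iInter₂.2 fun k hk => ?_
    change k • h • y ∈ O₁
    rw [← mul_smul]
    exact Set.mem_iInter₂.1 hy _ (mul_mem hk hh)
  refine ⟨connectedComponentIn O₂ x, ?_, hO₂o.connectedComponentIn,
    isConnected_connectedComponentIn_iff.2 hxO₂, mem_connectedComponentIn hxO₂, ?_, ?_⟩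
  · exact (connectedComponentIn_subset _ _).trans (hO₂₁.trans fun y hy => (hO₁ hy).1)
  · intro h hh y hy
    have h2 : (fun y => h • y) '' connectedComponentIn O₂ x ⊆ connectedComponentIn O₂ x := by
      refine IsPreconnected.subset_connectedComponentIn
        (isPreconnected_connectedComponentIn.image _ (hc h).continuousOn)
        ⟨x, mem_connectedComponentIn hxO₂, hh⟩ ?_
      rintro _ ⟨z, hz, rfl⟩
      exact hinv h hh z (connectedComponentIn_subset _ _ hz)
    exact h2 ⟨y, hy, rfl⟩
  · intro h y hy hy'
    have h2 := hO₁ (hO₂₁ (connectedComponentIn_subset _ _ hy))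
    have h3 := hO₁ (hO₂₁ (connectedComponentIn_subset _ _ hy'))
    exact hST (Set.mk_mem_prod h2.2.1 h3.2.2) h rfl

variable {d m : ℕ} {G M : Type*} [Group G] [TopologicalSpace G]
  [ChartedSpace (EuclideanSpace ℝ (Fin d)) G] [TopologicalSpace M]
  [ChartedSpace (EuclideanSpace ℝ (Fin m)) M] [MulAction G M]

namespace SliceChart

/-- Two continuous maps to `G` that carry a slice into a second slice differ by an element of the
local group of the second slice. -/
theorem exists_const_mul [IsTopologicalGroup G] [T2Space G] (c c' : SliceChart d m G M)
    {a b : c.V → G} (ha : Continuous a) (hb : Continuous b)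
    (hav : ∀ v, ∃ w, a v • c.φ v = c'.φ w) (hbv : ∀ v, ∃ w, b v • c.φ v = c'.φ w) :
    ∃ k : c'.H, ∀ v, b v = k * a v := by
  have : ConnectedSpace c.V := isConnected_iff_connectedSpace.1 c.isConnected_V
  have h1 : ∀ v, ∃ k : c'.H, (k : G) = b v * (a v)⁻¹ := by
    intro v
    obtain ⟨w', hw'⟩ := hav v
    obtain ⟨w, hw⟩ := hbv v
    obtain ⟨k, hk, -⟩ := c'.exists_of_smul_eq (b v * (a v)⁻¹) w' w
      (by rw [← hw', ← hw, mul_smul, inv_smul_smul])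
    exact ⟨k, hk⟩
  choose k hk using h1
  have hkc : Continuous k := by
    refine continuous_induced_rng.2 ?_
    rw [show (Subtype.val ∘ k) = fun v => b v * (a v)⁻¹ from funext hk]
    exact hb.mul ha.inv
  obtain ⟨x⟩ := (inferInstance : Nonempty c.V)
  refine ⟨k x, fun v => ?_⟩
  rw [← (PreconnectedSpace.constant inferInstance hkc : k v = k x), hk, inv_mul_cancel_right]

theorem contMDiff_φ (c : SliceChart d m G M) : ContMDiff (𝓡 (m - d)) (𝓡 m) ∞ c.φ := by
  have h := c.isLocalDiffeomorph.contMDiff.comp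
    (contMDiff_const.prodMk contMDiff_id : ContMDiff _ ((𝓡 d).prod (𝓡 (m - d))) _
      fun v : c.V => ((1 : G), v))
  have h' : (fun p : G × c.V => p.1 • c.φ p.2) ∘ (fun v : c.V => ((1 : G), v)) = c.φ := by
    funext v
    exact one_smul G _
  rwa [← h']

/-- Two germs of maps between slices that are realized by maps to `G` with inverse values at the
base points are inverse to each other, as points of a slice on nearby orbits are related by elements
of `G` close to `1` only if they are equal. -/
theorem eventually_eq_of_smul_eq [ContinuousMul G] (c c' : SliceChart d m G M) {v : c.V}
    {v' : c'.V} {g : G} {a : c.V → G} {e : c.V → c'.V} {a' : c'.V → G} {e' : c'.V → c.V}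
    (ha : ContinuousAt a v) (he : ContinuousAt e v) (hav : a v = g) (hev : e v = v')
    (hae : ∀ᶠ w in nhds v, a w • c.φ w = c'.φ (e w))
    (ha' : ContinuousAt a' v') (he' : ContinuousAt e' v') (hav' : a' v' = g⁻¹) (hev' : e' v' = v)
    (hae' : ∀ᶠ w in nhds v', a' w • c'.φ w = c.φ (e' w)) :
    ∀ᶠ w in nhds v, e' (e w) = w := by
  have het : Filter.Tendsto e (nhds v) (nhds v') := by
    have := he.tendsto
    rwa [hev] at this
  have hat : Filter.Tendsto (fun w => a' (e w) * a w) (nhds v) (nhds 1) := by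
    have := (ha'.tendsto.comp het).mul ha.tendsto
    rwa [hav, hav', inv_mul_cancel] at this
  have het' : Filter.Tendsto (fun w => e' (e w)) (nhds v) (nhds v) := by
    have := he'.tendsto.comp het
    rwa [hev'] at this
  have h1 := ((hat.prodMk_nhds Filter.tendsto_id).prodMk_nhds
    ((tendsto_const_nhds (x := (1 : G))).prodMk_nhds het')).eventually
      (c.isLocalDiffeomorph (1, v)).eventually_injective
  filter_upwards [h1, hae, het.eventually hae'] with w h2 h3 h4
  refine (congrArg Prod.snd (h2 ?_)).symm
  change (a' (e w) * a w) • c.φ w = (1 : G) • c.φ (e' (e w))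
  rw [mul_smul, h3, h4, one_smul]

variable [LieGroup (𝓡 d) ∞ G] [ContMDiffSMul (𝓡 d) (𝓡 m) ∞ G M]

/-- If `g` carries the point `φ v` of a slice to the point `φ' v'` of another, then `g` extends to a
smooth germ of a map to `G` carrying the first slice to the second. -/
theorem exists_transition (c c' : SliceChart d m G M) {v : c.V} {v' : c'.V} {g : G}
    (h : g • c.φ v = c'.φ v') : ∃ (a : c.V → G) (e : c.V → c'.V), a v = g ∧ e v = v' ∧
      (∀ᶠ w in nhds v, ContMDiffAt (𝓡 (m - d)) (𝓡 d) ∞ a w) ∧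
      (∀ᶠ w in nhds v, ContMDiffAt (𝓡 (m - d)) (𝓡 (m - d)) ∞ e w) ∧
      ∀ᶠ w in nhds v, a w • c.φ w = c'.φ (e w) := by
  obtain ⟨s, -, hs, hs1, hs2⟩ := (c'.isLocalDiffeomorph (1, v')).exists_eventually
  have hs0 : s (c'.φ v') = (1, v') := by
    have := hs1.self_of_nhds
    rwa [one_smul] at this
  simp only [one_smul] at hs hs2
  have ht : ContMDiff (𝓡 (m - d)) (𝓡 m) ∞ fun w => g • c.φ w :=
    (contMDiff_smul_const_left d g).comp c.contMDiff_φ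
  have hlim : Filter.Tendsto (fun w => g • c.φ w) (nhds v) (nhds (c'.φ v')) := by
    have := ht.continuous.tendsto v
    rwa [h] at this
  have hsw : ∀ᶠ w in nhds v, ContMDiffAt (𝓡 (m - d)) ((𝓡 d).prod (𝓡 (m - d))) ∞
      (fun w => s (g • c.φ w)) w := by
    filter_upwards [hlim.eventually hs] with w hw
    exact ContMDiffAt.comp w hw (ht w)
  refine ⟨fun w => (s (g • c.φ w)).1⁻¹ * g, fun w => (s (g • c.φ w)).2, ?_, ?_, ?_, ?_, ?_⟩
  · simp only [h, hs0, inv_one, one_mul]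
  · simp only [h, hs0]
  · filter_upwards [hsw] with w hw
    exact (ContMDiffAt.inv hw.fst).mul contMDiffAt_const
  · filter_upwards [hsw] with w hw
    exact hw.snd
  · filter_upwards [hlim.eventually hs2] with w hw
    rw [mul_smul, inv_smul_eq_iff]
    exact hw.symm

/-- Any two slice charts have a common refinement near points `v`, `v'` that are related by an
element `g` of `G`: the third chart is a small neighbourhood of `v` in the first slice, with the
stabilizer of `v` as its local group. -/
theorem exists_refinement [T2Space G] (c c' : SliceChart d m G M) (v : c.V) (v' : c'.V) (g : G)
    (h : g • c.φ v = c'.φ v') :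
    ∃ (c₃ : SliceChart d m G M) (i : SliceInjection c₃ c) (j : SliceInjection c₃ c') (u : c₃.V),
      i.emb u = v ∧ i.a u = 1 ∧ j.emb u = v' ∧ j.a u = g := by
  have : IsTopologicalGroup G := topologicalGroup_of_lieGroup (𝓡 d) ∞
  obtain ⟨a, e, hav, hev, has, hes, hae⟩ := c.exists_transition c' h
  obtain ⟨a', e', hav', hev', has', hes', hae'⟩ := c'.exists_transition c
    (show g⁻¹ • c'.φ v' = c.φ v from inv_smul_eq_iff.2 h.symm)
  have he1 := c.eventually_eq_of_smul_eq c' has.self_of_nhds.continuousAt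
    hes.self_of_nhds.continuousAt hav hev hae has'.self_of_nhds.continuousAt
    hes'.self_of_nhds.continuousAt hav' hev' hae'
  have he2 := c'.eventually_eq_of_smul_eq c has'.self_of_nhds.continuousAt
    hes'.self_of_nhds.continuousAt hav' hev' hae' has.self_of_nhds.continuousAt
    hes.self_of_nhds.continuousAt (by rw [hav, inv_inv]) hev hae
  have hel : IsLocalDiffeomorphAt (𝓡 (m - d)) (𝓡 (m - d)) ∞ e v :=
    isLocalDiffeomorphAt_of_eventually hes (by rwa [hev]) he1 (by rwa [hev])
  -- the third chart is a connected neighbourhood of `v` on which the germs `a` and `e` are defined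
  have : LocallyConnectedSpace c.V := c.V.isOpen.locallyConnectedSpace
  obtain ⟨U, hUO, hUo, hUc, hvU, hUs, hUh⟩ := exists_isConnected_invariant_nhds (H := c.H)
    (fun k => (c.contMDiff_smul k).continuous) v (has.and (hae.and hel.eventually))
  let V : Opens (EuclideanSpace ℝ (Fin (m - d))) :=
    ⟨Subtype.val '' U, c.V.isOpen.isOpenMap_subtype_val U hUo⟩
  have hV : V ≤ c.V := by
    rintro _ ⟨w, -, rfl⟩
    exact w.2
  let ι : V → c.V := Opens.inclusion hV
  have hι : ∀ w, ι w ∈ U := by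
    rintro ⟨_, w, hw, rfl⟩
    exact hw
  have hιi : Function.Injective ι := Set.inclusion_injective hV
  have hιl : IsLocalDiffeomorph (𝓡 (m - d)) (𝓡 (m - d)) ∞ ι := isLocalDiffeomorph_inclusion hV
  let K := MulAction.stabilizer c.H v
  let H₃ : Subgroup G := K.map c.H.subtype
  have hH₃ : H₃ ≤ c.H := Subgroup.map_subtype_le K
  let l : H₃ →* c.H := Subgroup.inclusion hH₃
  have hl : ∀ k, (l k : G) = k := fun k => rfl
  have hlK : ∀ k, l k ∈ K := by
    rintro ⟨_, k, hk, rfl⟩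
    exact hk
  have : Finite H₃ := Finite.of_injective l (Subgroup.inclusion_injective hH₃)
  have hsm : ∀ (k : H₃) (w : V), ((l k • ι w : c.V) : EuclideanSpace ℝ (Fin (m - d))) ∈ V :=
    fun k w => ⟨l k • ι w, hUs _ (hlK k) _ (hι w), rfl⟩
  let act : MulAction H₃ V :=
    { smul := fun k w => ⟨(l k • ι w : c.V).1, hsm k w⟩
      one_smul := fun w => hιi (by
        change l 1 • ι w = ι w
        rw [map_one, one_smul])
      mul_smul := fun k k' w => hιi (by
        change l (k * k') • ι w = l k • l k' • ι w
        rw [map_mul, mul_smul]) }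
  have hact : ∀ (k : H₃) (w : V), ι (k • w) = l k • ι w := fun k w => rfl
  let c₃ : SliceChart d m G M :=
    { V := V
      isConnected_V := hUc.image _ continuous_subtype_val.continuousOn
      H := H₃
      contMDiff_smul := fun k => by
        rw [← ContMDiff.subtypeVal_comp_iff]
        change ContMDiff _ _ _ ((Subtype.val : c.V → _) ∘ (fun w => l k • w) ∘ ι)
        exact contMDiff_subtype_val.comp ((c.contMDiff_smul (l k)).comp hιl.contMDiff)
      φ := fun w => c.φ (ι w)
      φ_smul := fun k w => c.φ_smul (l k) (ι w)
      isLocalDiffeomorph := fun p =>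
        IsLocalDiffeomorphAt.comp (hf := (isLocalDiffeomorph_id p.1).prodMap (hιl p.2))
          (hg := c.isLocalDiffeomorph _)
      exists_of_smul_eq := fun k w w' hk => by
        obtain ⟨k', hk', hkw⟩ := c.exists_of_smul_eq k (ι w) (ι w') hk
        have hK : k' ∈ K := hUh k' (ι w) (hι w) (by rw [hkw]; exact hι w')
        exact ⟨⟨k', k', hK, rfl⟩, hk', hιi hkw⟩ }
  let a₃ : c₃.V → G := fun w => a (ι w)
  have ha₃ : ContMDiff (𝓡 (m - d)) (𝓡 d) ∞ a₃ := fun w =>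
    ContMDiffAt.comp w (hUO (hι w)).1 (hιl.contMDiff w)
  have ha₃φ : ∀ w : c₃.V, a₃ w • c₃.φ w = c'.φ (e (ι w)) := fun w => (hUO (hι w)).2.1
  -- `w ↦ a₃ (k • w) * k` and `a₃` both carry the slice to that of `c'`, so they differ by a constant
  have hhom : ∀ k : c₃.H, ∃ k' : c'.H, ∀ w : c₃.V, a₃ (k • w) * k = k' * a₃ w := fun k =>
    c₃.exists_const_mul c' ha₃.continuous
      ((ha₃.continuous.comp (c₃.contMDiff_smul k).continuous).mul continuous_const)
      (fun w => ⟨_, ha₃φ w⟩)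
      (fun w => ⟨e (ι (k • w)), by
        rw [mul_smul, ← c₃.φ_smul, ha₃φ]⟩)
  choose χ hχ using hhom
  let u : c₃.V := ⟨v, v, hvU, rfl⟩
  have hu : ι u = v := rfl
  refine ⟨c₃,
    { a := fun _ => 1
      contMDiff_a := contMDiff_const
      emb := ι
      emb_isLocalDiffeomorph := hιl
      a_smul := fun w => one_smul G _
      hom := l
      hom_injective := Subgroup.inclusion_injective hH₃
      a_equivariant := fun k w => by rw [one_mul, mul_one, hl] },
    { a := a₃
      contMDiff_a := ha₃
      emb := fun w => e (ι w)
      emb_isLocalDiffeomorph := fun w =>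
        IsLocalDiffeomorphAt.comp (hf := hιl w) (hg := (hUO (hι w)).2.2)
      a_smul := ha₃φ
      hom :=
        { toFun := χ
          map_one' := Subtype.ext (mul_right_cancel (b := a₃ u) (by
            rw [← hχ, one_smul, OneMemClass.coe_one, OneMemClass.coe_one, mul_one, one_mul]))
          map_mul' := fun k k' => Subtype.ext (mul_right_cancel (b := a₃ u) (by
            rw [← hχ, Subgroup.coe_mul, Subgroup.coe_mul, mul_assoc, ← hχ k',
              ← mul_assoc (χ k : G), ← hχ k, mul_smul, mul_assoc])) }
      hom_injective := (injective_iff_map_eq_one _).2 fun k hk => by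
        have h1 : a₃ (k • u) * k = a₃ u := by
          rw [hχ, show χ k = 1 from hk, OneMemClass.coe_one, one_mul]
        have h2 : k • u = u := hιi ((hact k u).trans (hlK k))
        rw [h2] at h1
        exact Subtype.ext (mul_eq_left.1 h1)
      a_equivariant := hχ }, u, rfl, rfl, hev, hav⟩

end SliceChart

end Refinement

/-! ### Maps of complex vector bundles -/

section BundleMaps

/-- The inverses of a continuous family of linear isomorphisms of finite-dimensional spaces form a
continuous family. -/
theorem continuous_symm_apply_of_continuous {X V V' : Type*} [TopologicalSpace X]
    [NormedAddCommGroup V] [NormedSpace ℂ V] [FiniteDimensional ℂ V]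
    [NormedAddCommGroup V'] [NormedSpace ℂ V'] [FiniteDimensional ℂ V']
    (A : X → V ≃ₗ[ℂ] V') (hA : Continuous fun p : X × V => A p.1 p.2) :
    Continuous fun p : X × V' => (A p.1).symm p.2 := by
  have : CompleteSpace V := FiniteDimensional.complete ℂ V
  let L : X → V →L[ℂ] V' := fun x => ((A x).toContinuousLinearEquiv : V →L[ℂ] V')
  have hL : Continuous L := continuous_clm_apply.2 fun v =>
    hA.comp (continuous_id.prodMk continuous_const)
  have hL' : Continuous fun x => (L x).inverse := by
    refine continuous_iff_continuousAt.2 fun x => ?_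
    exact ContinuousAt.comp (f := L)
      (contDiffAt_map_inverse (n := 0) (A x).toContinuousLinearEquiv).continuousAt hL.continuousAt
  have h : ∀ p : X × V', (A p.1).symm p.2 = (L p.1).inverse p.2 := fun p => by
    rw [ContinuousLinearMap.inverse_equiv]
    rfl
  simp only [h]
  exact (hL'.comp continuous_fst).clm_apply continuous_snd

namespace ComplexVectorBundle

/-- A bundle map that is isomorphic on fibres, over an open continuous map, is open. -/
theorem isOpenMap_of_fiberwise {B B' : Type*} [TopologicalSpace B] [TopologicalSpace B']
    (E : ComplexVectorBundle B) (E' : ComplexVectorBundle B') {f : B → B'} (hf : Continuous f)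
    (hfo : IsOpenMap f) (T : ∀ b, E.fiber b ≃ₗ[ℂ] E'.fiber (f b))
    (hT : Continuous fun e : E.Total => (⟨f e.proj, T e.proj e.snd⟩ : E'.Total)) :
    IsOpenMap fun e : E.Total => (⟨f e.proj, T e.proj e.snd⟩ : E'.Total) := by
  refine IsOpenMap.of_nhds_le fun e₀ => ?_
  obtain ⟨b₀, ξ₀⟩ := e₀
  obtain ⟨U, k, φ, hU, h1, h2⟩ := E.locally_trivial b₀
  obtain ⟨U', k', φ', hU', h1', h2'⟩ := E'.locally_trivial (f b₀)
  let N : Set B := U ∩ f ⁻¹' U'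
  have hN : IsOpen N := U.isOpen.inter (U'.isOpen.preimage hf)
  -- in trivializations, `T` is a continuous family `A` of isomorphisms, and so is its inverse
  let A : N → (Fin k → ℂ) ≃ₗ[ℂ] (Fin k' → ℂ) := fun b =>
    ((φ ⟨b, b.2.1⟩).symm.trans (T b)).trans (φ' ⟨f b, b.2.2⟩)
  have hs : Continuous fun p : N × (Fin k → ℂ) =>
      (⟨p.1, (φ ⟨p.1, p.1.2.1⟩).symm p.2⟩ : E.Total) :=
    h2.comp (((continuous_subtype_val.comp continuous_fst).subtype_mk _).prodMk continuous_snd)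
  have hA : Continuous fun p : N × (Fin k → ℂ) => A p.1 p.2 :=
    h1'.comp ((hT.comp hs).subtype_mk fun p => p.1.2.2)
  have hA' := continuous_symm_apply_of_continuous A hA
  let S : N × (Fin k' → ℂ) → E.Total := fun p =>
    ⟨p.1, (φ ⟨p.1, p.1.2.1⟩).symm ((A p.1).symm p.2)⟩
  have hS : Continuous S := hs.comp (continuous_fst.prodMk hA')
  have hTS : ∀ (b : N) (η : E'.fiber (f b)),
      T b ((φ ⟨b, b.2.1⟩).symm ((A b).symm (φ' ⟨f b, b.2.2⟩ η))) = η := by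
    intro b η
    apply (φ' ⟨f b, b.2.2⟩).injective
    exact (A b).apply_symm_apply _
  -- `S` is a continuous local inverse of the fibre part of the map
  let b₁ : N := ⟨b₀, hU, hU'⟩
  let w₁ : Fin k' → ℂ := φ' ⟨f b₀, hU'⟩ (T b₀ ξ₀)
  have hS₁ : S (b₁, w₁) = ⟨b₀, ξ₀⟩ := by
    have h3 := (T b₀).injective (hTS b₁ (T b₀ ξ₀))
    exact congrArg (TotalOf.mk b₀) h3
  intro O hO
  have hO' : S ⁻¹' ((fun e : E.Total => (⟨f e.proj, T e.proj e.snd⟩ : E'.Total)) ⁻¹' O) ∈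
      nhds (b₁, w₁) := hS.continuousAt.preimage_mem_nhds (by rw [hS₁]; exact hO)
  rw [nhds_prod_eq] at hO'
  obtain ⟨P, hP, Q, hQ, hPQ⟩ := Filter.mem_prod_iff.1 hO'
  have hfP : f '' (Subtype.val '' P) ∈ nhds (f b₀) :=
    hfo.image_mem_nhds (hN.isOpenMap_subtype_val.image_mem_nhds hP)
  let e₁ : {e : E'.Total // e.proj ∈ U'} := ⟨⟨f b₀, T b₀ ξ₀⟩, hU'⟩
  have hQ' : {e : {e : E'.Total // e.proj ∈ U'} | φ' ⟨e.1.proj, e.2⟩ e.1.snd ∈ Q} ∈ nhds e₁ :=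
    h1'.continuousAt.preimage_mem_nhds hQ
  have hQ'' := (U'.isOpen.preimage E'.continuous_proj).isOpenMap_subtype_val.image_mem_nhds hQ'
  filter_upwards [E'.continuous_proj.continuousAt.preimage_mem_nhds hfP, hQ'']
  rintro ⟨_, η⟩ ⟨_, ⟨b, hb, rfl⟩, rfl⟩ ⟨⟨e, he⟩, heQ, rfl⟩
  have h3 := hPQ (Set.mk_mem_prod hb heQ)
  have h4 := hTS b η
  have h5 : (⟨f b, T b ((φ ⟨b, b.2.1⟩).symm ((A b).symm (φ' ⟨f b, b.2.2⟩ η)))⟩ : E'.Total) ∈ O := h3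
  rwa [h4] at h5

/-- A continuous family of isomorphisms of the fibres is an isomorphism of vector bundles. -/
def Iso.ofContinuous {B : Type*} [TopologicalSpace B] {E E' : ComplexVectorBundle B}
    (T : ∀ b, E.fiber b ≃ₗ[ℂ] E'.fiber b)
    (hT : Continuous fun e : E.Total => (⟨e.proj, T e.proj e.snd⟩ : E'.Total)) : Iso E E' where
  equiv := T
  continuous_equiv := hT
  continuous_symm := by
    let t : E.Total ≃ E'.Total :=
      { toFun := fun e => ⟨e.proj, T e.proj e.snd⟩
        invFun := fun e => ⟨e.proj, (T e.proj).symm e.snd⟩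
        left_inv := fun e => congrArg (TotalOf.mk e.proj) ((T e.proj).symm_apply_apply e.snd)
        right_inv := fun e => congrArg (TotalOf.mk e.proj) ((T e.proj).apply_symm_apply e.snd) }
    exact (t.toHomeomorphOfContinuousOpen hT
      (isOpenMap_of_fiberwise E E' continuous_id IsOpenMap.id T hT)).symm.continuous

end ComplexVectorBundle

end BundleMaps

/-! ### Transport of fibres along the translation groupoid -/

section Transport

theorem TotalOf.snd_eq {B : Type*} {P : B → Type} {x : B} {ξ ξ' : P x}
    (h : (⟨x, ξ⟩ : TotalOf P) = ⟨x, ξ'⟩) : ξ = ξ' := by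
  cases h
  rfl

/-- A presentation of the charts of an orbifold atlas `𝒪` by a `G`-space `M`. Each chart `c` is
mapped to `M` by `φ c`, transversally to the orbits, and each injection `i` records through `a i`
the group elements that carry the image of its source to the image of its target. Every arrow `g • φ
c v = φ c' v'` of the translation groupoid is realized by a pair of injections of a third chart, and
an injection is determined by its value `a i u` at any one point. -/
structure ActionPresentation {n : ℕ} {X : Type*} [TopologicalSpace X] (𝒪 : OrbifoldAtlas n X)
    (G M : Type*) [Group G] [TopologicalSpace G] [TopologicalSpace M] [MulAction G M] where
  φ : ∀ c : 𝒪.Chart, 𝒪.V c → M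
  continuous_φ : ∀ c, Continuous (φ c)
  isLocalHomeomorph : ∀ c, IsLocalHomeomorph fun p : G × 𝒪.V c => p.1 • φ c p.2
  a : ∀ {c c' : 𝒪.Chart}, 𝒪.Inj c c' → 𝒪.V c → G
  continuous_a : ∀ {c c' : 𝒪.Chart} (i : 𝒪.Inj c c'), Continuous (a i)
  a_smul : ∀ {c c' : 𝒪.Chart} (i : 𝒪.Inj c c') (v : 𝒪.V c), a i v • φ c v = φ c' (𝒪.emb i v)
  a_comp : ∀ {c c' c'' : 𝒪.Chart} (j : 𝒪.Inj c' c'') (i : 𝒪.Inj c c') (v : 𝒪.V c),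
    a (𝒪.comp j i) v = a j (𝒪.emb i v) * a i v
  eq_of_a_eq : ∀ {c c' : 𝒪.Chart} (i j : 𝒪.Inj c c') (u : 𝒪.V c), a i u = a j u → i = j
  exists_φ_eq : ∀ x : M, ∃ (c : 𝒪.Chart) (v : 𝒪.V c), φ c v = x
  exists_refinement : ∀ {c c' : 𝒪.Chart} (v : 𝒪.V c) (v' : 𝒪.V c') (g : G),
    g • φ c v = φ c' v' → ∃ (c₃ : 𝒪.Chart) (i : 𝒪.Inj c₃ c) (j : 𝒪.Inj c₃ c') (u : 𝒪.V c₃),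
      𝒪.emb i u = v ∧ a i u = 1 ∧ 𝒪.emb j u = v' ∧ a j u = g

namespace OrbifoldVectorBundle

variable {n : ℕ} {X : Type*} [TopologicalSpace X] {𝒪 : OrbifoldAtlas n X}
  (E : OrbifoldVectorBundle 𝒪) {c c' c'' : 𝒪.Chart}

/-- The bundle map of total spaces given by an injection of charts. -/
def totalMap (i : 𝒪.Inj c c') (e : (E.bundle c).Total) : (E.bundle c').Total :=
  ⟨𝒪.emb i e.proj, E.map i e.proj e.snd⟩

theorem continuous_totalMap (i : 𝒪.Inj c c') : Continuous (E.totalMap i) := E.continuous_map i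

theorem isOpenMap_totalMap (i : 𝒪.Inj c c') : IsOpenMap (E.totalMap i) :=
  ComplexVectorBundle.isOpenMap_of_fiberwise _ _ (𝒪.emb_isLocalDiffeomorph i).contMDiff.continuous
    (𝒪.emb_isLocalDiffeomorph i).isOpenMap (E.map i) (E.continuous_map i)

theorem totalMap_comp (j : 𝒪.Inj c' c'') (i : 𝒪.Inj c c') (e : (E.bundle c).Total) :
    E.totalMap (𝒪.comp j i) e = E.totalMap j (E.totalMap i e) :=
  E.map_comp j i e.proj e.snd

theorem exists_totalMap_eq (i : 𝒪.Inj c c') {u : 𝒪.V c} {v : 𝒪.V c'} (h : 𝒪.emb i u = v)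
    (ξ : (E.bundle c').fiber v) : ∃ ζ : (E.bundle c).fiber u, E.totalMap i ⟨u, ζ⟩ = ⟨v, ξ⟩ := by
  subst h
  exact ⟨(E.map i u).symm ξ, congrArg (TotalOf.mk _) ((E.map i u).apply_symm_apply ξ)⟩

end OrbifoldVectorBundle

namespace ActionPresentation

variable {n : ℕ} {X : Type*} [TopologicalSpace X] {𝒪 : OrbifoldAtlas n X}
  {G M : Type*} [Group G] [TopologicalSpace G] [TopologicalSpace M] [MulAction G M]
  (P : ActionPresentation 𝒪 G M) (E : OrbifoldVectorBundle 𝒪)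

/-- An arrow `g` of the translation groupoid from the point `φ v` of a slice to the point `φ' v'` of
another induces an isomorphism of the fibres of `E`, through any chart with injections into both
that realize the arrow. -/
theorem exists_transport {c c' : 𝒪.Chart} (v : 𝒪.V c) (v' : 𝒪.V c') (g : G)
    (h : g • P.φ c v = P.φ c' v') :
    ∃ T : (E.bundle c).fiber v ≃ₗ[ℂ] (E.bundle c').fiber v',
      ∀ (c₃ : 𝒪.Chart) (i : 𝒪.Inj c₃ c) (j : 𝒪.Inj c₃ c') (u : 𝒪.V c₃)
        (ζ : (E.bundle c₃).fiber u) (ξ : (E.bundle c).fiber v), g * P.a i u = P.a j u →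
        E.totalMap i ⟨u, ζ⟩ = ⟨v, ξ⟩ → E.totalMap j ⟨u, ζ⟩ = ⟨v', T ξ⟩ := by
  obtain ⟨c₃, i, j, u, rfl, hia, rfl, hja⟩ := P.exists_refinement v v' g h
  refine ⟨(E.map i u).symm.trans (E.map j u), ?_⟩
  intro c₄ i' j' u' ζ' ξ ha hξ
  have hemb : 𝒪.emb i' u' = 𝒪.emb i u := congrArg TotalOf.proj hξ
  obtain ⟨c₅, s, t, w, rfl, hsa, rfl, hta⟩ := P.exists_refinement u u'
    ((P.a i' u')⁻¹ * P.a i u) (by rw [mul_smul, P.a_smul, ← hemb, ← P.a_smul, inv_smul_smul])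
  -- both refinements have a common refinement, on which the injections to `c` and `c'` agree
  have h1 : 𝒪.comp i s = 𝒪.comp i' t := by
    refine P.eq_of_a_eq _ _ w ?_
    rw [P.a_comp, P.a_comp, hsa, hta, mul_one, mul_inv_cancel_left]
  have h2 : 𝒪.comp j s = 𝒪.comp j' t := by
    refine P.eq_of_a_eq _ _ w ?_
    rw [P.a_comp, P.a_comp, hsa, hja, ← ha, hta, hia, mul_one, mul_one, mul_inv_cancel_right]
  obtain ⟨η, hη⟩ := E.exists_totalMap_eq t (u := w) rfl ζ'
  have h3 : E.totalMap i (E.totalMap s ⟨w, η⟩) = ⟨𝒪.emb i (𝒪.emb s w), ξ⟩ := by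
    rw [← hξ, ← hη, ← E.totalMap_comp, ← E.totalMap_comp, h1]
  have h4 : E.map i _ (E.map s w η) = ξ := TotalOf.snd_eq h3
  have h5 : E.totalMap j (E.totalMap s ⟨w, η⟩) = E.totalMap j' ⟨_, ζ'⟩ := by
    rw [← hη, ← E.totalMap_comp, ← E.totalMap_comp, h2]
  rw [← h5, ← h4]
  refine congrArg (TotalOf.mk _) ?_
  rw [LinearEquiv.trans_apply, LinearEquiv.symm_apply_apply]
  rfl

/-- The isomorphism of the fibres of `E` induced by an arrow of the translation groupoid between
points of two slices. -/
noncomputable def transport {c c' : 𝒪.Chart} (v : 𝒪.V c) (v' : 𝒪.V c') (g : G)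
    (h : g • P.φ c v = P.φ c' v') : (E.bundle c).fiber v ≃ₗ[ℂ] (E.bundle c').fiber v' :=
  (P.exists_transport E v v' g h).choose

variable {E}

theorem transport_spec {c c' : 𝒪.Chart} {v : 𝒪.V c} {v' : 𝒪.V c'} {g : G}
    (h : g • P.φ c v = P.φ c' v') {c₃ : 𝒪.Chart} (i : 𝒪.Inj c₃ c) (j : 𝒪.Inj c₃ c') {u : 𝒪.V c₃}
    {ζ : (E.bundle c₃).fiber u} {ξ : (E.bundle c).fiber v} (ha : g * P.a i u = P.a j u)
    (hξ : E.totalMap i ⟨u, ζ⟩ = ⟨v, ξ⟩) :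
    E.totalMap j ⟨u, ζ⟩ = ⟨v', P.transport E v v' g h ξ⟩ :=
  (P.exists_transport E v v' g h).choose_spec c₃ i j u ζ ξ ha hξ

theorem transport_trans {c c' c'' : 𝒪.Chart} {v : 𝒪.V c} {v' : 𝒪.V c'} {v'' : 𝒪.V c''} {g g' : G}
    (h : g • P.φ c v = P.φ c' v') (h' : g' • P.φ c' v' = P.φ c'' v'')
    (h'' : (g' * g) • P.φ c v = P.φ c'' v'') (ξ : (E.bundle c).fiber v) :
    P.transport E v' v'' g' h' (P.transport E v v' g h ξ) =
      P.transport E v v'' (g' * g) h'' ξ := by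
  obtain ⟨c₃, i, j, u, hi, hia, hj, hja⟩ := P.exists_refinement v v' g h
  obtain ⟨c₄, s, t, w, rfl, hsa, ht, hta⟩ := P.exists_refinement u v'' (g' * g) (by
    rw [← h'', ← hi, ← P.a_smul, hia, one_smul])
  obtain ⟨ζ, hζ⟩ := E.exists_totalMap_eq (𝒪.comp i s) (u := w) ((𝒪.emb_comp _ _ _).trans hi) ξ
  have ha1 : P.a (𝒪.comp i s) w = 1 := by rw [P.a_comp, hia, hsa, one_mul]
  have ha2 : P.a (𝒪.comp j s) w = g := by rw [P.a_comp, hja, hsa, mul_one]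
  have h1 := P.transport_spec h _ (𝒪.comp j s) (by rw [ha1, ha2, mul_one]) hζ
  have h2 := P.transport_spec h' _ t (by rw [ha2, hta]) h1
  have h3 := P.transport_spec h'' _ t (by rw [ha1, hta, mul_one]) hζ
  exact TotalOf.snd_eq (h2.symm.trans h3)

/-- Transport along the arrows of an injection is the bundle map of the injection. -/
theorem transport_inj {c c' : 𝒪.Chart} (i : 𝒪.Inj c c') (v : 𝒪.V c) (ξ : (E.bundle c).fiber v) :
    P.transport E v (𝒪.emb i v) (P.a i v) (P.a_smul i v) ξ = E.map i v ξ := by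
  obtain ⟨c₃, s, -, u, rfl, hsa, -, -⟩ := P.exists_refinement v v 1 (one_smul G _)
  obtain ⟨ζ, hζ⟩ := E.exists_totalMap_eq s (u := u) rfl ξ
  have h1 := P.transport_spec (P.a_smul i (𝒪.emb s u)) s (𝒪.comp i s) (P.a_comp i s u).symm hζ
  refine TotalOf.snd_eq (h1.symm.trans ?_)
  rw [E.totalMap_comp, hζ]
  rfl

end ActionPresentation

end Transport

/-! ### The pull-back of an orbifold vector bundle -/

section Pullback

/-- A map is continuous at the image of a point under an open map `f` if its composite with `f` is
continuous. -/
theorem IsOpenMap.continuousAt_of_comp {X Y Z : Type*} [TopologicalSpace X] [TopologicalSpace Y]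
    [TopologicalSpace Z] {f : X → Y} {g : Y → Z} (hf : IsOpenMap f) {x : X}
    (h : ContinuousAt (g ∘ f) x) : ContinuousAt g (f x) := by
  intro s hs
  change g ⁻¹' s ∈ nhds (f x)
  have hs' : f '' ((g ∘ f) ⁻¹' s) ∈ nhds (f x) := hf.image_mem_nhds (h hs)
  exact Filter.mem_of_superset hs' (Set.image_subset_iff.2 fun _ hy => hy)

namespace ActionPresentation

variable {n : ℕ} {X : Type*} [TopologicalSpace X] {𝒪 : OrbifoldAtlas n X}
  {G M : Type*} [Group G] [TopologicalSpace G] [TopologicalSpace M] [MulAction G M]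

/-- `F` is the pull-back of the orbifold vector bundle `E` along the projection of `M` to the orbit
space, in terms of the charts of a presentation. -/
def IsPullback (P : ActionPresentation 𝒪 G M) (E : OrbifoldVectorBundle 𝒪)
    (F : EquivariantVectorBundle G M) : Prop :=
  ∃ β : ∀ (c : 𝒪.Chart) (g : G) (v : 𝒪.V c), (E.bundle c).fiber v ≃ₗ[ℂ] F.fiber (g • P.φ c v),
    (∀ c : 𝒪.Chart, Continuous (fun p : G × (E.bundle c).Total =>
      (⟨p.1 • P.φ c p.2.proj, β c p.1 p.2.proj p.2.snd⟩ : F.Total))) ∧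
    (∀ (c c' : 𝒪.Chart) (i : 𝒪.Inj c c') (g : G) (v : 𝒪.V c) (ξ : (E.bundle c).fiber v),
      (⟨(g * (P.a i v)⁻¹) • P.φ c' (𝒪.emb i v),
        β c' (g * (P.a i v)⁻¹) (𝒪.emb i v) (E.map i v ξ)⟩ : F.Total) =
        ⟨g • P.φ c v, β c g v ξ⟩) ∧
    (∀ (c : 𝒪.Chart) (g h : G) (v : 𝒪.V c) (ξ : (E.bundle c).fiber v),
      (⟨(g * h) • P.φ c v, β c (g * h) v ξ⟩ : F.Total) =
        ⟨g • h • P.φ c v, F.act g (h • P.φ c v) (β c h v ξ)⟩)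

variable (P : ActionPresentation 𝒪 G M) (E : OrbifoldVectorBundle 𝒪)

/-- The map `(k, e) ↦ (k a(e)⁻¹, i e)` of `G × E_c` to `G × E_{c'}`. The points
`k • e` and `(k a(e)⁻¹) • (i e)` of a pull-back of `E` are the same. -/
def shearMap {c c' : 𝒪.Chart} (i : 𝒪.Inj c c') (p : G × (E.bundle c).Total) :
    G × (E.bundle c').Total :=
  (p.1 * (P.a i p.2.proj)⁻¹, E.totalMap i p.2)

theorem continuous_shearMap [IsTopologicalGroup G] {c c' : 𝒪.Chart} (i : 𝒪.Inj c c') :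
    Continuous (P.shearMap E i) :=
  (continuous_fst.mul ((P.continuous_a i).comp
    ((E.bundle c).continuous_proj.comp continuous_snd)).inv).prodMk
    ((E.continuous_totalMap i).comp continuous_snd)

theorem isOpenMap_shearMap [IsTopologicalGroup G] {c c' : 𝒪.Chart} (i : 𝒪.Inj c c') :
    IsOpenMap (P.shearMap E i) := by
  have ha : Continuous fun p : G × (E.bundle c).Total => P.a i p.2.proj :=
    (P.continuous_a i).comp ((E.bundle c).continuous_proj.comp continuous_snd)
  let t : G × (E.bundle c).Total ≃ₜ G × (E.bundle c).Total :=
    { toFun := fun p => (p.1 * (P.a i p.2.proj)⁻¹, p.2)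
      invFun := fun p => (p.1 * P.a i p.2.proj, p.2)
      left_inv := fun p => Prod.ext (inv_mul_cancel_right _ _) rfl
      right_inv := fun p => Prod.ext (mul_inv_cancel_right _ _) rfl
      continuous_toFun := (continuous_fst.mul ha.inv).prodMk continuous_snd
      continuous_invFun := (continuous_fst.mul ha).prodMk continuous_snd }
  exact (IsOpenMap.id.prodMap (E.isOpenMap_totalMap i)).comp t.isOpenMap

variable {E}

/-- The map `(g, e) ↦ g • e` of `G × E_c` to the total space of a family `Q` of vector spaces over
`M`, given by isomorphisms of the fibres of `E` and `Q`. -/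
def sweep {Q : M → Type} [∀ x, AddCommGroup (Q x)] [∀ x, Module ℂ (Q x)]
    (β : ∀ (c : 𝒪.Chart) (g : G) (v : 𝒪.V c), (E.bundle c).fiber v ≃ₗ[ℂ] Q (g • P.φ c v))
    (c : 𝒪.Chart) (p : G × (E.bundle c).Total) : TotalOf Q :=
  ⟨p.1 • P.φ c p.2.proj, β c p.1 p.2.proj p.2.snd⟩

/-- Two points with the same image in the total space over `M` come from a point over a common
refinement of the two charts. -/
theorem exists_shearMap_eq {Q : M → Type} [∀ x, AddCommGroup (Q x)] [∀ x, Module ℂ (Q x)]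
    {β : ∀ (c : 𝒪.Chart) (g : G) (v : 𝒪.V c), (E.bundle c).fiber v ≃ₗ[ℂ] Q (g • P.φ c v)}
    (hβ : ∀ {c c' : 𝒪.Chart} (i : 𝒪.Inj c c') (p : G × (E.bundle c).Total),
      P.sweep β c' (P.shearMap E i p) = P.sweep β c p)
    {c c' : 𝒪.Chart} {p : G × (E.bundle c).Total} {p' : G × (E.bundle c').Total}
    (heq : P.sweep β c p = P.sweep β c' p') :
    ∃ (c₃ : 𝒪.Chart) (i : 𝒪.Inj c₃ c) (j : 𝒪.Inj c₃ c') (q : G × (E.bundle c₃).Total),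
      P.shearMap E i q = p ∧ P.shearMap E j q = p' := by
  obtain ⟨g, v, ξ⟩ := p
  obtain ⟨g', v', ξ'⟩ := p'
  have hbase : g • P.φ c v = g' • P.φ c' v' := congrArg TotalOf.proj heq
  obtain ⟨c₃, i, j, u, hi, hia, rfl, hja⟩ := P.exists_refinement v v' (g'⁻¹ * g) (by
    rw [mul_smul, hbase, inv_smul_smul])
  obtain ⟨ζ, hζ⟩ := E.exists_totalMap_eq i hi ξ
  have hI : P.shearMap E i (g, ⟨u, ζ⟩) = (g, ⟨v, ξ⟩) :=
    Prod.ext (by change g * (P.a i u)⁻¹ = g; rw [hia, inv_one, mul_one]) hζ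
  have hJ : P.shearMap E j (g, ⟨u, ζ⟩) = (g', ⟨𝒪.emb j u, E.map j u ζ⟩) :=
    Prod.ext (by change g * (P.a j u)⁻¹ = g'; rw [hja, mul_inv_rev, inv_inv,
      mul_inv_cancel_left]) rfl
  refine ⟨c₃, i, j, (g, ⟨u, ζ⟩), hI, hJ.trans ?_⟩
  have h : P.sweep β c' (g', ⟨𝒪.emb j u, E.map j u ζ⟩) = P.sweep β c' (g', ⟨𝒪.emb j u, ξ'⟩) := by
    rw [← heq, ← hI, hβ, ← hJ, hβ]
  exact congrArg (fun ζ' => (g', (⟨_, ζ'⟩ : (E.bundle c').Total)))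
    ((β c' g' (𝒪.emb j u)).injective (TotalOf.snd_eq h))

variable (E)

/-- A chart whose slice passes through the point `x`. -/
noncomputable def chart (x : M) : 𝒪.Chart := (P.exists_φ_eq x).choose

/-- The coordinate of the point `x` in the chart `P.chart x`. -/
noncomputable def coord (x : M) : 𝒪.V (P.chart x) := (P.exists_φ_eq x).choose_spec.choose

theorem φ_coord (x : M) : P.φ (P.chart x) (P.coord x) = x :=
  (P.exists_φ_eq x).choose_spec.choose_spec

/-- The fibre at `x` of the pull-back of `E`: the fibre of `E` at the coordinate of `x` in a chosen
chart. -/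
def pullbackFiber (x : M) : Type := (E.bundle (P.chart x)).fiber (P.coord x)

noncomputable instance (x : M) : AddCommGroup (P.pullbackFiber E x) :=
  inferInstanceAs (AddCommGroup ((E.bundle (P.chart x)).fiber (P.coord x)))

noncomputable instance (x : M) : Module ℂ (P.pullbackFiber E x) :=
  inferInstanceAs (Module ℂ ((E.bundle (P.chart x)).fiber (P.coord x)))

/-- The isomorphism of a fibre of `E` with the fibre of the pull-back at the point `x = g • φ v`. -/
noncomputable def toPullbackFiber {c : 𝒪.Chart} (v : 𝒪.V c) (x : M) (g : G)
    (h : g • P.φ c v = x) : (E.bundle c).fiber v ≃ₗ[ℂ] P.pullbackFiber E x :=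
  P.transport E v (P.coord x) g (h.trans (P.φ_coord x).symm)

/-- The map `(g, e) ↦ g • e` of `G × E_c` to the total space of the pull-back of `E`. -/
noncomputable def totalPull (c : 𝒪.Chart) (p : G × (E.bundle c).Total) :
    TotalOf (P.pullbackFiber E) :=
  ⟨p.1 • P.φ c p.2.proj, P.toPullbackFiber E p.2.proj _ p.1 rfl p.2.snd⟩

/-- The total space of the pull-back of `E` is topologized as a quotient of the spaces `G × E_c`. -/
noncomputable instance : TopologicalSpace (TotalOf (P.pullbackFiber E)) :=
  ⨆ c, TopologicalSpace.coinduced (P.totalPull E c) inferInstance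

theorem continuous_totalPull (c : 𝒪.Chart) : Continuous (P.totalPull E c) :=
  continuous_iSup_rng (i := c) continuous_coinduced_rng

variable {E}

theorem mk_toPullbackFiber {c : 𝒪.Chart} {v : 𝒪.V c} {x : M} {g : G} (h : g • P.φ c v = x)
    (ξ : (E.bundle c).fiber v) :
    (⟨x, P.toPullbackFiber E v x g h ξ⟩ : TotalOf (P.pullbackFiber E)) =
      P.totalPull E c (g, ⟨v, ξ⟩) := by
  subst h
  rfl

theorem toPullbackFiber_transport {c c' : 𝒪.Chart} {v : 𝒪.V c} {v' : 𝒪.V c'} {x : M} {g g' : G}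
    (h : g • P.φ c v = P.φ c' v') (h' : g' • P.φ c' v' = x) (h'' : (g' * g) • P.φ c v = x)
    (ξ : (E.bundle c).fiber v) :
    P.toPullbackFiber E v' x g' h' (P.transport E v v' g h ξ) =
      P.toPullbackFiber E v x (g' * g) h'' ξ :=
  P.transport_trans _ _ _ _

theorem totalPull_transport {c c' : 𝒪.Chart} {v : 𝒪.V c} {v' : 𝒪.V c'} {g : G} (g' : G)
    (h : g • P.φ c v = P.φ c' v') (ξ : (E.bundle c).fiber v) :
    P.totalPull E c' (g', ⟨v', P.transport E v v' g h ξ⟩) =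
      P.totalPull E c (g' * g, ⟨v, ξ⟩) := by
  rw [← P.mk_toPullbackFiber (x := (g' * g) • P.φ c v) (by rw [mul_smul, h]),
    ← P.mk_toPullbackFiber rfl, P.toPullbackFiber_transport h]

theorem totalPull_totalMap {c c' : 𝒪.Chart} (i : 𝒪.Inj c c') (g : G) (e : (E.bundle c).Total) :
    P.totalPull E c' (g * (P.a i e.proj)⁻¹, E.totalMap i e) = P.totalPull E c (g, e) := by
  have h := P.totalPull_transport (g * (P.a i e.proj)⁻¹) (P.a_smul i e.proj) e.snd
  rw [P.transport_inj, inv_mul_cancel_right] at h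
  exact h

theorem exists_totalPull_eq (f : TotalOf (P.pullbackFiber E)) :
    ∃ (c : 𝒪.Chart) (p : G × (E.bundle c).Total), P.totalPull E c p = f := by
  obtain ⟨x, ξ⟩ := f
  have h : (1 : G) • P.φ (P.chart x) (P.coord x) = x := by rw [one_smul, P.φ_coord]
  exact ⟨P.chart x, (1, ⟨P.coord x, (P.toPullbackFiber E _ x 1 h).symm ξ⟩), by
    rw [← P.mk_toPullbackFiber h, LinearEquiv.apply_symm_apply]⟩

theorem totalPull_shearMap {c c' : 𝒪.Chart} (i : 𝒪.Inj c c') (p : G × (E.bundle c).Total) :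
    P.totalPull E c' (P.shearMap E i p) = P.totalPull E c p :=
  P.totalPull_totalMap i p.1 p.2

variable (E)

/-- The quotient map of `G × E_c` to the pull-back is open: two of its points with the same image
are related by injections of a third chart, which give open maps. -/
theorem isOpenMap_totalPull [IsTopologicalGroup G] (c : 𝒪.Chart) :
    IsOpenMap (P.totalPull E c) := by
  intro O hO
  refine isOpen_iSup_iff.2 fun c' => isOpen_coinduced.2 (isOpen_iff_mem_nhds.2 ?_)
  rintro p' ⟨p, hp, heq⟩
  obtain ⟨c₃, i, j, q, rfl, rfl⟩ := P.exists_shearMap_eq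
    (β := fun c g v => P.toPullbackFiber E v _ g rfl) (fun i p => P.totalPull_shearMap i p) heq
  refine Filter.mem_of_superset ((P.isOpenMap_shearMap E j).image_mem_nhds
    ((P.continuous_shearMap E i).continuousAt.preimage_mem_nhds (hO.mem_nhds hp))) ?_
  rintro _ ⟨q', hq', rfl⟩
  exact ⟨_, hq', by rw [P.totalPull_shearMap, P.totalPull_shearMap]⟩

theorem continuous_pullback_proj [ContinuousSMul G M] :
    Continuous (TotalOf.proj : TotalOf (P.pullbackFiber E) → M) :=
  continuous_iSup_dom.2 fun c => continuous_coinduced_dom.2 <|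
    continuous_fst.smul ((P.continuous_φ c).comp
      ((E.bundle c).continuous_proj.comp continuous_snd))

theorem pullback_locally_trivial [IsTopologicalGroup G] [ContinuousSMul G M] (x : M) :
    ∃ (U : Opens M) (k : ℕ) (φ : ∀ y : U, P.pullbackFiber E y ≃ₗ[ℂ] (Fin k → ℂ)),
      x ∈ U ∧
      Continuous (fun e : {e : TotalOf (P.pullbackFiber E) // e.proj ∈ U} =>
        φ ⟨e.1.proj, e.2⟩ e.1.snd) ∧
      Continuous (fun p : U × (Fin k → ℂ) =>
        (⟨p.1, (φ p.1).symm p.2⟩ : TotalOf (P.pullbackFiber E))) := by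
  obtain ⟨c, v, hv⟩ := P.exists_φ_eq x
  obtain ⟨U₀, k, ψ, hU₀, hψ, hψ'⟩ := (E.bundle c).locally_trivial v
  obtain ⟨e₀, he₀, he₀f⟩ := P.isLocalHomeomorph c (1, v)
  -- over the image of `e` a point is uniquely `g • φ w` with `(g, w)` in the source of `e`, and the
  -- trivialization of `E` near `v` is transported along `g`
  let e := e₀.restrOpen (Prod.snd ⁻¹' (U₀ : Set (𝒪.V c))) (U₀.isOpen.preimage continuous_snd)
  have hef : ∀ p, e p = p.1 • P.φ c p.2 := fun p => (congrFun he₀f p).symm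
  have heU : ∀ p ∈ e.source, p.2 ∈ U₀ := fun p hp => hp.2
  have hev : ((1 : G), v) ∈ e.source := ⟨he₀, hU₀⟩
  let U : Opens M := ⟨e.target, e.open_target⟩
  have hsm : ∀ y : U, (e.symm y).2 ∈ U₀ := fun y => heU _ (e.map_target y.2)
  have hsy : ∀ y : U, (e.symm y).1 • P.φ c (e.symm y).2 = y := fun y => by
    rw [← hef, e.right_inv y.2]
  let T : ∀ y : U, (E.bundle c).fiber (e.symm y).2 ≃ₗ[ℂ] P.pullbackFiber E y := fun y =>
    P.toPullbackFiber E (e.symm y).2 y (e.symm y).1 (hsy y)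
  refine ⟨U, k, fun y => (T y).symm.trans (ψ ⟨(e.symm y).2, hsm y⟩), ?_, ?_, ?_⟩
  · have := e.map_source hev
    rwa [hef, one_smul, hv] at this
  · let S : Set (G × (E.bundle c).Total) := {p | (p.1, p.2.proj) ∈ e.source}
    have hS : IsOpen S := e.open_source.preimage
      (continuous_fst.prodMk ((E.bundle c).continuous_proj.comp continuous_snd))
    have hSU : ∀ p ∈ S, (P.totalPull E c p).proj ∈ U := fun p hp => by
      have := e.map_source hp
      rwa [hef] at this
    let q : S → {f : TotalOf (P.pullbackFiber E) // f.proj ∈ U} := fun p =>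
      ⟨P.totalPull E c p, hSU p p.2⟩
    have hqc : Continuous q :=
      ((P.continuous_totalPull E c).comp continuous_subtype_val).subtype_mk _
    have hqo : IsOpenMap q := by
      refine IsOpenMap.subtype_mk ?_ _
      exact (P.isOpenMap_totalPull E c).comp hS.isOpenMap_subtype_val
    have hqs : Function.Surjective q := by
      rintro ⟨⟨y, ξ⟩, hy⟩
      refine ⟨⟨((e.symm y).1, ⟨(e.symm y).2, (T ⟨y, hy⟩).symm ξ⟩), e.map_target hy⟩, ?_⟩
      refine Subtype.ext ?_
      refine (P.mk_toPullbackFiber (hsy ⟨y, hy⟩) _).symm.trans ?_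
      exact congrArg (TotalOf.mk y) ((T ⟨y, hy⟩).apply_symm_apply ξ)
    -- the trivialization is continuous after composition with the quotient map `q`
    refine (hqo.isQuotientMap hqc hqs).continuous_iff.2 ?_
    have h0 : Continuous fun p : S =>
        (⟨p.1.2, heU _ p.2⟩ : {e : (E.bundle c).Total // e.proj ∈ U₀}) :=
      (continuous_snd.comp continuous_subtype_val).subtype_mk _
    have h1 : Continuous fun p : S => ψ ⟨p.1.2.proj, heU _ p.2⟩ p.1.2.snd :=
      hψ.comp h0
    refine h1.congr ?_
    rintro ⟨⟨g, w, ξ⟩, hp⟩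
    have hy : g • P.φ c w ∈ U := hSU _ hp
    have hs : e.symm (g • P.φ c w) = (g, w) := by
      rw [← hef (g, w)]
      exact e.left_inv hp
    have key : ∀ (g' : G) (w' : 𝒪.V c) (hw' : w' ∈ U₀) (h' : g' • P.φ c w' = g • P.φ c w),
        (g', w') = (g, w) → ψ ⟨w, heU _ hp⟩ ξ = ψ ⟨w', hw'⟩
          ((P.toPullbackFiber E w' _ g' h').symm (P.toPullbackFiber E w _ g rfl ξ)) := by
      rintro g' w' hw' h' hgw
      cases hgw
      rw [LinearEquiv.symm_apply_apply]
    exact key _ _ (hsm ⟨_, hy⟩) (hsy ⟨_, hy⟩) hs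
  · have hs : Continuous fun y : U => e.symm y :=
      e.continuousOn_symm.comp_continuous continuous_subtype_val fun y => y.2
    have h1 : Continuous fun p : U × (Fin k → ℂ) => (⟨(e.symm p.1).2,
        (ψ ⟨(e.symm p.1).2, hsm p.1⟩).symm p.2⟩ : (E.bundle c).Total) :=
      hψ'.comp (((continuous_snd.comp (hs.comp continuous_fst)).subtype_mk
        fun p => hsm p.1).prodMk continuous_snd)
    refine ((P.continuous_totalPull E c).comp
      ((continuous_fst.comp (hs.comp continuous_fst)).prodMk h1)).congr ?_
    intro p
    exact (P.mk_toPullbackFiber (hsy p.1) _).symm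

/-- The action of `G` on the pull-back of `E`, given by the transport of fibres. -/
noncomputable def pullbackAct (g : G) (x : M) :
    P.pullbackFiber E x ≃ₗ[ℂ] P.pullbackFiber E (g • x) :=
  P.toPullbackFiber E (P.coord x) (g • x) g (by rw [P.φ_coord])

variable {E}

theorem pullbackAct_totalPull {c : 𝒪.Chart} (h : G) (p : G × (E.bundle c).Total) :
    (⟨h • (P.totalPull E c p).proj, P.pullbackAct E h _ (P.totalPull E c p).snd⟩ :
      TotalOf (P.pullbackFiber E)) = P.totalPull E c (h * p.1, p.2) := by
  refine (P.mk_toPullbackFiber _ _).trans ?_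
  exact P.totalPull_transport h _ _

variable (E)

/-- The pull-back of an orbifold vector bundle to the space that presents the orbifold. -/
noncomputable def pullback [IsTopologicalGroup G] [ContinuousSMul G M] :
    EquivariantVectorBundle G M where
  fiber := P.pullbackFiber E
  continuous_proj := P.continuous_pullback_proj E
  locally_trivial := P.pullback_locally_trivial E
  act := P.pullbackAct E
  continuous_act := by
    refine continuous_iff_continuousAt.2 ?_
    rintro ⟨h, f⟩
    obtain ⟨c, p, rfl⟩ := P.exists_totalPull_eq f
    refine (IsOpenMap.id.prodMap (P.isOpenMap_totalPull E c)).continuousAt_of_comp (x := (h, p)) ?_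
    have h1 : Continuous fun q : G × G × (E.bundle c).Total =>
        P.totalPull E c (q.1 * q.2.1, q.2.2) :=
      (P.continuous_totalPull E c).comp ((continuous_fst.mul (continuous_fst.comp
        continuous_snd)).prodMk (continuous_snd.comp continuous_snd))
    exact (h1.congr fun q => (P.pullbackAct_totalPull q.1 q.2).symm).continuousAt
  act_one x ξ := by
    obtain ⟨c, p, hp⟩ := P.exists_totalPull_eq (⟨x, ξ⟩ : TotalOf (P.pullbackFiber E))
    have h := P.pullbackAct_totalPull 1 p
    rw [hp, one_mul] at h
    exact h.trans hp
  act_mul g h x ξ := by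
    obtain ⟨c, p, hp⟩ := P.exists_totalPull_eq (⟨x, ξ⟩ : TotalOf (P.pullbackFiber E))
    have h1 := P.pullbackAct_totalPull (g * h) p
    have h2 := P.pullbackAct_totalPull h p
    have h3 := P.pullbackAct_totalPull g (h * p.1, p.2)
    rw [hp] at h1 h2
    rw [← h2, ← mul_assoc] at h3
    exact h1.trans h3.symm

theorem isPullback_pullback [IsTopologicalGroup G] [ContinuousSMul G M] :
    P.IsPullback E (P.pullback E) := by
  refine ⟨fun c g v => P.toPullbackFiber E v _ g rfl, P.continuous_totalPull E, ?_, ?_⟩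
  · intro c c' i g v ξ
    exact P.totalPull_totalMap i g ⟨v, ξ⟩
  · intro c g h v ξ
    exact (P.pullbackAct_totalPull g (h, ⟨v, ξ⟩)).symm

end ActionPresentation

end Pullback

/-! ### Uniqueness of the pull-back, descent and K-groups -/

section Descent

theorem ComplexVectorBundle.pullback_ext {B B' : Type*} [TopologicalSpace B] [TopologicalSpace B']
    {E : ComplexVectorBundle B} {f : B' → B} {hf : Continuous f} {e e' : (E.pullback f hf).Total}
    (h : e.proj = e'.proj)
    (h' : (⟨f e.proj, e.snd⟩ : E.Total) = ⟨f e'.proj, e'.snd⟩) : e = e' := by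
  obtain ⟨x, ξ⟩ := e
  obtain ⟨x', ξ'⟩ := e'
  change x = x' at h
  subst h
  exact congrArg (TotalOf.mk x) (TotalOf.snd_eq (P := E.fiber) h')

namespace EquivariantVectorBundle

variable {G M : Type*} [Group G] [TopologicalSpace G] [TopologicalSpace M] [MulAction G M]
  (F : EquivariantVectorBundle G M)

/-- The action of an element of `G` on the total space of an equivariant vector bundle. -/
def totalAct (g : G) (f : F.Total) : F.Total := ⟨g • f.proj, F.act g f.proj f.snd⟩

theorem totalAct_mul (g h : G) (f : F.Total) : F.totalAct (g * h) f = F.totalAct g (F.totalAct h f) :=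
  F.act_mul g h f.proj f.snd

end EquivariantVectorBundle

namespace ActionPresentation

variable {n : ℕ} {X : Type*} [TopologicalSpace X] {𝒪 : OrbifoldAtlas n X}
  {G M : Type*} [Group G] [TopologicalSpace G] [TopologicalSpace M] [MulAction G M]
  (P : ActionPresentation 𝒪 G M)

/-- The maps `G × E_c → F` of a pull-back `F` of `E` are open, being bundle maps over open maps. -/
theorem isOpenMap_sweep [ContinuousSMul G M] {E : OrbifoldVectorBundle 𝒪}
    {F : EquivariantVectorBundle G M}
    {β : ∀ (c : 𝒪.Chart) (g : G) (v : 𝒪.V c), (E.bundle c).fiber v ≃ₗ[ℂ] F.fiber (g • P.φ c v)}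
    {c : 𝒪.Chart} (hβ : Continuous (P.sweep β c : _ → F.Total)) :
    IsOpenMap (P.sweep β c : _ → F.Total) := by
  let B := (E.bundle c).pullback (Prod.snd : G × 𝒪.V c → 𝒪.V c) continuous_snd
  let r : B.Total → G × (E.bundle c).Total := fun e => (e.proj.1, ⟨e.proj.2, e.snd⟩)
  have hr : Continuous r := by
    have h := ComplexVectorBundle.continuous_pullbackProj (E.bundle c)
      (Prod.snd : G × 𝒪.V c → 𝒪.V c) continuous_snd
    exact (continuous_fst.comp (continuous_fst.comp h)).prodMk (continuous_snd.comp h)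
  have hrs : Function.Surjective r := fun p => ⟨⟨(p.1, p.2.proj), p.2.snd⟩, rfl⟩
  have h : IsOpenMap (P.sweep β c ∘ r : _ → F.Total) :=
    ComplexVectorBundle.isOpenMap_of_fiberwise B F.toComplexVectorBundle
      (P.isLocalHomeomorph c).continuous (P.isLocalHomeomorph c).isOpenMap
      (fun p => β c p.1 p.2) (hβ.comp hr)
  intro O hO
  rw [← Set.image_preimage_eq O hrs, ← Set.image_comp]
  exact h _ (hO.preimage hr)

theorem exists_one_smul_φ_eq (x : M) : ∃ (c : 𝒪.Chart) (v : 𝒪.V c), (1 : G) • P.φ c v = x := by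
  obtain ⟨c, v, hv⟩ := P.exists_φ_eq x
  exact ⟨c, v, by rw [one_smul, hv]⟩

variable {P}

/-- The pull-back is unique up to isomorphism, and functorial for isomorphisms. -/
theorem IsPullback.isomorphic [ContinuousSMul G M] {E E' : OrbifoldVectorBundle 𝒪}
    {F F' : EquivariantVectorBundle G M} (h : P.IsPullback E F) (h' : P.IsPullback E' F')
    (hE : E.Isomorphic E') : F.Isomorphic F' := by
  obtain ⟨β, hβ, hβi, hβa⟩ := h
  obtain ⟨β', hβ', hβi', hβa'⟩ := h'
  obtain ⟨δ, hδ⟩ := hE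
  let D : ∀ c, G × (E.bundle c).Total → G × (E'.bundle c).Total := fun c p =>
    (p.1, ⟨p.2.proj, (δ c).equiv p.2.proj p.2.snd⟩)
  have hD : ∀ c, Continuous (D c) := fun c =>
    continuous_fst.prodMk ((δ c).continuous_equiv.comp continuous_snd)
  have hDs : ∀ {c c' : 𝒪.Chart} (i : 𝒪.Inj c c') p,
      D c' (P.shearMap E i p) = P.shearMap E' i (D c p) := by
    intro c c' i p
    exact congrArg (fun ζ => (p.1 * (P.a i p.2.proj)⁻¹, (⟨_, ζ⟩ : (E'.bundle c').Total)))
      (hδ c c' i p.2.proj p.2.snd)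
  have hs : ∀ {c c' : 𝒪.Chart} (i : 𝒪.Inj c c') p,
      P.sweep β c' (P.shearMap E i p) = P.sweep β c p := fun i p => hβi _ _ i p.1 p.2.proj p.2.snd
  have hs' : ∀ {c c' : 𝒪.Chart} (i : 𝒪.Inj c c') p,
      P.sweep β' c' (P.shearMap E' i p) = P.sweep β' c p := fun i p =>
    hβi' _ _ i p.1 p.2.proj p.2.snd
  -- points with the same image in `F` have the same image in `F'`
  have hwd : ∀ {c c' : 𝒪.Chart} (p : G × (E.bundle c).Total) (p' : G × (E.bundle c').Total),
      P.sweep β c p = P.sweep β c' p' → P.sweep β' c (D c p) = P.sweep β' c' (D c' p') := by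
    intro c c' p p' heq
    obtain ⟨c₃, i, j, q, rfl, rfl⟩ := P.exists_shearMap_eq hs heq
    rw [hDs, hDs, hs', hs']
  have hex : ∀ x, ∃ f : F.fiber x ≃ₗ[ℂ] F'.fiber x, ∀ (c : 𝒪.Chart) p (η : F.fiber x),
      P.sweep β c p = ⟨x, η⟩ → P.sweep β' c (D c p) = ⟨x, f η⟩ := by
    intro x
    obtain ⟨c, v, rfl⟩ := P.exists_one_smul_φ_eq x
    refine ⟨((β c 1 v).symm.trans ((δ c).equiv v)).trans (β' c 1 v), fun c' p η hp => ?_⟩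
    have h1 : P.sweep β c (1, ⟨v, (β c 1 v).symm η⟩) = ⟨(1 : G) • P.φ c v, η⟩ :=
      congrArg (TotalOf.mk _) ((β c 1 v).apply_symm_apply η)
    exact hwd _ _ (hp.trans h1.symm)
  choose f hf using hex
  let t : F.Total → F'.Total := fun e => ⟨e.proj, f e.proj e.snd⟩
  have ht : ∀ (c : 𝒪.Chart) p, t (P.sweep β c p) = P.sweep β' c (D c p) := fun c p =>
    (hf _ c p _ rfl).symm
  have hsurj : ∀ e : F.Total, ∃ (c : 𝒪.Chart) (p : G × (E.bundle c).Total), P.sweep β c p = e := by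
    rintro ⟨x, η⟩
    obtain ⟨c, v, rfl⟩ := P.exists_one_smul_φ_eq x
    exact ⟨c, (1, ⟨v, (β c 1 v).symm η⟩),
      congrArg (TotalOf.mk _) ((β c 1 v).apply_symm_apply η)⟩
  -- the maps `G × E_c → F` are open, so continuity can be checked after composition with them
  have htc : Continuous t := by
    refine continuous_iff_continuousAt.2 fun e => ?_
    obtain ⟨c, p, rfl⟩ := hsurj e
    refine (P.isOpenMap_sweep (F := F) (hβ c)).continuousAt_of_comp ?_
    exact (((hβ' c).comp (hD c)).congr fun q => (ht c q).symm).continuousAt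
  refine ⟨ComplexVectorBundle.Iso.ofContinuous f htc, fun g x ξ => TotalOf.snd_eq ?_⟩
  obtain ⟨c, p, hp⟩ := hsurj ⟨x, ξ⟩
  have h1 : P.sweep β c (g * p.1, p.2) = F.totalAct g (P.sweep β c p) := hβa c g p.1 p.2.proj p.2.snd
  have h2 : P.sweep β' c (D c (g * p.1, p.2)) = F'.totalAct g (P.sweep β' c (D c p)) :=
    hβa' c g p.1 p.2.proj _
  rw [← ht, ← ht, h1, hp] at h2
  exact h2

/-- A bundle isomorphic to a pull-back is a pull-back. -/
theorem IsPullback.of_isomorphic {E : OrbifoldVectorBundle 𝒪} {F F' : EquivariantVectorBundle G M}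
    (h : P.IsPullback E F) (hF : F.Isomorphic F') : P.IsPullback E F' := by
  obtain ⟨β, hβ, hβi, hβa⟩ := h
  obtain ⟨f, hf⟩ := hF
  let t : F.Total → F'.Total := fun e => ⟨e.proj, f.equiv e.proj e.snd⟩
  refine ⟨fun c g v => (β c g v).trans (f.equiv _), fun c => f.continuous_equiv.comp (hβ c),
    fun c c' i g v ξ => congrArg t (hβi c c' i g v ξ), fun c g h v ξ => ?_⟩
  refine (congrArg t (hβa c g h v ξ)).trans ?_
  exact congrArg (TotalOf.mk _) (hf g (h • P.φ c v) (β c h v ξ))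

theorem IsPullback.sum {E E' : OrbifoldVectorBundle 𝒪} {F F' : EquivariantVectorBundle G M}
    (h : P.IsPullback E F) (h' : P.IsPullback E' F') : P.IsPullback (E.sum E') (F.sum F') := by
  obtain ⟨β, hβ, hβi, hβa⟩ := h
  obtain ⟨β', hβ', hβi', hβa'⟩ := h'
  refine ⟨fun c g v => (β c g v).prodCongr (β' c g v), fun c => ?_,
    fun c c' i g v ξ => TotalOf.mk_prod_eq (hβi c c' i g v ξ.1) (hβi' c c' i g v ξ.2),
    fun c g h v ξ => TotalOf.mk_prod_eq (hβa c g h v ξ.1) (hβa' c g h v ξ.2)⟩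
  have hs := ComplexVectorBundle.continuous_sumProj (E.bundle c) (E'.bundle c)
  exact ComplexVectorBundle.continuous_to_sum
    (((hβ c).comp (continuous_fst.prodMk (continuous_fst.comp (hs.comp continuous_snd)))).prodMk
      ((hβ' c).comp (continuous_fst.prodMk (continuous_snd.comp (hs.comp continuous_snd)))))

variable (P)

/-- The orbifold vector bundle of an equivariant vector bundle `F`: its restriction to the slices,
an injection acting through the action of `G` on `F`. -/
def descend (F : EquivariantVectorBundle G M) : OrbifoldVectorBundle 𝒪 where
  bundle c := F.toComplexVectorBundle.pullback (P.φ c) (P.continuous_φ c)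
  map {c c'} i v := (F.act (P.a i v) (P.φ c v)).trans (F.castFiber (P.a_smul i v))
  continuous_map {c c'} i := by
    have h := ComplexVectorBundle.continuous_pullbackProj F.toComplexVectorBundle
      (P.φ c) (P.continuous_φ c)
    have hp := continuous_fst.comp h
    refine ComplexVectorBundle.continuous_to_pullback (Continuous.prodMk
      ((𝒪.emb_isLocalDiffeomorph i).contMDiff.continuous.comp hp) ?_)
    refine (F.continuous_act.comp (Continuous.prodMk
      ((P.continuous_a i).comp hp) (continuous_snd.comp h))).congr ?_
    intro e
    exact (F.mk_castFiber (P.a_smul i e.proj) _).symm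
  map_comp {c c' c''} j i v ξ := by
    refine ComplexVectorBundle.pullback_ext (𝒪.emb_comp j i v) ?_
    refine (F.mk_castFiber (P.a_smul _ v) _).trans (Eq.trans ?_ (F.mk_castFiber (P.a_smul j _) _).symm)
    change F.totalAct (P.a (𝒪.comp j i) v) ⟨P.φ c v, ξ⟩ = F.totalAct (P.a j (𝒪.emb i v)) ⟨_, _⟩
    rw [P.a_comp, F.totalAct_mul]
    exact congrArg _ (F.mk_castFiber (P.a_smul i v) _).symm

/-- An equivariant vector bundle is the pull-back of the orbifold vector bundle to which it
descends. -/
theorem isPullback_descend (F : EquivariantVectorBundle G M) : P.IsPullback (P.descend F) F := by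
  refine ⟨fun c g v => F.act g (P.φ c v), fun c => ?_, fun c c' i g v ξ => ?_,
    fun c g h v ξ => F.act_mul g h (P.φ c v) ξ⟩
  · have h := ComplexVectorBundle.continuous_pullbackProj F.toComplexVectorBundle
      (P.φ c) (P.continuous_φ c)
    exact F.continuous_act.comp (continuous_fst.prodMk (continuous_snd.comp (h.comp continuous_snd)))
  · have h : F.totalAct (g * (P.a i v)⁻¹) ⟨P.φ c' (𝒪.emb i v), (P.descend F).map i v ξ⟩ =
        F.totalAct (g * (P.a i v)⁻¹) (F.totalAct (P.a i v) ⟨P.φ c v, ξ⟩) :=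
      congrArg _ (F.mk_castFiber (P.a_smul i v) _)
    rw [← F.totalAct_mul, inv_mul_cancel_right] at h
    exact h

variable {P}

/-- An orbifold vector bundle is recovered from its pull-back, by restriction to the slices. -/
theorem IsPullback.isomorphic_descend {E : OrbifoldVectorBundle 𝒪} {F : EquivariantVectorBundle G M}
    (h : P.IsPullback E F) : E.Isomorphic (P.descend F) := by
  obtain ⟨β, hβ, hβi, hβa⟩ := h
  have hs : ∀ (c : 𝒪.Chart) (v : 𝒪.V c) ξ,
      (⟨P.φ c v, F.castFiber (one_smul G _) (β c 1 v ξ)⟩ : F.Total) = P.sweep β c (1, ⟨v, ξ⟩) :=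
    fun c v ξ => F.mk_castFiber (one_smul G _) _
  refine ⟨fun c => ComplexVectorBundle.Iso.ofContinuous
    (fun v => (β c 1 v).trans (F.castFiber (one_smul G _))) ?_, fun c c' i v ξ => ?_⟩
  · refine ComplexVectorBundle.continuous_to_pullback (hf := P.continuous_φ c)
      ((E.bundle c).continuous_proj.prodMk ?_)
    exact ((hβ c).comp (continuous_const.prodMk continuous_id)).congr
      fun e => (hs c e.proj e.snd).symm
  -- the compatibility of `β` with the injection at `g = a i v` and the equivariance of `β`
  · refine TotalOf.snd_eq (P := F.fiber) (x := P.φ c' (𝒪.emb i v)) ?_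
    refine (hs c' (𝒪.emb i v) (E.map i v ξ)).trans (Eq.trans ?_ (F.mk_castFiber (P.a_smul i v) _).symm)
    have h1 : P.sweep β c' (P.a i v * (P.a i v)⁻¹, ⟨𝒪.emb i v, E.map i v ξ⟩) =
      P.sweep β c (P.a i v, ⟨v, ξ⟩) := hβi c c' i (P.a i v) v ξ
    have h2 : P.sweep β c (P.a i v * 1, ⟨v, ξ⟩) = F.totalAct (P.a i v) (P.sweep β c (1, ⟨v, ξ⟩)) :=
      hβa c (P.a i v) 1 v ξ
    rw [mul_inv_cancel] at h1
    rw [mul_one, ← hs] at h2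
    exact h1.trans h2

variable (P)

/-- Pull-back is an isomorphism of the monoids of isomorphism classes of bundles. -/
noncomputable def isoClassEquiv [IsTopologicalGroup G] [ContinuousSMul G M] :
    OrbifoldVectorBundle.IsoClass 𝒪 ≃+ EquivariantVectorBundle.IsoClass G M where
  toFun := Quotient.map (fun E => P.pullback E) fun E E' h =>
    (P.isPullback_pullback E).isomorphic (P.isPullback_pullback E') h
  invFun := Quotient.map P.descend fun F F' h =>
    ((P.isPullback_descend F).of_isomorphic h).isomorphic_descend
  left_inv := by
    rintro ⟨E⟩
    exact Quotient.sound (OrbifoldVectorBundle.isomorphic_equivalence.symm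
      (P.isPullback_pullback E).isomorphic_descend)
  right_inv := by
    rintro ⟨F⟩
    exact Quotient.sound ((P.isPullback_pullback _).isomorphic (P.isPullback_descend F)
      (OrbifoldVectorBundle.isomorphic_equivalence.refl _))
  map_add' := by
    rintro ⟨E⟩ ⟨E'⟩
    exact Quotient.sound ((P.isPullback_pullback _).isomorphic
      ((P.isPullback_pullback E).sum (P.isPullback_pullback E'))
      (OrbifoldVectorBundle.isomorphic_equivalence.refl _))

theorem isoClassEquiv_mk [IsTopologicalGroup G] [ContinuousSMul G M] {E : OrbifoldVectorBundle 𝒪}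
    {F : EquivariantVectorBundle G M} (h : P.IsPullback E F) :
    P.isoClassEquiv (Quotient.mk _ E) = Quotient.mk _ F :=
  Quotient.sound ((P.isPullback_pullback E).isomorphic h
    (OrbifoldVectorBundle.isomorphic_equivalence.refl _))

end ActionPresentation

theorem Algebra.GrothendieckAddGroup.lift_of {A B : Type*} [AddCommMonoid A] [AddCommGroup B]
    (f : A →+ B) (x : A) : Algebra.GrothendieckAddGroup.lift f (Algebra.GrothendieckAddGroup.of x) =
      f x :=
  DFunLike.congr_fun (Algebra.GrothendieckAddGroup.lift.symm_apply_apply f) x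

theorem Algebra.GrothendieckAddGroup.hom_ext {A B : Type*} [AddCommMonoid A] [AddCommGroup B]
    {f g : Algebra.GrothendieckAddGroup A →+ B}
    (h : ∀ x, f (Algebra.GrothendieckAddGroup.of x) = g (Algebra.GrothendieckAddGroup.of x)) :
    f = g :=
  Algebra.GrothendieckAddGroup.lift.symm.injective (DFunLike.ext _ _ h)

/-- An isomorphism of commutative monoids extends to their Grothendieck groups. -/
noncomputable def AddEquiv.grothendieckCongr {A B : Type*} [AddCommMonoid A] [AddCommMonoid B]
    (e : A ≃+ B) : Algebra.GrothendieckAddGroup A ≃+ Algebra.GrothendieckAddGroup B :=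
  AddMonoidHom.toAddEquiv
    (Algebra.GrothendieckAddGroup.lift (Algebra.GrothendieckAddGroup.of.comp e.toAddMonoidHom))
    (Algebra.GrothendieckAddGroup.lift (Algebra.GrothendieckAddGroup.of.comp e.symm.toAddMonoidHom))
    (Algebra.GrothendieckAddGroup.hom_ext fun x => by
      rw [AddMonoidHom.comp_apply, Algebra.GrothendieckAddGroup.lift_of, AddMonoidHom.comp_apply,
        Algebra.GrothendieckAddGroup.lift_of, AddMonoidHom.comp_apply]
      exact congrArg _ (e.symm_apply_apply x))
    (Algebra.GrothendieckAddGroup.hom_ext fun x => by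
      rw [AddMonoidHom.comp_apply, Algebra.GrothendieckAddGroup.lift_of, AddMonoidHom.comp_apply,
        Algebra.GrothendieckAddGroup.lift_of, AddMonoidHom.comp_apply]
      exact congrArg _ (e.apply_symm_apply x))

theorem AddEquiv.grothendieckCongr_of {A B : Type*} [AddCommMonoid A] [AddCommMonoid B]
    (e : A ≃+ B) (x : A) : e.grothendieckCongr (Algebra.GrothendieckAddGroup.of x) =
      Algebra.GrothendieckAddGroup.of (e x) :=
  Algebra.GrothendieckAddGroup.lift_of (Algebra.GrothendieckAddGroup.of.comp e.toAddMonoidHom) x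

end Descent

/-! ### The quotient orbifold -/

section QuotientOrbifoldPresentation

variable {d m : ℕ} {G M : Type*}
    [Group G] [TopologicalSpace G] [ChartedSpace (EuclideanSpace ℝ (Fin d)) G]
    [LieGroup (𝓡 d) ∞ G] [T2Space G]
    [TopologicalSpace M] [ChartedSpace (EuclideanSpace ℝ (Fin m)) M]
    [MulAction G M]

/-- An injection of slice charts is determined by its group element at one point, since two
injections differ by a constant element of the local group. -/
theorem SliceInjection.eq_of_a_eq {c c' : SliceChart d m G M} (i j : SliceInjection c c')
    (u : c.V) (h : i.a u = j.a u) : i = j := by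
  have : IsTopologicalGroup G := topologicalGroup_of_lieGroup (𝓡 d) ∞
  obtain ⟨k, hk⟩ := i.exists_const j.a j.contMDiff_a.continuous fun v => ⟨_, j.a_smul v⟩
  have h1 : (k : G) = 1 := by
    have := hk u
    rw [h] at this
    exact mul_eq_right.1 this.symm
  refine SliceInjection.ext_a (funext fun v => ?_)
  rw [hk, h1, one_mul]

variable [IsManifold (𝓡 m) ∞ M] [ContMDiffSMul (𝓡 d) (𝓡 m) ∞ G M] [ProperSMul G M]

variable (d m G M) in
/-- The quotient orbifold is presented by the action of `G` on `M`. -/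
def quotientPresentation (hfinite : ∀ x : M, Finite (MulAction.stabilizer G x)) :
    ActionPresentation (quotientOrbifold d m G M) G M where
  φ c := SliceChart.φ c
  continuous_φ c := SliceChart.continuous_φ c
  isLocalHomeomorph c := (SliceChart.isLocalDiffeomorph c).isLocalHomeomorph
  a i := SliceInjection.a i
  continuous_a i := (SliceInjection.contMDiff_a i).continuous
  a_smul i := SliceInjection.a_smul i
  a_comp _ _ _ := rfl
  eq_of_a_eq i j u h := SliceInjection.eq_of_a_eq i j u h
  exists_φ_eq x := by
    have := hfinite x
    exact SliceChart.exists_φ_eq x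
  exists_refinement {c c'} v v' g h := SliceChart.exists_refinement c c' v v' g h

theorem isOrbifold_quotientOrbifold [SecondCountableTopology M]
    (hfinite : ∀ x : M, Finite (MulAction.stabilizer G x)) :
    (quotientOrbifold d m G M).IsOrbifold where
  t2Space := t2Space_quotient_mulAction_of_properSMul
  secondCountable := ContinuousConstSMul.secondCountableTopology
  cover := by
    rintro ⟨x⟩
    obtain ⟨c, v, hv⟩ := (quotientPresentation d m G M hfinite).exists_φ_eq x
    exact ⟨c, v, congrArg (Quotient.mk _) hv⟩
  compatible := by
    rintro c₁ c₂ _ ⟨v₁, rfl⟩ ⟨v₂, h⟩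
    obtain ⟨g, hg⟩ := MulAction.orbitRel_apply.1 (Quotient.exact h)
    obtain ⟨c₃, i, j, u, rfl, -⟩ :=
      (quotientPresentation d m G M hfinite).exists_refinement v₁ v₂ g hg
    exact ⟨c₃, ⟨u, ((quotientOrbifold d m G M).π_emb i u).symm⟩, ⟨i⟩, ⟨j⟩⟩

end QuotientOrbifoldPresentation

theorem mainTheorem10 {d m : ℕ} {G M : Type*}
    [Group G] [TopologicalSpace G] [ChartedSpace (EuclideanSpace ℝ (Fin d)) G]
    [LieGroup (𝓡 d) ∞ G] [T2Space G]
    [TopologicalSpace M] [ChartedSpace (EuclideanSpace ℝ (Fin m)) M] [IsManifold (𝓡 m) ∞ M]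
    [T2Space M] [SecondCountableTopology M]
    [MulAction G M] [ContMDiffSMul (𝓡 d) (𝓡 m) ∞ G M] [ProperSMul G M]
    [CompactSpace (MulAction.orbitRel.Quotient G M)]
    (hfinite : ∀ x : M, Finite (MulAction.stabilizer G x)) :
    (quotientOrbifold d m G M).IsOrbifold ∧
    (∀ E : OrbifoldVectorBundle (quotientOrbifold d m G M),
      ∃ F : EquivariantVectorBundle G M, IsPullback E F) ∧
    (∀ (E E' : OrbifoldVectorBundle (quotientOrbifold d m G M))
      (F F' : EquivariantVectorBundle G M),
      IsPullback E F → IsPullback E' F' → E.Isomorphic E' → F.Isomorphic F') ∧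
    ∃ pStar : OrbifoldK (quotientOrbifold d m G M) ≃+ EquivariantK G M,
      (∀ (E : OrbifoldVectorBundle (quotientOrbifold d m G M)) (F : EquivariantVectorBundle G M),
        IsPullback E F → pStar E.toK = F.toK) ∧
      (∀ F : EquivariantVectorBundle G M,
        pStar.symm F.toK = (F.quotient (d := d) (m := m)).toK) := by
  have : IsTopologicalGroup G := topologicalGroup_of_lieGroup (𝓡 d) ∞
  let P := quotientPresentation d m G M hfinite
  have hP : ∀ E F, IsPullback E F ↔ P.IsPullback E F := fun _ _ => Iff.rfl
  have hK : ∀ (E : OrbifoldVectorBundle (quotientOrbifold d m G M)) (F : EquivariantVectorBundle G M),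
      IsPullback E F → P.isoClassEquiv.grothendieckCongr E.toK = F.toK := fun E F h =>
    (P.isoClassEquiv.grothendieckCongr_of _).trans (congrArg _ (P.isoClassEquiv_mk ((hP E F).1 h)))
  refine ⟨isOrbifold_quotientOrbifold hfinite, fun E => ⟨P.pullback E, P.isPullback_pullback E⟩,
    fun E E' F F' h h' hE => ((hP E F).1 h).isomorphic ((hP E' F').1 h') hE,
    P.isoClassEquiv.grothendieckCongr, hK, fun F => ?_⟩
  have hF : F.quotient (d := d) (m := m) = P.descend F := rfl
  rw [AddEquiv.symm_apply_eq, hF]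
  exact (hK _ F (P.isPullback_descend F)).symm
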